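/- Conventions. All spaces are Hausdorff. $\mathbb{L}_{\ge 0}$ is the closed long ray $\omega_1\times[0,1)$ with the lexicographic order topology, and $\alpha\in\omega_1$ is identified with $\langle\alpha,0\rangle$. A space $X$ is *Type I* if it is not Lindelöf and $X=\bigcup_{\alpha<\omega_1}X_\alpha$ with $X_\alpha$ open, $\overline{X_\alpha}$ Lindelöf and $\overline{X_\alpha}\subset X_\beta$ for $\alpha<\beta$. A subset of $X$ is *unbounded* if it is contained in no $X_\alpha$, and *club* if it is closed and unbounded. For $A,B\subset X$ write $A\preceq B$ if every continuous $f:X\to\mathbb{L}_{\ge0}$ that is unbounded on $A$ is unbounded on $B$. A *direction* in $X$ is a club $D\subset X$ such that $D\preceq E\preceq D$ for each club $E\subset D$. *Discrete* means discrete in the subspace topology. $X$ is *locally metrizable* (*locally separable*) if each point has a metrizable (separable) neighbourhood; *$\omega_1$-compact* if all its closed discrete subsets are countable; *$\omega$-bounded* if closures of countable subsets are compact; *collectionwise Hausdorff* if for each closed discrete $D\subset X$ there are pairwise disjoint open sets $U_x\ni x$, $x\in D$. A *manifold* of dimension $n$ is a connected (Hausdorff) space each of whose points has a neighbourhood homeomorphic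 to $\mathbb{R}^n$; in a *manifold with boundary* neighbourhoods homeomorphic to $\mathbb{R}^{n-1}\times[0,\infty)$ are also allowed. A *surface* is a 2-manifold. $\neg\mathbf{SH}$ says that there is a Suslin tree. A sequence $\langle X_\alpha\rangle$ is *canonical* if $X_0=\emptyset$ and $X_\alpha=\bigcup_{\beta<\alpha}X_\beta$ for limit $\alpha$. A *gentle slicer* on a surface $S$ that is Type I with canonical sequence $\langle S_\alpha\rangle$ is a continuous $s:S\to\mathbb{L}_{\ge0}$ such that $s(\overline{S_{\alpha+1}}\setminus S_\alpha)\subset[\alpha,\alpha+1]$ for all $\alpha<\omega_1$, and for each $\alpha<\omega_1$ there is $\theta:S_\alpha\setminus s^{-1}(\{0\})\to\mathbb{S}^1$ for which $x\mapsto\langle\theta(x),s(x)\rangle$ is a homeomorphism from $S_\alpha\setminus s^{-1}(\{0\})$ onto $\mathbb{S}^1\times(0,\alpha)$. *Nyikos' claim* is the assertion that $\diamondsuit^+$ implies that there is an $\omega$-bounded Type I surface containing no direction. **Theorem 7.7.** (a) There is a Type I, locally metrizable, locally separable space $X$ that possesses a discrete direction and in which every club contains a club discrete subset. (b) If $\diamondsuit^*$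 holds, there is a collectionwise Hausdorff space as in (a). (c) If $\neg\mathbf{SH}$ holds, there is a Type I, locally metrizable, locally separable space that possesses a discrete direction and a dense $\omega_1$-compact subspace, and in which every direction contains a club discrete subset. (d) Suppose that Nyikos' claim is correct and that $\diamondsuit^+$ holds. Then there is a space $X$ as in (c) whose dense $\omega_1$-compact subspace is a manifold that is a countable union of $\omega$-bounded submanifolds, possibly with boundary (that is, subspaces that are manifolds with or without boundary). Moreover, if $N$ is an $\omega$-bounded Type I surface that contains no direction and possesses a gentle slicer, then there is such an $X$ which is itself a 3-manifold. -/

import Mathlib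

open Set Topology

noncomputable section

/-- The set `ω₁` of countable ordinals. -/
abbrev Omega1 : Type 1 := Set.Iio (Ordinal.omega.{0} 1)

namespace Omega1

/-- The ordinal `0`, as an element of `ω₁`. -/
def zero : Omega1 := ⟨0, Ordinal.omega_pos 1⟩

/-- The successor `α + 1`, as an element of `ω₁`. -/
def succ (α : Omega1) : Omega1 :=
  ⟨Order.succ α.1, (Cardinal.isSuccLimit_omega 1).succ_lt α.2⟩

/-- Closed and unbounded subsets of `ω₁`. -/
def IsClub (C : Set Omega1) : Prop :=
  (∀ α : Omega1, ∃ β ∈ C, α < β) ∧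
    ∀ δ : Omega1, Order.IsSuccLimit δ → (∀ α < δ, ∃ β ∈ C, α < β ∧ β < δ) → δ ∈ C

end Omega1

/-- The principle `◇*`. -/
def DiamondStar : Prop :=
  ∃ 𝒜 : Omega1 → Set (Set Omega1),
    (∀ α, (𝒜 α).Countable ∧ ∀ S ∈ 𝒜 α, S ⊆ Iio α) ∧
    ∀ A : Set Omega1, ∃ C, Omega1.IsClub C ∧ ∀ α ∈ C, A ∩ Iio α ∈ 𝒜 α

/-- The principle `◇⁺`. -/
def DiamondPlus : Prop :=
  ∃ 𝒜 : Omega1 → Set (Set Omega1),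
    (∀ α, (𝒜 α).Countable ∧ ∀ S ∈ 𝒜 α, S ⊆ Iio α) ∧
    ∀ A : Set Omega1, ∃ C, Omega1.IsClub C ∧
      ∀ α ∈ C, A ∩ Iio α ∈ 𝒜 α ∧ C ∩ Iio α ∈ 𝒜 α

/-- A Suslin tree: a tree (a partial order in which the predecessors of each element are
well ordered) of cardinality `ℵ₁` all of whose chains and antichains are countable. -/
structure IsSuslinTree (T : Type) [PartialOrder T] : Prop where
  wellOrdered : ∀ t : T, IsWellOrder (Iio t) (· < ·)
  card : Cardinal.mk T = Cardinal.aleph 1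
  chain : ∀ C : Set T, IsChain (· ≤ ·) C → C.Countable
  antichain : ∀ A : Set T, IsAntichain (· ≤ ·) A → A.Countable

/-- The negation of the Suslin hypothesis: there is a Suslin tree. -/
def NotSH : Prop := ∃ (T : Type) (_ : PartialOrder T), IsSuslinTree T

/-- The closed long ray `ω₁ × [0,1)`, with the lexicographic order. -/
abbrev LongRay : Type 1 := Omega1 ×ₗ Ico (0 : ℝ) 1

/-- The order topology of the closed long ray. -/
instance LongRay.topology : TopologicalSpace LongRay := Preorder.topology LongRay

/-- The point `⟨α, 0⟩` of the closed long ray. -/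
def LongRay.ofOmega1 (α : Omega1) : LongRay :=
  toLex (α, ⟨0, le_refl 0, zero_lt_one⟩)

/-- A sequence `⟨X_α : α < ω₁⟩` witnessing that `X` is a (non-Lindelöf) Type I space. -/
structure TypeI (X : Type) [TopologicalSpace X] where
  seq : Omega1 → Set X
  isOpen_seq : ∀ α, IsOpen (seq α)
  isLindelof_closure : ∀ α, IsLindelof (closure (seq α))
  closure_subset : ∀ α β, α < β → closure (seq α) ⊆ seq β
  iUnion_seq : ⋃ α, seq α = univ
  not_lindelof : ¬ LindelofSpace X

section TypeI

variable {X : Type} [TopologicalSpace X]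

/-- The sequence is canonical (continuous at limits), and starts with the empty set. -/
def TypeI.IsCanonical (F : TypeI X) : Prop :=
  F.seq Omega1.zero = ∅ ∧
    ∀ δ : Omega1, Order.IsSuccLimit δ → F.seq δ = ⋃ β ∈ Iio δ, F.seq β

/-- A subset of a Type I space is unbounded if it is contained in no `X_α`. -/
def TypeI.Unbounded (F : TypeI X) (A : Set X) : Prop := ∀ α, ¬ A ⊆ F.seq α

/-- Closed and unbounded subsets of a Type I space. -/
def TypeI.IsClub (F : TypeI X) (D : Set X) : Prop := IsClosed D ∧ F.Unbounded D

/-- The unbounded function order: every continuous map into the closed long ray which is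
unbounded on `A` is unbounded on `B`. -/
def UfoLE (A B : Set X) : Prop :=
  ∀ f : X → LongRay, Continuous f → ¬ BddAbove (f '' A) → ¬ BddAbove (f '' B)

/-- A direction: a club set which is ufo-equivalent to each of its club subsets. -/
def TypeI.IsDirection (F : TypeI X) (D : Set X) : Prop :=
  F.IsClub D ∧ ∀ E ⊆ D, F.IsClub E → UfoLE D E ∧ UfoLE E D

/-- A slicer, relative to the given sequence. -/
def TypeI.IsSlicer (F : TypeI X) (s : X → LongRay) : Prop :=
  Continuous s ∧ ∀ α : Omega1, ∀ x ∈ closure (F.seq (Omega1.succ α)) \ F.seq α,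
    s x ∈ Icc (LongRay.ofOmega1 α) (LongRay.ofOmega1 (Omega1.succ α))

/-- A gentle slicer: for each `α` there is a homeomorphism `x ↦ ⟨θ x, s x⟩` from
`X_α - s⁻¹{0}` onto `S¹ × (0, α)`. -/
def TypeI.IsGentleSlicer (F : TypeI X) (s : X → LongRay) : Prop :=
  F.IsSlicer s ∧ ∀ α : Omega1,
    ∃ h : ↥(F.seq α \ s ⁻¹' {LongRay.ofOmega1 Omega1.zero}) ≃ₜ
        Circle × ↥(Ioo (LongRay.ofOmega1 Omega1.zero) (LongRay.ofOmega1 α)),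
      ∀ x, ((h x).2 : LongRay) = s x

end TypeI

section Properties

variable (X : Type) [TopologicalSpace X]

/-- Each point has a metrizable neighbourhood. -/
def LocallyMetrizable : Prop :=
  ∀ x : X, ∃ U ∈ 𝓝 x, TopologicalSpace.MetrizableSpace ↥U

/-- Each point has a separable neighbourhood. -/
def LocallySeparable : Prop :=
  ∀ x : X, ∃ U ∈ 𝓝 x, TopologicalSpace.SeparableSpace ↥U

/-- `ω₁`-compactness: closed discrete subsets are countable. -/
def Omega1Compact : Prop :=
  ∀ D : Set X, IsClosed D → DiscreteTopology ↥D → D.Countable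

/-- `ω`-boundedness: countable subsets have compact closure. -/
def OmegaBounded : Prop :=
  ∀ S : Set X, S.Countable → IsCompact (closure S)

/-- Collectionwise Hausdorff: each closed discrete set can be expanded to a disjoint
collection of open sets. -/
def CollectionwiseHausdorff : Prop :=
  ∀ D : Set X, IsClosed D → DiscreteTopology ↥D →
    ∃ U : X → Set X, (∀ x ∈ D, IsOpen (U x) ∧ x ∈ U x) ∧ D.PairwiseDisjoint U

/-- Topological manifolds of dimension `n` (Hausdorff and connected, not necessarily second
countable, without boundary). -/
structure IsTopManifold (n : ℕ) : Prop where
  t2 : T2Space X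
  connected : ConnectedSpace X
  chart : ∀ x : X, ∃ U ∈ 𝓝 x, Nonempty (↥U ≃ₜ EuclideanSpace ℝ (Fin n))

/-- Topological manifolds of dimension `n`, possibly with boundary: boundary points have
neighbourhoods homeomorphic to `ℝ^(n-1) × [0,∞)`. -/
structure IsTopManifoldWithBoundary (n : ℕ) : Prop where
  t2 : T2Space X
  connected : ConnectedSpace X
  chart : ∀ x : X, ∃ U ∈ 𝓝 x,
    Nonempty (↥U ≃ₜ EuclideanSpace ℝ (Fin n)) ∨
      ∃ k, n = k + 1 ∧ Nonempty (↥U ≃ₜ EuclideanSpace ℝ (Fin k) × ↥(Ici (0 : ℝ)))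

end Properties

section Examples

variable {X : Type} [TopologicalSpace X]

/-- `E` is a closed, unbounded and discrete subset. -/
def TypeI.IsClubDiscrete (F : TypeI X) (E : Set X) : Prop :=
  F.IsClub E ∧ DiscreteTopology ↥E

/-- `X` is Hausdorff, locally metrizable, locally separable and has a discrete direction. -/
structure TypeI.HasDiscreteDirection (F : TypeI X) : Prop where
  t2 : T2Space X
  locallyMetrizable : LocallyMetrizable X
  locallySeparable : LocallySeparable X
  discreteDirection : ∃ D : Set X, F.IsDirection D ∧ DiscreteTopology ↥D

/-- `X` is Hausdorff, locally metrizable, locally separable, has a discrete direction, and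
every club subset of it contains a club discrete subset. -/
def TypeI.ClubsContainDiscrete (F : TypeI X) : Prop :=
  F.HasDiscreteDirection ∧ ∀ C : Set X, F.IsClub C → ∃ E ⊆ C, F.IsClubDiscrete E

/-- `X` is Hausdorff, locally metrizable, locally separable, has a discrete direction, every
direction in it contains a club discrete subset, and `M` is a dense `ω₁`-compact subspace. -/
def TypeI.DirectionsContainDiscrete (F : TypeI X) (M : Set X) : Prop :=
  F.HasDiscreteDirection ∧ Dense M ∧ Omega1Compact ↥M ∧
    ∀ D : Set X, F.IsDirection D → ∃ E ⊆ D, F.IsClubDiscrete E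

/-- `M` is a topological manifold and a countable union of `ω`-bounded subspaces, each of
which is a topological manifold, possibly with boundary. -/
def IsManifoldUnionOmegaBounded (M : Set X) : Prop :=
  (∃ n, IsTopManifold ↥M n) ∧
    ∃ K : ℕ → Set X, M = ⋃ i, K i ∧
      ∀ i, OmegaBounded ↥(K i) ∧ ∃ m, IsTopManifoldWithBoundary ↥(K i) m

end Examples

/-- An `ω`-bounded (non-Lindelöf) Type I surface containing no direction. -/
def IsDirectionlessSurface (N : Type) [TopologicalSpace N] : Prop :=
  IsTopManifold N 2 ∧ OmegaBounded N ∧ ∃ F : TypeI N, ∀ D : Set N, ¬ F.IsDirection D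

/-- `N` possesses a gentle slicer (for some canonical sequence). -/
def HasGentleSlicer (N : Type) [TopologicalSpace N] : Prop :=
  ∃ F : TypeI N, F.IsCanonical ∧ ∃ s : N → LongRay, F.IsGentleSlicer s

/-- Nyikos' claim: `◇⁺` implies that there is an `ω`-bounded surface without direction. -/
def NyikosClaim : Prop :=
  DiamondPlus → ∃ (N : Type) (_ : TopologicalSpace N), IsDirectionlessSurface N

end

/-! All the discrete directions arise in one way (`TypeI.isDirection_of_rigid`). A club `D` is a
direction if a continuous `f` into the long ray that is small on uncountably many points of `D`
cannot also be arbitrarily large on uncountably many others. In each space the points of `D` pass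
their values on to auxiliary points, and two unbounded sets of auxiliary points always have a common
limit. There `f` would have to be at most `a` and at least `b` for some `a < b`.

For (a) and (c) a single space on `ω₁` suffices. Fix `S` such that `S` and its complement are
stationary and the complement consists of limit ordinals, and let a limit ordinal be approached only
through `S`. The complement of `S` is then a discrete direction. Every club meets it in an unbounded
set because the complement is stationary, and `S` is dense and `ω₁`-compact because `S` is
stationary.

For (b) the points of the direction are tips of columns of isolated points, and nodes are limits of
isolated points taken from cofinally many columns. To make the space collectionwise Hausdorff, `◇*`
guesses sets of nodes and makes a new node a limit of guessed nodes. A closed discrete set then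
contains nodes at nonstationarily many heights only (`exists_fertile`,
`not_stationary_of_isClosed_discrete`), and the club avoiding these heights cuts it into countable
groups. On the other hand every unbounded set of nodes has to contain a club discrete set. For this
an injection `r` of `ω₁` into the reals is used: a node is approached only along increasing values
of `r`, controlled by rational approximations `q` (`Block.spec`). A set of nodes on which an
approximation is constant therefore does not accumulate.

For (d), take a directionless `ω`-bounded surface `N` and the product `N × ℝ`. Remove the walls `N ×
{i}` at the integers, except for an open annulus, the gate, in each. What remains is a connected
3-manifold and a countable union of `ω`-bounded pieces, hence `ω₁`-compact. A direction without club
discrete subsets must be unbounded in one slab. Its projection to `N` is not a direction, and the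
map showing this extends over the whole space because it is bounded on the gates
(`exists_isClubDiscrete_of_slabs`).

A discrete direction is added at infinity. In the first space one point is put at the end of each
layer of `N`. In the manifold a plane is glued to the ends of a tube for each countable ordinal. The
tubes have to pierce the walls, and two devices repair the damage. First, there is a map `h` which
is unbounded on `N` but bounded on a club; the windows of the tubes lie where `h` is large in even
walls and where it is small in odd walls, so that a sufficiently slow map can be cut off by `h` in
one slab and by a constant in the next (`exists_extension_of_le`). Secondly, between two walls each
tube winds once around `N`; since homotopies of `ω`-bounded spaces move values in the long ray
boundedly (`OmegaBounded.exists_bound`), the value at the end of a tube controls a whole circle, and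
circles accumulate at limit levels. -/

noncomputable section

/-! ### Countable ordinals: closure points, stationary sets, pressing down -/

/-- A copy of `ω₁` in the lowest universe. -/
abbrev Om1 : Type := (Ordinal.omega.{0} 1).ToType

namespace Om1

/-- The order isomorphism with the set of countable ordinals. -/
def iso : Om1 ≃o Omega1 := Ordinal.ToType.mk.symm

theorem countable_Iio (a : Om1) : (Iio a).Countable := by
  have h : (Iio (iso a)).Countable := by
    have h1 : ((iso a).1).card < Cardinal.aleph 1 := by
      have := (iso a).2
      rw [mem_Iio] at this
      exact Cardinal.lt_omega_iff_card_lt.1 this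
    have h2 : (Iio (iso a).1).Countable := by
      rw [← Cardinal.le_aleph0_iff_set_countable, Cardinal.mk_Iio_ordinal]
      rw [Cardinal.lt_aleph_one_iff] at h1
      exact Cardinal.lift_le_aleph0.2 h1
    exact h2.preimage Subtype.val_injective
  exact (h.preimage iso.injective).mono fun b hb => iso.lt_iff_lt.2 hb

theorem uncountable : ¬ (univ : Set Om1).Countable := by
  intro h
  have := Cardinal.mk_toType (Ordinal.omega.{0} 1)
  rw [← Cardinal.le_aleph0_iff_set_countable, Cardinal.mk_univ, this] at h
  simp at h

theorem countable_Iic (a : Om1) : (Iic a).Countable := by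
  rw [← Iio_union_right]
  exact (countable_Iio a).union (countable_singleton a)

theorem exists_gt_of_countable {s : Set Om1} (hs : s.Countable) : ∃ b, ∀ a ∈ s, a < b := by
  by_contra! h
  refine uncountable ((hs.biUnion fun a _ => countable_Iic a).mono fun b _ => ?_)
  obtain ⟨a, ha, hb⟩ := h b
  exact mem_biUnion ha hb

theorem exists_gt_range {ι : Type*} [Countable ι] (f : ι → Om1) : ∃ b, ∀ i, f i < b := by
  obtain ⟨b, hb⟩ := exists_gt_of_countable (countable_range f)
  exact ⟨b, fun i => hb _ ⟨i, rfl⟩⟩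

instance : NoMaxOrder Om1 :=
  ⟨fun a => by
    obtain ⟨b, hb⟩ := exists_gt_of_countable (countable_singleton a)
    exact ⟨b, hb a rfl⟩⟩

instance : Nonempty Om1 := by
  by_contra h
  rw [not_nonempty_iff] at h
  exact uncountable (to_countable _)

theorem countable_of_bounded {s : Set Om1} {b : Om1} (h : ∀ a ∈ s, a ≤ b) : s.Countable :=
  (countable_Iic b).mono h

theorem unbounded_of_uncountable {s : Set Om1} (hs : ¬ s.Countable) (b : Om1) :
    ∃ a ∈ s, b < a := by
  by_contra! h
  exact hs (countable_of_bounded h)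

/-- An uncountable set cut into countably many pieces has an uncountable piece. -/
theorem exists_uncountable_fiber {ι α : Type*} [Countable ι] {s : Set α} (hs : ¬ s.Countable)
    (P : α → ι → Prop) (hP : ∀ a ∈ s, ∃ i, P a i) : ∃ i, ¬ {a ∈ s | P a i}.Countable := by
  by_contra! h
  refine hs ((countable_iUnion h).mono fun a ha => ?_)
  obtain ⟨i, hi⟩ := hP a ha
  exact mem_iUnion.2 ⟨i, ha, hi⟩

/-- Limit ordinals. -/
def IsLim (a : Om1) : Prop := (∃ b, b < a) ∧ ∀ b < a, ∃ c, b < c ∧ c < a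

/-- The limit ordinals closed under a function. -/
def Closure (G : Om1 → Om1) : Set Om1 := {d | IsLim d ∧ ∀ a < d, G a < d}

/-- The witness is the least strict upper bound of the orbit; minimality makes the orbit cofinal in
it. -/
theorem exists_iterate (f : Om1 → Om1) (hf : ∀ a, a < f a) (b : Om1) :
    ∃ d, IsLim d ∧ (∀ n, f^[n] b < d) ∧ ∀ a < d, ∃ n, a < f^[n] b := by
  obtain ⟨c, hc⟩ := exists_gt_range fun n => f^[n] b
  obtain ⟨d, hd, hmin⟩ := WellFounded.has_min (wellFounded_lt (α := Om1))
    {d | ∀ n, f^[n] b < d} ⟨c, hc⟩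
  have key : ∀ a < d, ∃ n, a < f^[n] b := by
    intro a ha
    by_contra! h
    refine hmin a (fun n => ?_) ha
    refine lt_of_lt_of_le ?_ (h (n + 1))
    rw [Function.iterate_succ_apply']
    exact hf _
  refine ⟨d, ⟨⟨b, hd 0⟩, fun a ha => ?_⟩, hd, key⟩
  obtain ⟨n, hn⟩ := key a ha
  exact ⟨_, hn, hd n⟩

/-- The sets `Closure G` play the part of the clubs. For unboundedness, iterate a function that
dominates `G` on whole initial segments. -/
theorem exists_mem_closure (G : Om1 → Om1) (b : Om1) : ∃ d ∈ Closure G, b < d := by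
  have h : ∀ a, ∃ c, a < c ∧ ∀ a' ≤ a, G a' < c := by
    intro a
    obtain ⟨c, hc⟩ := exists_gt_of_countable
      (((countable_Iic a).image G).union (countable_singleton a))
    exact ⟨c, hc _ (Or.inr rfl), fun a' h => hc _ (Or.inl ⟨a', h, rfl⟩)⟩
  choose f hf hG using h
  obtain ⟨d, hlim, hd, hd'⟩ := exists_iterate f hf b
  refine ⟨d, ⟨hlim, fun a ha => ?_⟩, hd 0⟩
  obtain ⟨n, hn⟩ := hd' a ha
  refine lt_trans (hG _ a hn.le) ?_
  rw [← Function.iterate_succ_apply' f]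
  exact hd _

/-- A pointwise bound of countably many functions. This is how countably many clubs are intersected.
-/
theorem exists_closure_subset {ι : Type*} [Countable ι] (G : ι → Om1 → Om1) :
    ∃ H, ∀ i, Closure H ⊆ Closure (G i) := by
  choose H hH using fun a => exists_gt_range fun i => G i a
  exact ⟨H, fun i d hd => ⟨hd.1, fun a ha => (hH a i).trans (hd.2 a ha)⟩⟩

theorem exists_closure_subset_two (G G' : Om1 → Om1) :
    ∃ H, Closure H ⊆ Closure G ∧ Closure H ⊆ Closure G' := by
  obtain ⟨H, hH⟩ := exists_closure_subset fun b : Bool => if b then G else G'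
  exact ⟨H, by simpa using hH true, by simpa using hH false⟩

/-- The limit points of an unbounded set contain the closure points of a function. -/
theorem exists_closure_limit {A : Set Om1} (hA : ∀ b, ∃ a ∈ A, b < a) :
    ∃ G, ∀ d ∈ Closure G, ∀ b < d, ∃ a ∈ A, b < a ∧ a < d := by
  choose G hG hG' using hA
  exact ⟨G, fun d hd b hb => ⟨G b, hG b, hG' b, hd.2 b hb⟩⟩

/-- Stationary sets: those that contain, for each function, a limit ordinal closed under it. -/
def Stationary (S : Set Om1) : Prop := ∀ G, (S ∩ Closure G).Nonempty

theorem Stationary.mono {S T : Set Om1} (hS : Stationary S) (h : S ⊆ T) : Stationary T :=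
  fun G => (hS G).mono (inter_subset_inter_left _ h)

theorem Stationary.inter_closure {S : Set Om1} (hS : Stationary S) (G : Om1 → Om1) :
    Stationary (S ∩ Closure G) := by
  intro H
  obtain ⟨K, hK, hK'⟩ := exists_closure_subset_two G H
  obtain ⟨d, hd, hdK⟩ := hS K
  exact ⟨d, ⟨hd, hK hdK⟩, hK' hdK⟩

theorem Stationary.unbounded {S : Set Om1} (hS : Stationary S) (b : Om1) : ∃ a ∈ S, b < a := by
  obtain ⟨d, hd, hdG⟩ := hS fun _ => b
  obtain ⟨c, hc⟩ := hdG.1.1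
  exact ⟨d, hd, hdG.2 c hc⟩

/-- The nonstationary ideal is countably complete. -/
theorem Stationary.exists_of_countable_cover {ι : Type*} [Countable ι] {S : Set Om1}
    (hS : Stationary S) (P : Om1 → ι → Prop) (hP : ∀ a ∈ S, ∃ i, P a i) :
    ∃ i, Stationary {a ∈ S | P a i} := by
  by_contra! h
  simp only [Stationary, not_forall] at h
  choose G hG using h
  obtain ⟨H, hH⟩ := exists_closure_subset G
  obtain ⟨d, hd, hdH⟩ := hS H
  obtain ⟨i, hi⟩ := hP d hd
  exact hG i ⟨d, ⟨hd, hi⟩, hH i hdH⟩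

/-- The pressing down lemma. -/
theorem Stationary.exists_fiber {S : Set Om1} (hS : Stationary S) (P : Om1 → Om1 → Prop)
    (hP : ∀ a ∈ S, IsLim a → ∃ b < a, P a b) : ∃ b, Stationary {a ∈ S | P a b} := by
  by_contra! h
  simp only [Stationary, not_forall] at h
  choose G hG using h
  -- The function `H` obtained from this has its closure points in the diagonal intersection of the
  -- sets `Closure (G b)`.
  have h : ∀ a, ∃ c, ∀ b ≤ a, ∀ a' ≤ a, G b a' < c := by
    intro a
    obtain ⟨c, hc⟩ := exists_gt_of_countable
      (((countable_Iic a).prod (countable_Iic a)).image fun p => G p.1 p.2)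
    exact ⟨c, fun b hb a' ha' => hc _ ⟨(b, a'), ⟨hb, ha'⟩, rfl⟩⟩
  choose H hH using h
  obtain ⟨d, hd, hdH⟩ := hS H
  obtain ⟨b, hbd, hb⟩ := hP d hd hdH.1
  refine hG b ⟨d, ⟨hd, hb⟩, hdH.1, fun a ha => ?_⟩
  exact (hH (max a b) b (le_max_right _ _) a (le_max_left _ _)).trans
    (hdH.2 _ (max_lt ha hbd))

/-- Choosing points of increasing heights, with gaps below. -/
theorem exists_sparse {Y : Type*} (ht : Y → Om1) (P : Om1 → Y → Prop)
    (h : ∀ i b, ∃ y, P i y ∧ b < ht y) :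
    ∃ (e : Om1 → Y) (b : Om1 → Om1),
      ∀ i, P i (e i) ∧ b i < ht (e i) ∧ ∀ j < i, ht (e j) ≤ b i := by
  have hb : ∀ (i : Om1) (f : ∀ j, j < i → Y), ∃ b, ∀ j (hj : j < i), ht (f j hj) < b := by
    intro i f
    have : Countable (Iio i) := (countable_Iio i).to_subtype
    obtain ⟨b, hb⟩ := exists_gt_range fun j : Iio i => ht (f j.1 j.2)
    exact ⟨b, fun j hj => hb ⟨j, hj⟩⟩
  choose bd hbd using hb
  choose y hy hy' using h
  let e : Om1 → Y := wellFounded_lt.fix fun i f => y i (bd i f)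
  have he : ∀ i, e i = y i (bd i fun j _ => e j) := fun i =>
    wellFounded_lt.fix_eq (fun i f => y i (bd i f)) i
  refine ⟨e, fun i => bd i fun j _ => e j, fun i => ⟨?_, ?_, fun j hj => ?_⟩⟩
  · rw [he]; exact hy _ _
  · conv_rhs => rw [he]
    exact hy' _ _
  · exact (hbd i (fun j _ => e j) j hj).le

theorem IsLim.exists_cofinal {a : Om1} (ha : IsLim a) :
    ∃ f : ℕ → Om1, (∀ n, f n < a) ∧ ∀ b < a, ∃ n, b < f n := by
  obtain ⟨f, hf⟩ := (countable_Iio a).exists_eq_range ha.1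
  refine ⟨f, fun n => ?_, fun b hb => ?_⟩
  · have : f n ∈ Iio a := hf ▸ mem_range_self n
    exact this
  · obtain ⟨c, hbc, hc⟩ := ha.2 b hb
    have : c ∈ range f := hf ▸ hc
    obtain ⟨n, rfl⟩ := this
    exact ⟨n, hbc⟩

theorem exists_injective_real : ∃ r : Om1 → ℝ, Function.Injective r := by
  have h : Cardinal.mk Om1 ≤ Cardinal.mk ℝ := by
    rw [Cardinal.mk_toType, Cardinal.mk_real]
    simpa using Cardinal.aleph_one_le_continuum
  exact ⟨_, (Classical.choice h).injective⟩

/-- There is a stationary set of limit ordinals whose complement is stationary. -/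
theorem exists_costationary : ∃ T : Set Om1, T ⊆ {a | IsLim a} ∧ Stationary T ∧ Stationary Tᶜ := by
  obtain ⟨r, hr⟩ := exists_injective_real
  by_contra! h
  -- If no such set exists, each rational cut of the values of `r` is decided on a club. On the
  -- intersection of these clubs `r` is constant, against injectivity.
  have hdich : ∀ x : ℚ, ∃ G, (∀ a ∈ Closure G, r a < x) ∨ (∀ a ∈ Closure G, x ≤ r a) := by
    intro x
    by_cases hs : Stationary {a | IsLim a ∧ r a < x}
    · have := h _ (fun a ha => ha.1) hs
      simp only [Stationary, not_forall] at this
      obtain ⟨G, hG⟩ := this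
      refine ⟨G, Or.inl fun a ha => ?_⟩
      by_contra hx
      exact hG ⟨a, fun h' => hx h'.2, ha⟩
    · simp only [Stationary, not_forall] at hs
      obtain ⟨G, hG⟩ := hs
      refine ⟨G, Or.inr fun a ha => ?_⟩
      by_contra! hx
      exact hG ⟨a, ⟨ha.1, hx⟩, ha⟩
  choose G hG using hdich
  obtain ⟨H, hH⟩ := exists_closure_subset G
  obtain ⟨a, ha, -⟩ := exists_mem_closure H (Classical.arbitrary Om1)
  obtain ⟨b, hb, hab⟩ := exists_mem_closure H a
  have key : ∀ a b, a ∈ Closure H → b ∈ Closure H → ¬ r a < r b := by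
    intro a b ha hb hlt
    obtain ⟨x, hx, hx'⟩ := exists_rat_btwn hlt
    rcases hG x with h1 | h1
    · exact lt_asymm hx' (h1 b (hH x hb))
    · exact hx.not_ge (h1 a (hH x ha))
  rcases lt_trichotomy (r a) (r b) with h1 | h1 | h1
  · exact key a b ha hb h1
  · exact hab.ne (hr h1)
  · exact key b a hb ha h1

end Om1
end

/-! ### The long ray -/

noncomputable section

instance : OrderTopology LongRay := ⟨rfl⟩

namespace LongRay

/-- The point of the long ray given by a countable ordinal. -/
def pt (a : Om1) : LongRay := ofOmega1 (Om1.iso a)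

theorem lt_iff {x y : LongRay} : x < y ↔
    (ofLex x).1 < (ofLex y).1 ∨ (ofLex x).1 = (ofLex y).1 ∧ (ofLex x).2 < (ofLex y).2 :=
  Prod.Lex.lt_iff

theorem le_iff {x y : LongRay} : x ≤ y ↔
    (ofLex x).1 < (ofLex y).1 ∨ (ofLex x).1 = (ofLex y).1 ∧ (ofLex x).2 ≤ (ofLex y).2 :=
  Prod.Lex.le_iff

theorem lt_ofOmega1_iff {x : LongRay} {a : Omega1} : x < ofOmega1 a ↔ (ofLex x).1 < a := by
  rw [lt_iff]
  refine ⟨fun h => h.resolve_right fun h' => ?_, Or.inl⟩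
  exact absurd h'.2 (not_lt.2 (Subtype.coe_le_coe.1 (ofLex x).2.2.1))

theorem ofOmega1_le_iff {x : LongRay} {a : Omega1} : ofOmega1 a ≤ x ↔ a ≤ (ofLex x).1 := by
  rw [← not_lt, lt_ofOmega1_iff, not_lt]

theorem ofOmega1_lt_iff {a b : Omega1} : ofOmega1 a < ofOmega1 b ↔ a < b := lt_ofOmega1_iff

theorem pt_lt_iff {a b : Om1} : pt a < pt b ↔ a < b :=
  lt_ofOmega1_iff.trans Om1.iso.lt_iff_lt

theorem pt_le_iff {a b : Om1} : pt a ≤ pt b ↔ a ≤ b := by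
  rw [← not_lt, pt_lt_iff, not_lt]

theorem exists_lt_pt (x : LongRay) : ∃ a, x < pt a := by
  obtain ⟨a, ha⟩ := exists_gt (Om1.iso.symm (ofLex x).1)
  refine ⟨a, lt_ofOmega1_iff.2 ?_⟩
  have := Om1.iso.lt_iff_lt.2 ha
  rwa [OrderIso.apply_symm_apply] at this

theorem bddAbove_iff {A : Set LongRay} : BddAbove A ↔ ∃ a, ∀ x ∈ A, x < pt a := by
  constructor
  · rintro ⟨b, hb⟩
    obtain ⟨a, ha⟩ := exists_lt_pt b
    exact ⟨a, fun x hx => (hb hx).trans_lt ha⟩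
  · rintro ⟨a, ha⟩
    exact ⟨pt a, fun x hx => (ha x hx).le⟩

theorem bddAbove_of_countable {A : Set LongRay} (hA : A.Countable) : BddAbove A := by
  choose f hf using exists_lt_pt
  obtain ⟨a, ha⟩ := Om1.exists_gt_of_countable (hA.image f)
  exact bddAbove_iff.2 ⟨a, fun x hx => (hf x).trans (pt_lt_iff.2 (ha _ ⟨x, hx, rfl⟩))⟩

theorem bddAbove_image_of_isLindelof {X : Type*} [TopologicalSpace X] {f : X → LongRay}
    (hf : Continuous f) {K : Set X} (hK : IsLindelof K) : BddAbove (f '' K) := by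
  obtain ⟨r, hr, hr'⟩ := hK.elim_countable_subcover (fun a => f ⁻¹' Iio (pt a))
    (fun a => isOpen_Iio.preimage hf) (fun x _ => mem_iUnion.2 (exists_lt_pt (f x)))
  obtain ⟨a, ha⟩ := Om1.exists_gt_of_countable hr
  refine bddAbove_iff.2 ⟨a, ?_⟩
  rintro _ ⟨x, hx, rfl⟩
  obtain ⟨b, hb, hxb⟩ := mem_iUnion₂.1 (hr' hx)
  exact lt_trans hxb (pt_lt_iff.2 (ha b hb))

end LongRay

/-! ### Type I spaces, clubs and directions -/

namespace TypeI

variable {X : Type} [TopologicalSpace X] (F : TypeI X)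

/-- The sequence of a Type I space, indexed in the lowest universe. -/
def stage (a : Om1) : Set X := F.seq (Om1.iso a)

theorem isOpen_stage (a : Om1) : IsOpen (F.stage a) := F.isOpen_seq _

theorem isLindelof_closure_stage (a : Om1) : IsLindelof (closure (F.stage a)) :=
  F.isLindelof_closure _

theorem closure_stage_subset {a b : Om1} (h : a < b) : closure (F.stage a) ⊆ F.stage b :=
  F.closure_subset _ _ (Om1.iso.lt_iff_lt.2 h)

theorem stage_mono {a b : Om1} (h : a ≤ b) : F.stage a ⊆ F.stage b := by
  rcases h.eq_or_lt with rfl | h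
  · exact subset_rfl
  · exact subset_closure.trans (F.closure_stage_subset h)

theorem exists_mem_stage (x : X) : ∃ a, x ∈ F.stage a := by
  have : x ∈ ⋃ α, F.seq α := F.iUnion_seq ▸ mem_univ x
  obtain ⟨α, hα⟩ := mem_iUnion.1 this
  exact ⟨Om1.iso.symm α, by rwa [stage, OrderIso.apply_symm_apply]⟩

theorem unbounded_iff {A : Set X} : F.Unbounded A ↔ ∀ a, ∃ x ∈ A, x ∉ F.stage a := by
  constructor
  · intro h a
    exact not_subset.1 (h (Om1.iso a))
  · intro h α hα
    obtain ⟨x, hx, hx'⟩ := h (Om1.iso.symm α)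
    rw [stage, OrderIso.apply_symm_apply] at hx'
    exact hx' (hα hx)

theorem not_unbounded_iff {A : Set X} : ¬ F.Unbounded A ↔ ∃ a, A ⊆ F.stage a := by
  rw [unbounded_iff]
  push Not
  rfl

theorem exists_subset_stage_of_isLindelof {K : Set X} (hK : IsLindelof K) :
    ∃ a, K ⊆ F.stage a := by
  obtain ⟨r, hr, hr'⟩ := hK.elim_countable_subcover F.stage F.isOpen_stage
    (fun x _ => mem_iUnion.2 (F.exists_mem_stage x))
  obtain ⟨a, ha⟩ := Om1.exists_gt_of_countable hr
  refine ⟨a, fun x hx => ?_⟩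
  obtain ⟨b, hb, hxb⟩ := mem_iUnion₂.1 (hr' hx)
  exact F.stage_mono (ha b hb).le hxb

theorem Unbounded.not_countable {F : TypeI X} {A : Set X} (hA : F.Unbounded A) :
    ¬ A.Countable := by
  intro h
  obtain ⟨a, ha⟩ := F.exists_subset_stage_of_isLindelof h.isLindelof
  exact hA _ ha

theorem Unbounded.diff_stage {F : TypeI X} {A : Set X} (hA : F.Unbounded A) (a : Om1) :
    F.Unbounded (A \ F.stage a) := by
  rw [unbounded_iff] at hA ⊢
  intro b
  obtain ⟨x, hx, hx'⟩ := hA (max a b)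
  exact ⟨x, ⟨hx, fun h => hx' (F.stage_mono (le_max_left _ _) h)⟩,
    fun h => hx' (F.stage_mono (le_max_right _ _) h)⟩

theorem Unbounded.exists_of_countable_cover {ι : Type*} [Countable ι] {F : TypeI X} {A : Set X}
    (hA : F.Unbounded A) {B : ι → Set X} (h : A ⊆ ⋃ i, B i) : ∃ i, F.Unbounded (A ∩ B i) := by
  by_contra! hb
  choose b hb using fun i => F.not_unbounded_iff.1 (hb i)
  obtain ⟨a, ha⟩ := Om1.exists_gt_range b
  refine F.not_unbounded_iff.2 ⟨a, fun x hx => ?_⟩ hA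
  obtain ⟨i, hi⟩ := mem_iUnion.1 (h hx)
  exact F.stage_mono (ha i).le (hb i ⟨hx, hi⟩)

/-- Stages of one sequence have Lindelöf closures, hence lie in stages of the other. The sequence of
a gentle slicer and the sequence for which there is no direction may differ, so this independence is
needed. -/
theorem unbounded_congr (F F' : TypeI X) {A : Set X} (h : F.Unbounded A) : F'.Unbounded A := by
  by_contra h'
  obtain ⟨a, ha⟩ := F'.not_unbounded_iff.1 h'
  obtain ⟨b, hb⟩ := F.exists_subset_stage_of_isLindelof (F'.isLindelof_closure_stage a)
  exact F.not_unbounded_iff.2 ⟨b, (ha.trans subset_closure).trans hb⟩ h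

theorem unbounded_univ : F.Unbounded univ := by
  by_contra h
  obtain ⟨a, ha⟩ := F.not_unbounded_iff.1 h
  refine F.not_lindelof (isLindelof_univ_iff.1 ?_)
  rw [← univ_subset_iff.1 (ha.trans subset_closure)]
  exact F.isLindelof_closure_stage a

/-- Building a Type I structure from a sequence of open sets and Lindelöf sets containing their
closures. -/
def ofStages (S T : Om1 → Set X) (hS : ∀ a, IsOpen (S a)) (hT : ∀ a, IsLindelof (T a))
    (hST : ∀ a, closure (S a) ⊆ T a) (hTS : ∀ a b, a < b → T a ⊆ S b)
    (hcover : ∀ x, ∃ a, x ∈ S a) (hne : ∀ a, ∃ x, x ∉ S a) : TypeI X where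
  seq α := S (Om1.iso.symm α)
  isOpen_seq α := hS _
  isLindelof_closure α := (hT _).of_isClosed_subset isClosed_closure (hST _)
  closure_subset α β h := (hST _).trans (hTS _ _ (Om1.iso.symm.lt_iff_lt.2 h))
  iUnion_seq := by
    refine eq_univ_of_forall fun x => ?_
    obtain ⟨a, ha⟩ := hcover x
    exact mem_iUnion.2 ⟨Om1.iso a, by rwa [OrderIso.symm_apply_apply]⟩
  not_lindelof := by
    intro h
    obtain ⟨r, hr, hr'⟩ := (isLindelof_univ_iff.2 h).elim_countable_subcover S hS
      (fun x _ => mem_iUnion.2 (hcover x))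
    obtain ⟨a, ha⟩ := Om1.exists_gt_of_countable hr
    obtain ⟨x, hx⟩ := hne a
    obtain ⟨b, hb, hxb⟩ := mem_iUnion₂.1 (hr' (mem_univ x))
    exact hx (hTS b a (ha b hb) (hST b (subset_closure hxb)))

theorem stage_ofStages {S T : Om1 → Set X} {hS hT hST hTS hcover hne} (a : Om1) :
    (ofStages (X := X) S T hS hT hST hTS hcover hne).stage a = S a := by
  simp [stage, ofStages]

/-- A club set on which continuous functions into the long ray are either bounded or large on
all but countably many points is a direction. -/
theorem isDirection_of_rigid {F : TypeI X} {D : Set X} (hD : F.IsClub D)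
    (h : ∀ f : X → LongRay, Continuous f → ∀ a, ¬ {x ∈ D | f x < LongRay.pt a}.Countable →
      ∃ b, {x ∈ D | LongRay.pt b < f x}.Countable) : F.IsDirection D := by
  refine ⟨hD, fun E hED hE => ⟨fun f hf hfD hfE => hfD ?_, fun f hf hfE hfD =>
    hfE (hfD.mono (image_mono hED))⟩⟩
  obtain ⟨a, ha⟩ := LongRay.bddAbove_iff.1 hfE
  -- A club is uncountable, because countable sets are Lindelöf and lie in a single stage. So `f` is
  -- small on uncountably many points of `D`, and the countably many exceptional points where it is
  -- large cannot make it unbounded.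
  obtain ⟨b, hb⟩ := h f hf a fun hc => hE.2.not_countable
    (hc.mono (show E ⊆ {x ∈ D | f x < LongRay.pt a} from
      fun x hx => ⟨hED hx, ha _ ⟨x, hx, rfl⟩⟩))
  have : f '' D ⊆ f '' {x ∈ D | LongRay.pt b < f x} ∪ Iic (LongRay.pt b) := by
    rintro _ ⟨x, hx, rfl⟩
    by_cases hb : LongRay.pt b < f x
    · exact Or.inl ⟨x, ⟨hx, hb⟩, rfl⟩
    · exact Or.inr (not_lt.1 hb)
  exact ((LongRay.bddAbove_of_countable (hb.image f)).union bddAbove_Iic).mono this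

/-- An unbounded set that is locally at most a single point is club discrete. -/
theorem isClubDiscrete_of_locally {F : TypeI X} {E : Set X} (hE : F.Unbounded E)
    (h : ∀ x, ∃ U ∈ 𝓝 x, U ∩ E ⊆ {x}) : F.IsClubDiscrete E := by
  have this : IsClosed E ∧ IsDiscrete E := isClosed_and_discrete_iff.2 fun x => by
    obtain ⟨U, hU, hUE⟩ := h x
    rw [Filter.disjoint_principal_right, mem_nhdsWithin_iff_eventually]
    filter_upwards [hU] with y hy hyx hyE
    exact hyx (hUE ⟨hy, hyE⟩)
  exact ⟨⟨this.1, hE⟩, this.2.to_subtype⟩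

end TypeI

/-- A countable space with bases of clopen sets is separable and metrizable. -/
theorem metrizable_separable_of_countable {Y : Type*} [TopologicalSpace Y] [Countable Y] [T2Space Y]
    (B : Y → ℕ → Set Y) (hB : ∀ y k, IsClopen (B y k))
    (hbasis : ∀ y, ∀ U ∈ 𝓝 y, ∃ k, B y k ⊆ U) (hmem : ∀ y k, y ∈ B y k) :
    TopologicalSpace.MetrizableSpace Y ∧ TopologicalSpace.SeparableSpace Y := by
  have hb : ∀ y, (𝓝 y).HasBasis (fun _ => True) (B y) := fun y =>
    ⟨fun U => ⟨fun hU => by simpa using hbasis y U hU, fun ⟨k, _, hk⟩ =>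
      Filter.mem_of_superset ((hB y k).isOpen.mem_nhds (hmem y k)) hk⟩⟩
  have : FirstCountableTopology Y := ⟨fun y => (hb y).isCountablyGenerated⟩
  have : RegularSpace Y := RegularSpace.of_exists_mem_nhds_isClosed_subset fun y U hU => by
    obtain ⟨k, hk⟩ := hbasis y U hU
    exact ⟨B y k, (hB y k).isOpen.mem_nhds (hmem y k), (hB y k).isClosed, hk⟩
  have : T3Space Y := {}
  exact ⟨TopologicalSpace.metrizableSpace_of_t3_secondCountable Y, inferInstance⟩

end

/-! ### A topology on the countable ordinals given by a stationary set -/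

noncomputable section

namespace Om1

theorem exists_not_isLim_between {a b : Om1} (hb : IsLim b) (hab : a < b) :
    ∃ c, a < c ∧ c < b ∧ ¬ IsLim c := by
  obtain ⟨c, hc, hmin⟩ := WellFounded.has_min (wellFounded_lt (α := Om1)) (Ioi a) ⟨b, hab⟩
  obtain ⟨d, had, hdb⟩ := hb.2 a hab
  refine ⟨c, hc, (not_lt.1 (hmin d had)).trans_lt hdb, fun hlim => ?_⟩
  obtain ⟨e, hae, hec⟩ := hlim.2 a hc
  exact hmin e hae hec

end Om1

open Om1

/-- The set of countable ordinals, where the basic neighbourhoods of a limit ordinal consist of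
the point itself and the members of `S` in a final segment below it. -/
def StatSpace (_ : Set Om1) : Type := Om1

namespace StatSpace

variable {S : Set Om1}

/-- The point of the space given by an ordinal. -/
def mk (S : Set Om1) (a : Om1) : StatSpace S := a

/-- The ordinal underlying a point. -/
def ord (x : StatSpace S) : Om1 := x

instance : TopologicalSpace (StatSpace S) where
  IsOpen U := ∀ a ∈ U, IsLim (ord a) → ∃ c < ord a, ∀ b, c < b → b < ord a → b ∈ S → mk S b ∈ U
  isOpen_univ := fun a _ h => by
    obtain ⟨c, hc⟩ := h.1
    exact ⟨c, hc, fun _ _ _ _ => trivial⟩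
  isOpen_inter := fun U V hU hV a ha h => by
    obtain ⟨c, hc, hcU⟩ := hU a ha.1 h
    obtain ⟨d, hd, hdV⟩ := hV a ha.2 h
    exact ⟨max c d, max_lt hc hd, fun b hb hba hbS =>
      ⟨hcU b ((le_max_left _ _).trans_lt hb) hba hbS,
        hdV b ((le_max_right _ _).trans_lt hb) hba hbS⟩⟩
  isOpen_sUnion := fun 𝒰 h𝒰 a ⟨U, hU, haU⟩ h => by
    obtain ⟨c, hc, hcU⟩ := h𝒰 U hU a haU h
    exact ⟨c, hc, fun b hb hba hbS => ⟨U, hU, hcU b hb hba hbS⟩⟩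

theorem isOpen_preimage_Iio (a : Om1) : IsOpen (ord (S := S) ⁻¹' Iio a) := fun b hb h => by
  obtain ⟨c, hc⟩ := h.1
  exact ⟨c, hc, fun d _ hd _ => lt_trans hd hb⟩

theorem isOpen_preimage_Iic (a : Om1) : IsOpen (ord (S := S) ⁻¹' Iic a) := fun b hb h => by
  obtain ⟨c, hc⟩ := h.1
  exact ⟨c, hc, fun d _ hd _ => hd.le.trans hb⟩

theorem isOpen_preimage_Ioi (a : Om1) : IsOpen (ord (S := S) ⁻¹' Ioi a) :=
  fun _ hb _ => ⟨a, hb, fun _ hd _ _ => hd⟩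

theorem isClopen_preimage_Iic (a : Om1) : IsClopen (ord (S := S) ⁻¹' Iic a) :=
  ⟨⟨by rw [← preimage_compl, compl_Iic]; exact isOpen_preimage_Ioi a⟩, isOpen_preimage_Iic a⟩

theorem isClopen_preimage_Ioi (a : Om1) : IsClopen (ord (S := S) ⁻¹' Ioi a) := by
  rw [← compl_Iic, preimage_compl]
  exact (isClopen_preimage_Iic a).compl

instance : T2Space (StatSpace S) := by
  refine ⟨fun x y hxy => ?_⟩
  rcases lt_trichotomy (ord x) (ord y) with h | h | h
  · exact ⟨_, _, isOpen_preimage_Iic (ord x), isOpen_preimage_Ioi (ord x), mem_preimage.2 self_mem_Iic, h,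
      Disjoint.preimage _ (Iic_disjoint_Ioi le_rfl)⟩
  · exact absurd h hxy
  · exact ⟨_, _, isOpen_preimage_Ioi (ord y), isOpen_preimage_Iic (ord y), h, mem_preimage.2 self_mem_Iic,
      (Disjoint.preimage _ (Iic_disjoint_Ioi le_rfl)).symm⟩

theorem isOpen_singleton_of_not_isLim {x : StatSpace S} (h : ¬ IsLim (ord x)) :
    IsOpen ({x} : Set (StatSpace S)) := by
  rintro a rfl h'
  exact absurd h' h

/-- A neighbourhood of a point, all other points of which are smaller and lie in `S`. -/
def star (x : StatSpace S) : Set (StatSpace S) := insert x (ord ⁻¹' (Iio (ord x) ∩ S))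

theorem isOpen_star (x : StatSpace S) : IsOpen (star x) := by
  intro a ha h
  obtain ⟨c, hc⟩ := h.1
  refine ⟨c, hc, fun b _ hb hbS => Or.inr ⟨?_, hbS⟩⟩
  rcases ha with rfl | ha
  · exact hb
  · exact lt_trans hb ha.1

theorem countable_preimage {A : Set Om1} (hA : A.Countable) : (ord (S := S) ⁻¹' A).Countable :=
  hA.preimage_of_injOn (f := ord) (fun _ _ _ _ h => h)

theorem metrizable_separable_star (x : StatSpace S) :
    TopologicalSpace.MetrizableSpace ↥(star x) ∧ TopologicalSpace.SeparableSpace ↥(star x) := by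
  have hf : ∀ a : Om1, ∃ f : ℕ → Om1, IsLim a → (∀ n, f n < a) ∧ ∀ b < a, ∃ n, b < f n := by
    intro a
    by_cases h : IsLim a
    · obtain ⟨f, hf⟩ := h.exists_cofinal
      exact ⟨f, fun _ => hf⟩
    · exact ⟨fun _ => a, fun h' => absurd h' h⟩
  choose f hf using hf
  have : Countable ↥(star x) := by
    refine Set.Countable.to_subtype (Countable.insert _ (countable_preimage ?_))
    exact (countable_Iio _).mono inter_subset_left
  have hle : ∀ {y}, y ∈ star x → ord y ≤ ord x := fun h1 =>
    h1.elim (fun h1 => le_of_eq (congrArg ord h1)) fun h1 => le_of_lt h1.1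
  classical
  -- Inside the star, the points strictly below `y` all lie in `S`, so the traces of the clopen
  -- intervals `(c, y]` form a neighbourhood base of `y` there.
  refine metrizable_separable_of_countable (fun y k => Subtype.val ⁻¹' (if IsLim (ord y.1) then
    ord ⁻¹' Ioi (f (ord y.1) k) ∩ ord ⁻¹' Iic (ord y.1) else {y.1})) (fun y k => ?_)
    (fun y U hU => ?_) (fun y k => ?_)
  · refine IsClopen.preimage ?_ continuous_subtype_val
    split_ifs with h
    · exact (isClopen_preimage_Ioi _).inter (isClopen_preimage_Iic _)
    · exact ⟨isClosed_singleton, isOpen_singleton_of_not_isLim h⟩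
  · obtain ⟨V, hV, hVU⟩ := (mem_nhds_subtype _ _ _).1 hU
    obtain ⟨O, hOV, hO, hyO⟩ := mem_nhds_iff.1 hV
    by_cases h : IsLim (ord y.1)
    · obtain ⟨c, hc, hcO⟩ := hO _ hyO h
      obtain ⟨k, hk⟩ := (hf _ h).2 c hc
      refine ⟨k, fun z hz => hVU (hOV ?_)⟩
      simp only [h, if_true] at hz
      rcases (show ord z.1 ≤ ord y.1 from hz.2).eq_or_lt with he | hlt
      · exact (show z.1 = y.1 from he) ▸ hyO
      · refine hcO _ (hk.trans hz.1) hlt ?_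
        rcases z.2 with he | hz'
        · exact absurd hlt (not_lt.2 ((hle y.2).trans_eq (congrArg ord he.symm)))
        · exact hz'.2
    · refine ⟨0, fun z hz => hVU (hOV ?_)⟩
      simp only [h, if_false] at hz
      exact (show z.1 = y.1 from hz) ▸ hyO
  · by_cases h : IsLim (ord y.1)
    · simpa [h] using (hf _ h).1 k
    · simp [h]

/-- The initial segments turn the space into a Type I space. -/
def typeI (S : Set Om1) : TypeI (StatSpace S) :=
  TypeI.ofStages (fun a => ord ⁻¹' Iio a) (fun a => ord ⁻¹' Iic a) isOpen_preimage_Iio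
    (fun a => (countable_preimage (countable_Iic a)).isLindelof)
    (fun a => closure_minimal (preimage_mono Iio_subset_Iic_self) (isClopen_preimage_Iic a).1)
    (by exact fun _ _ h => preimage_mono (Iic_subset_Iio.2 h)) (by exact fun x => exists_gt (ord x))
    (by exact fun a => ⟨mk S a, lt_irrefl a⟩)

theorem stage_typeI (a : Om1) : (typeI S).stage a = ord ⁻¹' Iio a := TypeI.stage_ofStages a

theorem unbounded_iff {A : Set (StatSpace S)} :
    (typeI S).Unbounded A ↔ ∀ b, ∃ x ∈ A, b < ord x := by
  rw [TypeI.unbounded_iff]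
  refine ⟨fun h b => ?_, fun h b => ?_⟩
  · obtain ⟨c, hc⟩ := exists_gt b
    obtain ⟨x, hx, hx'⟩ := h c
    rw [stage_typeI] at hx'
    exact ⟨x, hx, hc.trans_le (not_lt.1 hx')⟩
  · obtain ⟨x, hx, hx'⟩ := h b
    refine ⟨x, hx, ?_⟩
    rw [stage_typeI]
    exact lt_asymm hx'

theorem mem_of_isClosed {C : Set (StatSpace S)} (hC : IsClosed C) {x : StatSpace S}
    (hx : IsLim (ord x)) (h : ∀ b < ord x, ∃ c ∈ S, mk S c ∈ C ∧ b < c ∧ c < ord x) : x ∈ C := by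
  by_contra hxC
  obtain ⟨b, hb, hbC⟩ := hC.isOpen_compl x hxC hx
  obtain ⟨c, hcS, hcC, hbc, hcx⟩ := h b hb
  exact hbC c hbc hcx hcS hcC

/-- The only point of `star x` that can be outside `S` is `x` itself. -/
theorem isClubDiscrete_of_subset_compl {E : Set (StatSpace S)} (hE : (typeI S).Unbounded E)
    (h : E ⊆ ord ⁻¹' Sᶜ) : (typeI S).IsClubDiscrete E := by
  refine TypeI.isClubDiscrete_of_locally hE fun x =>
    ⟨star x, (isOpen_star x).mem_nhds (mem_insert _ _), ?_⟩
  rintro y ⟨hy | hy, hyE⟩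
  · exact hy
  · exact absurd hy.2 (h hyE)

/-- Non-limit ordinals are cofinal below every limit ordinal, and `hlim` places all of them in `S`.
-/
theorem exists_mem_of_isOpen (hlim : Sᶜ ⊆ {a | IsLim a})
    {U : Set (StatSpace S)} (hU : IsOpen U) {x : StatSpace S}
    (hx : x ∈ U) (hxS : ord x ∉ S) {b : Om1} (hb : b < ord x) :
    ∃ c ∈ S, mk S c ∈ U ∧ b < c ∧ c < ord x := by
  have hl : IsLim (ord x) := hlim hxS
  obtain ⟨d, hd, hdU⟩ := hU x hx hl
  obtain ⟨c, hc, hcx, hcl⟩ := exists_not_isLim_between hl (max_lt hd hb)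
  have hcS : c ∈ S := by
    by_contra h
    exact hcl (hlim h)
  exact ⟨c, hcS, hdU c ((le_max_left _ _).trans_lt hc) hcx hcS,
    (le_max_right _ _).trans_lt hc, hcx⟩

/-- Values on points outside `S` are passed on to nearby points of `S`. If `f` is below `a` and
above `b` uncountably often, the corresponding two unbounded subsets of `S` have a common limit `δ`,
and `f` cannot be continuous there. -/
theorem isDirection_compl (hlim : Sᶜ ⊆ {a | IsLim a}) (hS : Stationary S)
    (hS' : Stationary Sᶜ) : (typeI S).IsDirection (ord ⁻¹' Sᶜ) := by
  have hub : (typeI S).Unbounded (ord ⁻¹' Sᶜ) := unbounded_iff.2 fun b => by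
    obtain ⟨a, ha, hab⟩ := hS'.unbounded b
    exact ⟨mk S a, ha, hab⟩
  refine TypeI.isDirection_of_rigid (isClubDiscrete_of_subset_compl hub subset_rfl).1
    fun f hf a ha => ?_
  obtain ⟨b, hab⟩ := exists_gt a
  refine ⟨b, ?_⟩
  by_contra hb
  have key : ∀ V : Set LongRay, IsOpen V → ¬ {x | ord x ∈ Sᶜ ∧ f x ∈ V}.Countable →
      ∀ b, ∃ c ∈ {c | c ∈ S ∧ f (mk S c) ∈ V}, b < c := by
    intro V hV hVc b
    obtain ⟨d, ⟨hd, hdV⟩, hbd⟩ := unbounded_of_uncountable hVc b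
    obtain ⟨c, hcS, hcV, hbc, -⟩ := exists_mem_of_isOpen hlim (hV.preimage hf) hdV hd hbd
    exact ⟨c, ⟨hcS, hcV⟩, hbc⟩
  obtain ⟨G, hG⟩ := exists_closure_limit (key _ isOpen_Iio ha)
  obtain ⟨G', hG'⟩ := exists_closure_limit (key _ isOpen_Ioi hb)
  obtain ⟨H, hH, hH'⟩ := exists_closure_subset_two G G'
  obtain ⟨δ, hδ, hδH⟩ := hS H
  have h1 : f (mk S δ) ≤ LongRay.pt a := by
    refine mem_of_isClosed (isClosed_Iic.preimage hf) hδH.1 fun c hc => ?_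
    obtain ⟨d, ⟨hdS, hd⟩, hcd, hdδ⟩ := hG δ (hH hδH) c hc
    exact ⟨d, hdS, Iio_subset_Iic_self hd, hcd, hdδ⟩
  have h2 : LongRay.pt b ≤ f (mk S δ) := by
    refine mem_of_isClosed (isClosed_Ici.preimage hf) hδH.1 fun c hc => ?_
    obtain ⟨d, ⟨hdS, hd⟩, hcd, hdδ⟩ := hG' δ (hH' hδH) c hc
    exact ⟨d, hdS, Ioi_subset_Ici_self hd, hcd, hdδ⟩
  exact not_le.2 hab (LongRay.pt_le_iff.1 (h2.trans h1))

theorem hasDiscreteDirection (hlim : Sᶜ ⊆ {a | IsLim a}) (hS : Stationary S)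
    (hS' : Stationary Sᶜ) : (typeI S).HasDiscreteDirection where
  t2 := inferInstance
  locallyMetrizable x :=
    ⟨_, (isOpen_star x).mem_nhds (mem_insert _ _), (metrizable_separable_star x).1⟩
  locallySeparable x :=
    ⟨_, (isOpen_star x).mem_nhds (mem_insert _ _), (metrizable_separable_star x).2⟩
  discreteDirection := by
    have h := isDirection_compl hlim hS hS'
    exact ⟨_, h, (isClubDiscrete_of_subset_compl h.1.2 subset_rfl).2⟩

/-- The part of `C` outside `S` works. Were it bounded, the part of `C` in `S` would be unbounded,
and a limit of it outside `S`, provided by stationarity, would again belong to `C`. -/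
theorem exists_isClubDiscrete (hS' : Stationary Sᶜ) {C : Set (StatSpace S)} (hC : (typeI S).IsClub C) :
    ∃ E ⊆ C, (typeI S).IsClubDiscrete E := by
  refine ⟨C ∩ ord ⁻¹' Sᶜ, inter_subset_left,
    isClubDiscrete_of_subset_compl ?_ inter_subset_right⟩
  by_contra hT
  rw [unbounded_iff] at hT
  push Not at hT
  obtain ⟨b, hb⟩ := hT
  have hA : ∀ d, ∃ c ∈ {c | c ∈ S ∧ mk S c ∈ C}, d < c := by
    intro d
    obtain ⟨x, hx, hx'⟩ := unbounded_iff.1 hC.2 (max d b)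
    refine ⟨ord x, ⟨?_, hx⟩, (le_max_left _ _).trans_lt hx'⟩
    by_contra hxS
    exact ((le_max_right _ _).trans_lt hx').not_ge (hb x ⟨hx, hxS⟩)
  obtain ⟨G, hG⟩ := exists_closure_limit hA
  obtain ⟨δ, ⟨hδ, hδG⟩, hbδ⟩ := (hS'.inter_closure G).unbounded b
  refine hbδ.not_ge (hb (mk S δ) ⟨mem_of_isClosed hC.1 hδG.1 fun c hc => ?_, hδ⟩)
  obtain ⟨d, ⟨hdS, hdC⟩, hcd, hdδ⟩ := hG δ hδG c hc
  exact ⟨d, hdS, hdC, hcd, hdδ⟩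

theorem dense_preimage (hlim : Sᶜ ⊆ {a | IsLim a}) : Dense (ord (S := S) ⁻¹' S) := by
  intro x
  by_cases hx : ord x ∈ S
  · exact subset_closure hx
  · rw [mem_closure_iff]
    intro U hU hxU
    obtain ⟨b, hb⟩ : ∃ b, b < ord x := (hlim hx).1
    obtain ⟨c, hcS, hcU, -⟩ := exists_mem_of_isOpen hlim hU hxU hx hb
    exact ⟨_, hcU, hcS⟩

/-- An uncountable subset of `S` has a limit point in `S`, since its limit points contain a club. -/
theorem omega1Compact_preimage (hS : Stationary S) : Omega1Compact ↥(ord (S := S) ⁻¹' S) := by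
  intro D hD hD'
  by_contra hDc
  have hA : ¬ (Subtype.val '' D : Set (StatSpace S)).Countable := fun h =>
    hDc (countable_of_injective_of_countable_image Subtype.val_injective.injOn h)
  obtain ⟨G, hG⟩ := exists_closure_limit (unbounded_of_uncountable (s := _) hA)
  obtain ⟨δ, hδ, hδG⟩ := hS G
  have h := (isClosed_and_discrete_iff.1 ⟨hD, isDiscrete_iff_discreteTopology.2 hD'⟩)
    (⟨mk S δ, hδ⟩ : ↥(ord (S := S) ⁻¹' S))
  rw [Filter.disjoint_principal_right, mem_nhdsWithin_iff_eventually] at h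
  obtain ⟨V, hV, hVD⟩ := (mem_nhds_subtype _ _ _).1 h
  obtain ⟨O, hOV, hO, hδO⟩ := mem_nhds_iff.1 hV
  obtain ⟨c, hc, hcO⟩ := hO _ hδO hδG.1
  obtain ⟨d, ⟨y, hy, hyd⟩, hcd, hdδ⟩ := hG δ hδG c hc
  have hyS : ord y.1 ∈ S := y.2
  have hyO : y.1 ∈ O := hcO (ord y.1) (by rw [hyd]; exact hcd) (by rw [hyd]; exact hdδ) hyS
  refine hVD (hOV hyO) (fun he => ?_) hy
  have : y.1 = mk S δ := congrArg Subtype.val he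
  exact hdδ.ne (hyd.symm.trans this)

theorem exists_clubsContainDiscrete :
    ∃ (X : Type) (_ : TopologicalSpace X) (F : TypeI X) (M : Set X),
      F.ClubsContainDiscrete ∧ F.DirectionsContainDiscrete M := by
  obtain ⟨T, hT, hT1, hT2⟩ := exists_costationary
  have hl : (Tᶜ)ᶜ ⊆ {a | IsLim a} := by rwa [compl_compl]
  have hT1' : Stationary (Tᶜ)ᶜ := by rwa [compl_compl]
  have h := hasDiscreteDirection hl hT2 hT1'
  have h' := fun C => exists_isClubDiscrete (C := C) hT1'
  exact ⟨StatSpace Tᶜ, inferInstance, typeI Tᶜ, _, ⟨h, h'⟩, h, dense_preimage hl,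
    omega1Compact_preimage hT2, fun D hD => h' D hD.1⟩

end StatSpace

end

/-! ### Guessing sequences and ladders -/

noncomputable section

namespace Om1

theorem IsLim.exists_strictMono {a : Om1} (ha : IsLim a) :
    ∃ f : ℕ → Om1, StrictMono f ∧ (∀ n, f n < a) ∧ ∀ b < a, ∃ n, b < f n := by
  obtain ⟨f, hf, hf'⟩ := ha.exists_cofinal
  have step : ∀ (n : ℕ) (s : Iio a), ∃ t : Iio a, s.1 < t.1 ∧ f n < t.1 := by
    intro n s
    obtain ⟨t, ht, hta⟩ := ha.2 _ (max_lt s.2 (hf n))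
    exact ⟨⟨t, hta⟩, (le_max_left _ _).trans_lt ht, (le_max_right _ _).trans_lt ht⟩
  choose g hg hg' using step
  let u : ℕ → Iio a := fun n => Nat.rec ⟨f 0, hf 0⟩ g n
  refine ⟨fun n => (u n).1, strictMono_nat_of_lt_succ fun n => hg n (u n), fun n => (u n).2,
    fun b hb => ?_⟩
  obtain ⟨n, hn⟩ := hf' b hb
  exact ⟨n + 1, hn.trans (hg' n (u n))⟩

theorem isLim_iso {a : Om1} (ha : IsLim a) : Order.IsSuccLimit (iso a) := by
  refine ⟨fun hmin => ?_, fun b hb => ?_⟩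
  · obtain ⟨c, hc⟩ := ha.1
    exact (hmin.not_lt (iso.lt_iff_lt.2 hc))
  · have hb1 : iso.symm b < a := by
      rw [← iso.lt_iff_lt, OrderIso.apply_symm_apply]; exact hb.1
    obtain ⟨c, hc, hca⟩ := ha.2 _ hb1
    rw [← iso.lt_iff_lt, OrderIso.apply_symm_apply] at hc
    exact hb.2 hc (iso.lt_iff_lt.2 hca)

theorem exists_closure_subset_of_isClub {C : Set Omega1} (hC : Omega1.IsClub C) :
    ∃ G, ∀ a ∈ Closure G, iso a ∈ C := by
  obtain ⟨G, hG⟩ := exists_closure_limit (A := iso ⁻¹' C) fun b => by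
    obtain ⟨c, hc, hbc⟩ := hC.1 (iso b)
    refine ⟨iso.symm c, ?_, ?_⟩
    · rw [mem_preimage, OrderIso.apply_symm_apply]; exact hc
    · rwa [← iso.lt_iff_lt, OrderIso.apply_symm_apply]
  refine ⟨G, fun a ha => hC.2 _ (isLim_iso ha.1) fun b hb => ?_⟩
  have hb1 : iso.symm b < a := by
    rwa [← iso.lt_iff_lt, OrderIso.apply_symm_apply]
  obtain ⟨c, hc, hbc, hca⟩ := hG a ha _ hb1
  rw [← iso.lt_iff_lt, OrderIso.apply_symm_apply] at hbc
  exact ⟨iso c, hc, hbc, iso.lt_iff_lt.2 hca⟩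

end Om1

open Om1

/-- A guessing sequence for subsets of `ω₁` decorated by a natural number and a smaller ordinal,
together with an injection into the reals and rational approximations to its values. -/
structure GuessData where
  r : Om1 → ℝ
  q : Om1 → Om1 → ℚ
  A : Om1 → ℕ → Set Om1
  m : Om1 → ℕ → ℕ
  γ : Om1 → ℕ → Om1
  r_injective : Function.Injective r
  q_mono : ∀ {a c d}, c ≤ d → d < a → q a c ≤ q a d
  q_lt : ∀ {a c}, c < a → (q a c : ℝ) < r a
  q_cofinal : ∀ {a}, IsLim a → ∀ y < r a, ∃ c < a, y < q a c
  γ_lt : ∀ {a} n, IsLim a → γ a n < a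
  guess : ∀ S, ∃ G, ∀ a ∈ Closure G, ∀ k, ∀ c < a, ∃ n, A a n = S ∩ Iio a ∧ m a n = k ∧ γ a n = c

namespace GuessData

variable (D : GuessData)

/-- The ordinals usable as the next step of a ladder at `a` for its `n`-th guess. -/
def Usable (a : Om1) (n : ℕ) (c : Om1) (y : ℝ) (b : Om1) : Prop :=
  b ∈ D.A a n ∧ c < b ∧ b < a ∧ IsLim b ∧ D.γ b (D.m a n) ≤ D.γ a n ∧ D.γ a n < b ∧
    y < D.q b (D.γ a n) ∧ D.r b < D.r a

/-- The `n`-th guess at `a` admits a ladder. -/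
def Fertile (a : Om1) (n : ℕ) : Prop := IsLim a ∧ ∀ c < a, ∀ y < D.r a, ∃ b, D.Usable a n c y b

end GuessData

/-- Attach a rational sequence increasing to `r a` to a cofinal sequence `f` in `a`: the value at
`c` is the term whose index is the first `n` with `c < f n`. -/
theorem exists_rational_approx (r : Om1 → ℝ) (a : Om1) : ∃ q : Om1 → ℚ,
    (∀ c d, c ≤ d → d < a → q c ≤ q d) ∧ (∀ c < a, (q c : ℝ) < r a) ∧
      (IsLim a → ∀ y < r a, ∃ c < a, y < q c) := by
  by_cases ha : IsLim a
  · obtain ⟨f, hf, hfa, hf'⟩ := ha.exists_strictMono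
    obtain ⟨u, hu, hu', hlim⟩ := Real.exists_seq_rat_strictMono_tendsto (r a)
    classical
    let N : Om1 → ℕ := fun c => if h : c < a then Nat.find (hf' c h) else 0
    have hN : ∀ c < a, c < f (N c) := fun c h => by
      simp only [N, h, dif_pos]
      exact Nat.find_spec (hf' c h)
    have hN' : ∀ c < a, ∀ n, c < f n → N c ≤ n := fun c h n hn => by
      simp only [N, h, dif_pos]
      exact Nat.find_min' _ hn
    refine ⟨fun c => u (N c), fun c d hcd hd => ?_, fun c hc => hu' _, fun _ y hy => ?_⟩
    · exact hu.monotone (hN' c (hcd.trans_lt hd) _ (hcd.trans_lt (hN d hd)))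
    · obtain ⟨n, hn⟩ := (hlim.eventually (lt_mem_nhds hy)).exists
      refine ⟨f n, hfa n, hn.trans ?_⟩
      exact Rat.cast_lt.2 (hu (hf.lt_iff_lt.1 (hN (f n) (hfa n))))
  · obtain ⟨q, hq⟩ := exists_rat_lt (r a)
    exact ⟨fun _ => q, fun _ _ _ _ => le_rfl, fun _ _ => hq, fun h => absurd h ha⟩

/-- Countability of the families of `◇*` leaves room to list every guess with every natural number
and every smaller ordinal attached. -/
theorem DiamondStar.exists_guessData (h : DiamondStar) : Nonempty GuessData := by
  obtain ⟨𝒜, h𝒜, hguess⟩ := h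
  obtain ⟨r, hr⟩ := exists_injective_real
  choose q hq hq' hq'' using exists_rational_approx r
  have henum : ∀ a : Om1, ∃ f : ℕ → Set Om1 × ℕ × Om1, ((∃ b, b < a) → ∀ n, (f n).2.2 < a) ∧
      ∀ S, iso '' S ∈ 𝒜 (iso a) → ∀ k, ∀ c < a, ∃ n, f n = (S, k, c) := by
    intro a
    by_cases ha : ∃ b, b < a
    · obtain ⟨b, hb⟩ := ha
      -- The empty set is thrown in only to make the set to be enumerated nonempty.
      have hc : ({p | p = ∅ ∨ iso '' p ∈ 𝒜 (iso a)} : Set (Set Om1)).Countable := by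
        refine Set.Countable.union (countable_singleton ∅) ?_
        exact (h𝒜 (iso a)).1.preimage_of_injOn (f := fun S : Set Om1 => iso '' S)
          (iso.injective.image_injective.injOn)
      obtain ⟨f, hf⟩ := (hc.prod ((Set.countable_univ (α := ℕ)).prod
        (countable_Iio a))).exists_eq_range ⟨(∅, 0, b), Or.inl rfl, trivial, hb⟩
      refine ⟨f, fun _ n => ?_, fun S hS k c hc => ?_⟩
      · have : f n ∈ range f := mem_range_self n
        rw [← hf] at this
        exact this.2.2
      · have : (S, k, c) ∈ range f := hf ▸ ⟨Or.inr hS, trivial, hc⟩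
        exact this
    · exact ⟨fun _ => (∅, 0, a), fun h => absurd h ha, fun _ _ _ c hc => absurd ⟨c, hc⟩ ha⟩
  choose f hf hf' using henum
  refine ⟨⟨r, q, fun a n => (f a n).1, fun a n => (f a n).2.1, fun a n => (f a n).2.2, hr,
    hq _ _ _, hq' _ _, hq'' _, fun n ha => hf _ ha.1 n, fun S => ?_⟩⟩
  obtain ⟨C, hC, hC'⟩ := hguess (iso '' S)
  obtain ⟨G, hG⟩ := exists_closure_subset_of_isClub hC
  refine ⟨G, fun a ha k c hc => ?_⟩
  have := hC' _ (hG a ha)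
  have he : iso '' S ∩ Iio (iso a) = iso '' (S ∩ Iio a) := by
    rw [image_inter iso.injective, OrderIso.image_Iio]
  obtain ⟨n, hn⟩ := hf' a (S ∩ Iio a) (he ▸ this) k c hc
  exact ⟨n, by simp [hn]⟩

/-- Ladders for the fertile guesses of a guessing sequence. -/
structure LadderData extends GuessData where
  h : Om1 → ℕ → Om1
  x : Om1 → ℕ → ℝ
  z : Om1 → ℕ → Om1
  κ : Om1 → ℕ → ℕ
  h_strictMono : ∀ {a}, IsLim a → StrictMono (h a)
  h_lt : ∀ {a} j, IsLim a → h a j < a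
  h_cofinal : ∀ {a}, IsLim a → ∀ b < a, ∃ j, b < h a j
  x_strictMono : ∀ {a}, IsLim a → StrictMono (x a)
  x_lt : ∀ {a} j, IsLim a → x a j < r a
  z_usable : ∀ {a} j, toGuessData.Fertile a (Nat.unpair j).1 →
    toGuessData.Usable a (Nat.unpair j).1 (h a j) (x a j) (z a j)
  z_lt : ∀ {a} j, toGuessData.Fertile a (Nat.unpair j).1 → z a j < h a (j + 1)
  r_z_le : ∀ {a} j, toGuessData.Fertile a (Nat.unpair j).1 → r (z a j) ≤ x a (j + 1)
  κ_spec : ∀ {a} j, toGuessData.Fertile a (Nat.unpair j).1 → j + 1 ≤ κ a j ∧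
    h a j ≤ h (z a j) (κ a j) ∧ q (z a j) (γ a (Nat.unpair j).1) ≤ x (z a j) (κ a j)

/-- Heights and reals are climbed simultaneously. As `(Nat.unpair j).1` takes each value infinitely
often, each fertile guess at `a` receives infinitely many steps, and consecutive steps are separated
both by `h` and by `x`. -/
theorem GuessData.exists_ladder (D : GuessData) (a : Om1) : ∃ (h : ℕ → Om1) (x : ℕ → ℝ)
    (z : ℕ → Om1), IsLim a → StrictMono h ∧ (∀ j, h j < a) ∧ (∀ b < a, ∃ j, b < h j) ∧
      StrictMono x ∧ (∀ j, x j < D.r a) ∧ (∀ y < D.r a, ∃ j, y < x j) ∧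
      ∀ j, D.Fertile a (Nat.unpair j).1 → D.Usable a (Nat.unpair j).1 (h j) (x j) (z j) ∧
        z j < h (j + 1) ∧ D.r (z j) ≤ x (j + 1) := by
  by_cases ha : IsLim a
  swap
  · exact ⟨fun _ => a, fun _ => 0, fun _ => a, fun h => absurd h ha⟩
  obtain ⟨f, hf, hfa, hf'⟩ := ha.exists_strictMono
  obtain ⟨u, hu, hu', hlim⟩ := exists_seq_strictMono_tendsto (D.r a)
  have step : ∀ (j : ℕ) (s : Iio a × Iio (D.r a)), ∃ (t : Iio a × Iio (D.r a)) (z : Om1),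
      s.1.1 < t.1.1 ∧ f j < t.1.1 ∧ s.2.1 < t.2.1 ∧ u j < t.2.1 ∧
        (D.Fertile a (Nat.unpair j).1 → D.Usable a (Nat.unpair j).1 s.1.1 s.2.1 z ∧
          z < t.1.1 ∧ D.r z ≤ t.2.1) := by
    intro j s
    have hz : ∃ z, z < a ∧ (D.Fertile a (Nat.unpair j).1 →
        D.Usable a (Nat.unpair j).1 s.1.1 s.2.1 z) ∧ ∃ y, y < D.r a ∧
        (D.Fertile a (Nat.unpair j).1 → D.r z ≤ y) := by
      by_cases hF : D.Fertile a (Nat.unpair j).1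
      · obtain ⟨z, hz⟩ := hF.2 _ s.1.2 _ s.2.2
        exact ⟨z, hz.2.2.1, fun _ => hz, D.r z, hz.2.2.2.2.2.2.2, fun _ => le_rfl⟩
      · exact ⟨f 0, hfa 0, fun h => absurd h hF, u 0, hu' 0, fun h => absurd h hF⟩
    obtain ⟨z, hza, hz, y, hy, hzy⟩ := hz
    obtain ⟨t, ht, hta⟩ := ha.2 _ (max_lt (max_lt s.1.2 (hfa j)) hza)
    obtain ⟨v, hv, hva⟩ := exists_between (max_lt (max_lt s.2.2 (hu' j)) hy)
    simp only [max_lt_iff] at ht hv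
    exact ⟨(⟨t, hta⟩, ⟨v, hva⟩), z, ht.1.1, ht.1.2, hv.1.1, hv.1.2,
      fun hF => ⟨hz hF, ht.2, (hzy hF).trans hv.2.le⟩⟩
  choose g z hg using step
  let s : ℕ → Iio a × Iio (D.r a) := fun n => Nat.rec (⟨f 0, hfa 0⟩, ⟨u 0, hu' 0⟩) g n
  refine ⟨fun n => (s n).1.1, fun n => (s n).2.1, fun n => z n (s n), fun _ =>
    ⟨strictMono_nat_of_lt_succ fun n => (hg n (s n)).1, fun n => (s n).1.2, fun b hb => ?_,
      strictMono_nat_of_lt_succ fun n => (hg n (s n)).2.2.1, fun n => (s n).2.2, fun y hy => ?_,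
      fun j => (hg j (s j)).2.2.2.2⟩⟩
  · obtain ⟨n, hn⟩ := hf' b hb
    exact ⟨n + 1, hn.trans (hg n (s n)).2.1⟩
  · obtain ⟨n, hn⟩ := (hlim.eventually (lt_mem_nhds hy)).exists
    exact ⟨n + 1, hn.trans (hg n (s n)).2.2.2.1⟩

/-- It remains to choose `κ`, which says how small a neighbourhood of the node below is absorbed.
Both requirements hold eventually: the ladder of `z a j` is cofinal in `z a j`, and its reals
converge to `r (z a j)`, which exceeds all its approximations. -/
theorem GuessData.exists_ladderData (D : GuessData) : ∃ L : LadderData, L.toGuessData = D := by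
  choose h x z H using D.exists_ladder
  have hκ : ∀ a j, ∃ k, D.Fertile a (Nat.unpair j).1 → j + 1 ≤ k ∧ h a j ≤ h (z a j) k ∧
      D.q (z a j) (D.γ a (Nat.unpair j).1) ≤ x (z a j) k := by
    intro a j
    by_cases hF : D.Fertile a (Nat.unpair j).1
    · have hU := ((H a hF.1).2.2.2.2.2.2 j hF).1
      have Hz := H _ hU.2.2.2.1
      obtain ⟨k, hk⟩ := Hz.2.2.1 _ hU.2.1
      obtain ⟨l, hl⟩ := Hz.2.2.2.2.2.1 _ (D.q_lt hU.2.2.2.2.2.1)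
      refine ⟨max (j + 1) (max k l), fun _ => ⟨le_max_left _ _, ?_, ?_⟩⟩
      · exact hk.le.trans (Hz.1.monotone ((le_max_left _ _).trans (le_max_right _ _)))
      · exact hl.le.trans (Hz.2.2.2.1.monotone ((le_max_right _ _).trans (le_max_right _ _)))
    · exact ⟨0, fun h => absurd h hF⟩
  choose κ hκ using hκ
  exact ⟨⟨D, h, x, z, κ, fun ha => (H _ ha).1, fun j ha => (H _ ha).2.1 j,
    fun ha => (H _ ha).2.2.1, fun ha => (H _ ha).2.2.2.1, fun j ha => (H _ ha).2.2.2.2.1 j,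
    fun j hF => ((H _ hF.1).2.2.2.2.2.2 j hF).1, fun j hF => ((H _ hF.1).2.2.2.2.2.2 j hF).2.1,
    fun j hF => ((H _ hF.1).2.2.2.2.2.2 j hF).2.2, fun j hF => hκ _ j hF⟩, rfl⟩

end

/-! ### The ladder space: blocks and separation of basic neighbourhoods -/

noncomputable section

open Om1

/-- The points of a ladder space: isolated points, limits of columns of isolated points, and
nodes. -/
inductive LadderSpace (L : LadderData) : Type
  | iso (b : Om1) (i : ℕ)
  | tip (b : Om1)
  | node (a : Om1) (n : ℕ)

namespace LadderSpace

variable {L : LadderData}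

/-- The height of a point. -/
def ht : LadderSpace L → Om1
  | iso b _ => b
  | tip b => b
  | node a _ => a

/-- The basic neighbourhoods of the nodes. -/
inductive Nb : Om1 → ℕ → ℕ → LadderSpace L → Prop
  | self {a n k} : Nb a n k (node a n)
  | own {a n k j b} : IsLim a → k ≤ j → L.h a j < b → b ≤ L.h a (j + 1) →
      Nb a n k (iso b (Nat.pair n j))
  | step {a k j x} : L.Fertile a (Nat.unpair j).1 → k ≤ j →
      Nb (L.z a j) (L.m a (Nat.unpair j).1) (L.κ a j) x → Nb a (Nat.unpair j).1 k x

/-- The `j`-th block of the neighbourhoods of a node. -/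
inductive Block (a : Om1) (n j : ℕ) : LadderSpace L → Prop
  | own {b} : L.h a j < b → b ≤ L.h a (j + 1) → Block a n j (iso b (Nat.pair n j))
  | step {x} : L.Fertile a (Nat.unpair j).1 → (Nat.unpair j).1 = n →
      Nb (L.z a j) (L.m a (Nat.unpair j).1) (L.κ a j) x → Block a n j x

theorem nb_iff {a : Om1} {n k : ℕ} {x : LadderSpace L} :
    Nb a n k x ↔ x = node a n ∨ IsLim a ∧ ∃ j, k ≤ j ∧ Block a n j x := by
  constructor
  · rintro (_ | ⟨ha, hk, h1, h2⟩ | ⟨hF, hk, h⟩)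
    · exact Or.inl rfl
    · exact Or.inr ⟨ha, _, hk, .own h1 h2⟩
    · exact Or.inr ⟨hF.1, _, hk, .step hF rfl h⟩
  · rintro (rfl | ⟨ha, j, hk, (⟨h1, h2⟩ | ⟨hF, rfl, h⟩)⟩)
    · exact .self
    · exact .own ha hk h1 h2
    · exact .step hF hk h

theorem Nb.mono {a : Om1} {n k l : ℕ} {x : LadderSpace L} (h : Nb a n l x) (hkl : k ≤ l) :
    Nb a n k x := by
  rw [nb_iff] at h ⊢
  rcases h with h | ⟨ha, j, hj, h⟩
  · exact Or.inl h
  · exact Or.inr ⟨ha, j, hkl.trans hj, h⟩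

theorem Nb.exists_node {a : Om1} {n k : ℕ} {x : LadderSpace L} (h : Nb a n k x) {b : Om1} {m : ℕ}
    (hx : x = node b m) : ∃ l, ∀ y : LadderSpace L, Nb b m l y → Nb a n k y := by
  induction h with
  | @self a n k => cases hx; exact ⟨k, fun _ h => h⟩
  | own => cases hx
  | step hF hk _ ih =>
    obtain ⟨l, hl⟩ := ih hx
    exact ⟨l, fun y hy => .step hF hk (hl y hy)⟩

theorem Nb.ht_le {a : Om1} {n k : ℕ} {x : LadderSpace L} (h : Nb a n k x) :
    ht x ≤ a ∧ (x = node a n ∨ IsLim a ∧ L.h a k < ht x) := by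
  induction h with
  | self => exact ⟨le_rfl, Or.inl rfl⟩
  | own ha hk h1 h2 =>
    exact ⟨h2.trans (L.h_lt _ ha).le, Or.inr ⟨ha, ((L.h_strictMono ha).monotone hk).trans_lt h1⟩⟩
  | @step a k j x hF hk _ ih =>
    have hU := L.z_usable j hF
    refine ⟨ih.1.trans hU.2.2.1.le, Or.inr ⟨hF.1, ?_⟩⟩
    refine ((L.h_strictMono hF.1).monotone hk).trans_lt ?_
    rcases ih.2 with rfl | ⟨_, h⟩
    · exact hU.2.1
    · exact (L.κ_spec j hF).2.1.trans_lt h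

theorem Block.ht_mem {a : Om1} {n j : ℕ} {x : LadderSpace L} (h : Block a n j x) :
    L.h a j < ht x ∧ ht x ≤ L.h a (j + 1) := by
  obtain ⟨h1, h2⟩ | ⟨hF, rfl, h⟩ := h
  · exact ⟨h1, h2⟩
  · refine ⟨?_, h.ht_le.1.trans (L.z_lt j hF).le⟩
    rcases h.ht_le.2 with rfl | ⟨_, h⟩
    · exact (L.z_usable j hF).2.1
    · exact (L.κ_spec j hF).2.1.trans_lt h

theorem Block.eq_of_ht {a : Om1} {n j j' : ℕ} {x : LadderSpace L} (ha : IsLim a)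
    (h : Block a n j x) (h' : L.h a j' < ht x ∧ ht x ≤ L.h a (j' + 1)) : j = j' := by
  have hm := L.h_strictMono ha
  have h1 := hm.lt_iff_lt.1 (h.ht_mem.1.trans_le h'.2)
  have h2 := hm.lt_iff_lt.1 (h'.1.trans_le h.ht_mem.2)
  omega

/-- The second component of a label is the index of the block where the point was first put in, and
`κ` exceeds the index of every block absorbing it. Hence shrinking neighbourhoods leave every
isolated point behind. -/
theorem Nb.le_unpair {a : Om1} {n k : ℕ} {x : LadderSpace L} (h : Nb a n k x) {b : Om1} {i : ℕ}
    (hx : x = iso b i) : k ≤ (Nat.unpair i).2 := by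
  induction h with
  | self => cases hx
  | own _ hk => cases hx; simpa using hk
  | @step a k j x hF hk _ ih =>
    have := ih hx
    have := (L.κ_spec j hF).1
    omega

theorem Nb.ne_tip {a : Om1} {n k : ℕ} {x : LadderSpace L} (h : Nb a n k x) (b : Om1) :
    x ≠ tip b := by
  induction h with
  | self => exact fun h => by cases h
  | own => exact fun h => by cases h
  | step _ _ _ ih => exact ih

/-- The height `b` occurs in at most one block. That block has one own point in the column, and the
rest comes from a lower node, by induction. This keeps tips out of the closures of neighbourhoods of
nodes. -/
theorem finite_nb_iso (b : Om1) (a : Om1) (n k : ℕ) :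
    {i | Nb a n k (iso b i : LadderSpace L)}.Finite := by
  induction a using WellFoundedLT.induction generalizing n k with
  | ind a ih =>
    by_cases hj : IsLim a ∧ ∃ j, L.h a j < b ∧ b ≤ L.h a (j + 1)
    · obtain ⟨ha, j, hj⟩ := hj
      by_cases hF : L.Fertile a (Nat.unpair j).1
      · refine ((ih (L.z a j) (L.z_usable j hF).2.2.1 (L.m a (Nat.unpair j).1)
          (L.κ a j)).union (finite_singleton (Nat.pair n j))).subset fun i hi => ?_
        obtain h | ⟨_, j', _, h⟩ := nb_iff.1 hi
        · cases h
        · obtain rfl := h.eq_of_ht ha hj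
          obtain ⟨h1, h2⟩ | ⟨_, _, h⟩ := h
          · exact Or.inr rfl
          · exact Or.inl h
      · refine (finite_singleton (Nat.pair n j)).subset fun i hi => ?_
        obtain h | ⟨_, j', _, h⟩ := nb_iff.1 hi
        · cases h
        · obtain rfl := h.eq_of_ht ha hj
          obtain ⟨h1, h2⟩ | ⟨h, _⟩ := h
          · exact rfl
          · exact absurd h hF
    · refine finite_empty.subset fun i hi => hj ?_
      obtain h | ⟨ha, j, _, h⟩ := nb_iff.1 hi
      · cases h
      · exact ⟨ha, j, h.ht_mem⟩

/-- Blocks with different indices differ in height. Within block `j`, own points carry the label of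
their node, absorbed points have labels with second component at least `j + 1`, and only the node
numbered `(Nat.unpair j).1` absorbs anything. -/
theorem not_nb_of_ne {a : Om1} {n n' k k' : ℕ} (hn : n ≠ n') {x : LadderSpace L}
    (h : Nb a n k x) (h' : Nb a n' k' x) : False := by
  have key : ∀ {n n' j : ℕ} {b : Om1}, IsLim a → n ≠ n' →
      Block a n j (iso b (Nat.pair n' j) : LadderSpace L) → False := by
    intro n n' j b ha hn h
    generalize hy : (iso b (Nat.pair n' j) : LadderSpace L) = y at h
    obtain ⟨h1, h2⟩ | ⟨hF, hj, h⟩ := h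
    · simp only [iso.injEq, Nat.pair_eq_pair] at hy
      exact hn hy.2.1.symm
    · have h1 := h.le_unpair hy.symm
      have h2 := (L.κ_spec j hF).1
      simp only [Nat.unpair_pair] at h1
      omega
  obtain rfl | ⟨ha, j, _, hb⟩ := nb_iff.1 h
  · obtain h' | ⟨ha, j, _, h'⟩ := nb_iff.1 h'
    · cases h'; exact hn rfl
    · exact (h'.ht_mem.2.trans_lt (L.h_lt _ ha)).ne rfl
  · obtain rfl | ⟨_, j', _, hb'⟩ := nb_iff.1 h'
    · exact (hb.ht_mem.2.trans_lt (L.h_lt _ ha)).ne rfl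
    · obtain rfl := hb.eq_of_ht ha hb'.ht_mem
      obtain ⟨h1, h2⟩ | ⟨_, hj, _⟩ := hb
      · exact key ha hn.symm hb'
      · obtain ⟨h1, h2⟩ | ⟨_, hj', _⟩ := hb'
        · exact key ha hn (nb_iff.1 h |>.elim (fun h => by cases h) fun ⟨_, j', _, h⟩ => by
            have := h.eq_of_ht ha ⟨h1, h2⟩
            rwa [this] at h)
        · exact hn (hj.symm.trans hj')

/-- Basic neighbourhoods are clopen at nodes. If `b < a`, small neighbourhoods of the lower node lie
in one block of the upper one, and induction applies to the node absorbed there; equal heights are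
`not_nb_of_ne`; if `a < b`, heights separate. -/
theorem exists_disjoint_nb {a : Om1} {n k : ℕ} {b : Om1} {m : ℕ}
    (h : ¬ Nb a n k (node b m : LadderSpace L)) :
    ∃ l, ∀ x : LadderSpace L, Nb b m l x → ¬ Nb a n k x := by
  induction a using WellFoundedLT.induction generalizing n k with
  | ind a ih =>
    rcases lt_trichotomy b a with hba | rfl | hab
    · by_cases hj : IsLim a ∧ ∃ j, L.h a j < b ∧ b ≤ L.h a (j + 1)
      · obtain ⟨ha, j, hj⟩ := hj
        have hl : ∃ l, ∀ x : LadderSpace L, Nb b m l x → L.h a j < ht x := by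
          by_cases hb : IsLim b
          · obtain ⟨l, hl⟩ := L.h_cofinal hb _ hj.1
            refine ⟨l, fun x hx => ?_⟩
            rcases hx.ht_le.2 with rfl | ⟨_, hx⟩
            · exact hj.1
            · exact hl.trans hx
          · refine ⟨0, fun x hx => ?_⟩
            rcases hx.ht_le.2 with rfl | ⟨hb', hx⟩
            · exact hj.1
            · exact absurd hb' hb
        obtain ⟨l, hl⟩ := hl
        have hl' : ∃ l', k ≤ j → L.Fertile a (Nat.unpair j).1 → (Nat.unpair j).1 = n →
            ∀ x : LadderSpace L, Nb b m l' x →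
              ¬ Nb (L.z a j) (L.m a (Nat.unpair j).1) (L.κ a j) x := by
          by_cases hF : k ≤ j ∧ L.Fertile a (Nat.unpair j).1 ∧ (Nat.unpair j).1 = n
          · obtain ⟨hk, hF, rfl⟩ := hF
            obtain ⟨l', hl'⟩ := ih (L.z a j) (L.z_usable j hF).2.2.1
              (n := L.m a (Nat.unpair j).1) (k := L.κ a j) fun h' => h (.step hF hk h')
            exact ⟨l', fun _ _ _ => hl'⟩
          · exact ⟨0, fun h1 h2 h3 => absurd ⟨h1, h2, h3⟩ hF⟩
        obtain ⟨l', hl'⟩ := hl'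
        -- Own points of block `j` have label with second component `j`, so `j + 1` excludes them.
        refine ⟨max (max l l') (j + 1), fun x hx hx' => ?_⟩
        have h1 := hl x (hx.mono ((le_max_left _ _).trans (le_max_left _ _)))
        have h2 := hx.ht_le.1
        obtain rfl | ⟨_, j', hk, hB⟩ := nb_iff.1 hx'
        · exact (h2.trans_lt hba).ne rfl
        · obtain rfl := hB.eq_of_ht ha ⟨h1, h2.trans hj.2⟩
          obtain ⟨_, _⟩ | ⟨hF, hn, hB⟩ := hB
          · have := hx.le_unpair rfl
            simp at this
          · exact hl' hk hF hn x (hx.mono ((le_max_right _ _).trans (le_max_left _ _))) hB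
      · refine ⟨0, fun x hx hx' => ?_⟩
        have h2 := hx.ht_le.1
        obtain rfl | ⟨ha, j, hk, hB⟩ := nb_iff.1 hx'
        · exact (h2.trans_lt hba).ne rfl
        · refine hj ⟨ha, ?_⟩
          classical
          have hex : ∃ j, b ≤ L.h a (j + 1) := by
            obtain ⟨j, hj⟩ := L.h_cofinal ha b hba
            exact ⟨j, hj.le.trans ((L.h_strictMono ha).monotone (Nat.le_succ j))⟩
          refine ⟨Nat.find hex, ?_, Nat.find_spec hex⟩
          rcases Nat.eq_zero_or_pos (Nat.find hex) with h0 | h0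
          · rw [h0]
            exact ((L.h_strictMono ha).monotone (Nat.zero_le j)).trans_lt
              (hB.ht_mem.1.trans_le h2)
          · obtain ⟨i, hi⟩ := Nat.exists_eq_succ_of_ne_zero h0.ne'
            have := Nat.find_min hex (m := i) (by omega)
            rw [hi]
            exact not_le.1 this
    · refine ⟨0, fun x hx hx' => ?_⟩
      rcases eq_or_ne n m with rfl | hn
      · exact h .self
      · exact not_nb_of_ne hn hx' hx
    · by_cases hb : IsLim b
      · obtain ⟨l, hl⟩ := L.h_cofinal hb a hab
        refine ⟨l, fun x hx hx' => ?_⟩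
        rcases hx.ht_le.2 with rfl | ⟨_, hx⟩
        · exact hab.not_ge hx'.ht_le.1
        · exact (hl.trans hx).not_ge hx'.ht_le.1
      · refine ⟨0, fun x hx hx' => ?_⟩
        rcases hx.ht_le.2 with rfl | ⟨hb', _⟩
        · exact hab.not_ge hx'.ht_le.1
        · exact hb hb'

/-- The nodes in the `j`-th block are controlled by the data at the bottom node. -/
theorem Block.spec {a : Om1} {n j : ℕ} {x : LadderSpace L} (h : Block a n j x) {b : Om1} {m : ℕ}
    (hx : x = node b m) : L.γ b m ≤ L.γ a n ∧ (L.γ a n < b → L.x a j < L.q b (L.γ a n)) ∧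
      L.r b ≤ L.x a (j + 1) := by
  induction a using WellFoundedLT.induction generalizing n j with
  | ind a ih =>
    obtain ⟨h1, h2⟩ | ⟨hF, rfl, h⟩ := h
    · cases hx
    · obtain ⟨hA, hhz, hza, hzlim, hγ, hγz, hxz, hrz⟩ := L.z_usable j hF
      obtain h | ⟨_, i, hi, h⟩ := nb_iff.1 h
      · rw [hx] at h
        cases h
        exact ⟨hγ, fun _ => hxz, L.r_z_le j hF⟩
      · obtain ⟨h1, h2, h3⟩ := ih _ hza h
        refine ⟨h1.trans hγ, fun hb => ?_, ?_⟩
        -- With `z` the absorbed node and `γ = γ a n`, the chain is `x a j < q z γ ≤ x z κ ≤ x z i <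
        -- q b (γ z m) ≤ q b γ`; here the choice of `κ` and the monotonicity of `q b` are used.
        · have h4 := h2 (hγ.trans_lt hb)
          have h5 := L.q_mono hγ hb
          have h6 := (L.κ_spec j hF).2.2
          have h7 := (L.x_strictMono hzlim).monotone hi
          have h8 : (L.q b (L.γ (L.z a j) (L.m a (Nat.unpair j).1)) : ℝ) ≤
            L.q b (L.γ a (Nat.unpair j).1) := by exact_mod_cast h5
          linarith
        · have h4 := L.x_lt (i + 1) hzlim
          have h5 := L.r_z_le j hF
          linarith

end LadderSpace

end

/-! ### The topology of the ladder space, its direction and its clubs -/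

noncomputable section

open Om1

namespace LadderSpace

variable {L : LadderData}

instance : TopologicalSpace (LadderSpace L) where
  IsOpen U := (∀ a n, node a n ∈ U → ∃ k, ∀ x, Nb a n k x → x ∈ U) ∧
    ∀ b, tip b ∈ U → ∃ k, ∀ i, k ≤ i → iso b i ∈ U
  isOpen_univ := ⟨fun _ _ _ => ⟨0, fun _ _ => trivial⟩, fun _ _ => ⟨0, fun _ _ => trivial⟩⟩
  isOpen_inter := fun U V hU hV => by
    refine ⟨fun a n h => ?_, fun b h => ?_⟩
    · obtain ⟨k, hk⟩ := hU.1 a n h.1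
      obtain ⟨l, hl⟩ := hV.1 a n h.2
      exact ⟨max k l, fun x hx =>
        ⟨hk x (hx.mono (le_max_left _ _)), hl x (hx.mono (le_max_right _ _))⟩⟩
    · obtain ⟨k, hk⟩ := hU.2 b h.1
      obtain ⟨l, hl⟩ := hV.2 b h.2
      exact ⟨max k l, fun i hi =>
        ⟨hk i ((le_max_left _ _).trans hi), hl i ((le_max_right _ _).trans hi)⟩⟩
  isOpen_sUnion := fun 𝒰 h𝒰 => by
    refine ⟨fun a n ⟨U, hU, h⟩ => ?_, fun b ⟨U, hU, h⟩ => ?_⟩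
    · obtain ⟨k, hk⟩ := (h𝒰 U hU).1 a n h
      exact ⟨k, fun x hx => ⟨U, hU, hk x hx⟩⟩
    · obtain ⟨k, hk⟩ := (h𝒰 U hU).2 b h
      exact ⟨k, fun i hi => ⟨U, hU, hk i hi⟩⟩

/-- The basic clopen neighbourhoods. -/
def basic : LadderSpace L → ℕ → Set (LadderSpace L)
  | iso b i, _ => {iso b i}
  | tip b, k => {x | x = tip b ∨ ∃ i, k ≤ i ∧ x = iso b i}
  | node a n, k => {x | Nb a n k x}

theorem mem_basic (x : LadderSpace L) (k : ℕ) : x ∈ basic x k := by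
  cases x with
  | iso b i => exact rfl
  | tip b => exact Or.inl rfl
  | node a n => exact .self

theorem exists_basic_subset {U : Set (LadderSpace L)} (hU : IsOpen U) {x : LadderSpace L}
    (hx : x ∈ U) : ∃ k, basic x k ⊆ U := by
  cases x with
  | iso b i => exact ⟨0, singleton_subset_iff.2 hx⟩
  | tip b =>
    obtain ⟨k, hk⟩ := hU.2 b hx
    refine ⟨k, ?_⟩
    rintro y (rfl | ⟨i, hi, rfl⟩)
    · exact hx
    · exact hk i hi
  | node a n => exact hU.1 a n hx

theorem isOpen_basic (x : LadderSpace L) (k : ℕ) : IsOpen (basic x k) := by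
  cases x with
  | iso b i =>
    refine ⟨fun a n h => ?_, fun b h => ?_⟩
    · cases (mem_singleton_iff.1 h)
    · cases (mem_singleton_iff.1 h)
  | tip b =>
    refine ⟨fun a n h => ?_, fun c h => ⟨k, fun i hi => ?_⟩⟩
    · obtain h | ⟨i, _, h⟩ := h <;> cases h
    · obtain h | ⟨i', _, h⟩ := h <;> cases h
      exact Or.inr ⟨i, hi, rfl⟩
  | node a n =>
    refine ⟨fun b m h => Nb.exists_node h rfl, fun b h => absurd rfl (Nb.ne_tip h b)⟩

theorem isClosed_basic (x : LadderSpace L) (k : ℕ) : IsClosed (basic x k) := by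
  refine ⟨⟨fun a n h => ?_, fun c h => ?_⟩⟩
  · cases x with
    | iso b i =>
      refine ⟨(Nat.unpair i).2 + 1, fun y hy h' => ?_⟩
      exact absurd (hy.le_unpair (mem_singleton_iff.1 h')) (by omega)
    | tip b =>
      obtain ⟨l, hl⟩ := (finite_nb_iso (L := L) b a n 0).bddAbove
      refine ⟨l + 1, fun y hy h' => ?_⟩
      obtain h' | ⟨i, hi, h'⟩ := h'
      · exact hy.ne_tip b h'
      · subst h'
        have h1 : (Nat.unpair i).2 ≤ i := Nat.unpair_right_le i
        have h2 := hl (show i ∈ {i | _} from hy.mono (Nat.zero_le _))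
        exact absurd (hy.le_unpair rfl) (by omega)
    | node b m => exact exists_disjoint_nb h
  · cases x with
    | iso b i =>
      refine ⟨i + 1, fun j hj h' => ?_⟩
      cases mem_singleton_iff.1 h'
      omega
    | tip b =>
      refine ⟨0, fun j hj h' => h ?_⟩
      obtain h' | ⟨i, hi, h'⟩ := h'
      · cases h'
      · cases h'
        exact Or.inl rfl
    | node b m =>
      obtain ⟨l, hl⟩ := (finite_nb_iso (L := L) c b m k).bddAbove
      refine ⟨l + 1, fun j hj h' => ?_⟩
      have := hl (show j ∈ {i | _} from h')
      omega

theorem isClopen_basic (x : LadderSpace L) (k : ℕ) : IsClopen (basic x k) :=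
  ⟨isClosed_basic x k, isOpen_basic x k⟩

theorem basic_mem_nhds (x : LadderSpace L) (k : ℕ) : basic x k ∈ 𝓝 x :=
  (isOpen_basic x k).mem_nhds (mem_basic x k)

theorem basic_anti (x : LadderSpace L) {k l : ℕ} (h : k ≤ l) : basic x l ⊆ basic x k := by
  cases x with
  | iso b i => exact subset_rfl
  | tip b =>
    rintro y (rfl | ⟨i, hi, rfl⟩)
    · exact Or.inl rfl
    · exact Or.inr ⟨i, h.trans hi, rfl⟩
  | node a n => exact fun y hy => Nb.mono hy h

theorem ht_le_of_mem_basic {x y : LadderSpace L} {k : ℕ} (h : y ∈ basic x k) : ht y ≤ ht x := by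
  cases x with
  | iso b i => rw [mem_singleton_iff.1 h]
  | tip b => obtain rfl | ⟨i, _, rfl⟩ := h <;> exact le_rfl
  | node a n => exact (Nb.ht_le h).1

theorem exists_lt_ht_of_mem_basic {x : LadderSpace L} {c : Om1} (hc : c < ht x) :
    ∃ k, ∀ y ∈ basic x k, c < ht y := by
  cases x with
  | iso b i =>
    refine ⟨0, fun y h => ?_⟩
    rw [mem_singleton_iff.1 h]
    exact hc
  | tip b =>
    refine ⟨0, fun y h => ?_⟩
    obtain rfl | ⟨i, _, rfl⟩ := h <;> exact hc
  | node a n =>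
    by_cases ha : IsLim a
    · obtain ⟨l, hl⟩ := L.h_cofinal ha c hc
      refine ⟨l, fun x hx => ?_⟩
      rcases (Nb.ht_le hx).2 with rfl | ⟨_, hx⟩
      · exact hc
      · exact hl.trans hx
    · refine ⟨0, fun x hx => ?_⟩
      rcases (Nb.ht_le hx).2 with rfl | ⟨hb', _⟩
      · exact hc
      · exact absurd hb' ha

theorem isOpen_of_basic {U : Set (LadderSpace L)} (h : ∀ x ∈ U, ∃ k, basic x k ⊆ U) : IsOpen U :=
  isOpen_iff_mem_nhds.2 fun x hx => by
    obtain ⟨k, hk⟩ := h x hx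
    exact Filter.mem_of_superset (basic_mem_nhds x k) hk

theorem isOpen_ht_lt (a : Om1) : IsOpen {x : LadderSpace L | ht x < a} :=
  isOpen_of_basic fun _ hx => ⟨0, fun _ hy => (ht_le_of_mem_basic hy).trans_lt hx⟩

theorem isClosed_ht_le (a : Om1) : IsClosed {x : LadderSpace L | ht x ≤ a} := by
  refine ⟨isOpen_of_basic fun x hx => ?_⟩
  obtain ⟨k, hk⟩ := exists_lt_ht_of_mem_basic (not_le.1 hx)
  exact ⟨k, fun y hy => not_le.2 (hk y hy)⟩

theorem exists_notMem_basic {x y : LadderSpace L} (h : y ≠ x) : ∃ k, y ∉ basic x k := by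
  cases x with
  | iso b i => exact ⟨0, h⟩
  | tip b =>
    cases y with
    | iso c i =>
      refine ⟨i + 1, ?_⟩
      rintro (h | ⟨j, hj, h⟩)
      · cases h
      · cases h; omega
    | tip c =>
      refine ⟨0, ?_⟩
      rintro (h' | ⟨j, hj, h'⟩)
      · exact h h'
      · cases h'
    | node c i => exact ⟨0, by rintro (h | ⟨j, hj, h⟩) <;> cases h⟩
  | node a n =>
    by_contra! hall
    have h0 := (Nb.ht_le (hall 0)).2.resolve_left h
    have hlt : ht y < a := by
      obtain h1 | ⟨ha, j, _, hB⟩ := nb_iff.1 (hall 0)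
      · exact absurd h1 h
      · exact hB.ht_mem.2.trans_lt (L.h_lt _ ha)
    obtain ⟨k, hk⟩ := L.h_cofinal h0.1 _ hlt
    exact lt_asymm hk ((Nb.ht_le (hall k)).2.resolve_left h).2

instance : T2Space (LadderSpace L) := by
  refine ⟨fun x y hxy => ?_⟩
  obtain ⟨k, hk⟩ := exists_notMem_basic hxy
  exact ⟨(basic y k)ᶜ, basic y k, (isClosed_basic y k).isOpen_compl, isOpen_basic y k, hk,
    mem_basic y k, disjoint_compl_left⟩

theorem countable_ht_le (a : Om1) : {x : LadderSpace L | ht x ≤ a}.Countable := by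
  have hc := countable_Iic a
  have h1 : ((fun p : Om1 × ℕ => (iso p.1 p.2 : LadderSpace L)) '' (Iic a ×ˢ univ)).Countable :=
    (hc.prod countable_univ).image _
  have h2 : ((fun p : Om1 × ℕ => (node p.1 p.2 : LadderSpace L)) '' (Iic a ×ˢ univ)).Countable :=
    (hc.prod countable_univ).image _
  refine ((h1.union h2).union (hc.image tip)).mono fun x hx => ?_
  cases x with
  | iso b i => exact Or.inl (Or.inl ⟨(b, i), ⟨hx, trivial⟩, rfl⟩)
  | node b i => exact Or.inl (Or.inr ⟨(b, i), ⟨hx, trivial⟩, rfl⟩)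
  | tip b => exact Or.inr ⟨b, hx, rfl⟩

/-- The points of bounded height turn the space into a Type I space. -/
def typeI (L : LadderData) : TypeI (LadderSpace L) :=
  TypeI.ofStages (fun a => {x | ht x < a}) (fun a => {x | ht x ≤ a}) isOpen_ht_lt
    (fun a => (countable_ht_le a).isLindelof)
    (fun a => closure_minimal (fun x h => show ht x ≤ a from le_of_lt h) (isClosed_ht_le a))
    (by exact fun _ _ h _ hx => lt_of_le_of_lt hx h) (by exact fun x => exists_gt (ht x))
    (by exact fun a => ⟨tip a, lt_irrefl a⟩)

theorem stage_typeI (a : Om1) : (typeI L).stage a = {x | ht x < a} := TypeI.stage_ofStages a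

theorem unbounded_iff {A : Set (LadderSpace L)} :
    (typeI L).Unbounded A ↔ ∀ b, ∃ x ∈ A, b < ht x := by
  rw [TypeI.unbounded_iff]
  refine ⟨fun h b => ?_, fun h b => ?_⟩
  · obtain ⟨c, hc⟩ := exists_gt b
    obtain ⟨x, hx, hx'⟩ := h c
    rw [stage_typeI] at hx'
    exact ⟨x, hx, hc.trans_le (not_lt.1 hx')⟩
  · obtain ⟨x, hx, hx'⟩ := h b
    refine ⟨x, hx, ?_⟩
    rw [stage_typeI]
    exact lt_asymm hx'

theorem metrizable_separable_basic (x : LadderSpace L) :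
    TopologicalSpace.MetrizableSpace ↥(basic x 0) ∧
      TopologicalSpace.SeparableSpace ↥(basic x 0) := by
  have : Countable ↥(basic x 0) :=
    ((countable_ht_le (ht x)).mono fun _ hy => ht_le_of_mem_basic hy).to_subtype
  refine metrizable_separable_of_countable (fun y k => Subtype.val ⁻¹' basic y.1 k)
    (fun y k => (isClopen_basic _ _).preimage continuous_subtype_val) (fun y U hU => ?_)
    fun y k => mem_basic _ _
  obtain ⟨V, hV, hVU⟩ := (mem_nhds_subtype _ _ _).1 hU
  obtain ⟨O, hOV, hO, hyO⟩ := mem_nhds_iff.1 hV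
  obtain ⟨k, hk⟩ := exists_basic_subset hO hyO
  exact ⟨k, fun z hz => hVU (hOV (hk hz))⟩

theorem isClubDiscrete_of_subset_tip {E : Set (LadderSpace L)} (hE : (typeI L).Unbounded E)
    (h : E ⊆ range tip) : (typeI L).IsClubDiscrete E := by
  refine TypeI.isClubDiscrete_of_locally hE fun x => ⟨basic x 0, basic_mem_nhds x 0, ?_⟩
  rintro y ⟨hy, hyE⟩
  obtain ⟨b, rfl⟩ := h hyE
  cases x with
  | iso c i => cases mem_singleton_iff.1 hy
  | tip c => obtain h | ⟨i, _, h⟩ := hy <;> cases h; exact rfl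
  | node a n => exact absurd rfl (Nb.ne_tip hy b)

/-- The neighbourhoods of `node a 0` contain an isolated point of each column high enough below `a`,
and its position `Nat.pair 0 j` in the column is at least `j`, hence eventually at least `m`. -/
theorem le_apply_node {f : LadderSpace L → LongRay} {V : Set LongRay} (hf : Continuous f)
    (hV : IsClosed V) {A : Set Om1} {m : ℕ} (hA : ∀ b ∈ A, ∀ i, m ≤ i → f (iso b i) ∈ V)
    {a : Om1} (ha : IsLim a) (hlim : ∀ c < a, ∃ b ∈ A, c < b ∧ b < a) :
    f (node a 0) ∈ V := by
  by_contra hcon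
  obtain ⟨k, hk⟩ := exists_basic_subset (hV.isOpen_compl.preimage hf) hcon
  obtain ⟨b, hbA, hkb, hba⟩ := hlim _ (L.h_lt (max k m) ha)
  classical
  have hex : ∃ j, b ≤ L.h a (j + 1) := by
    obtain ⟨j, hj⟩ := L.h_cofinal ha b hba
    exact ⟨j, hj.le.trans ((L.h_strictMono ha).monotone (Nat.le_succ j))⟩
  have hj1 : L.h a (Nat.find hex) < b := by
    rcases Nat.eq_zero_or_pos (Nat.find hex) with h0 | h0
    · rw [h0]
      exact ((L.h_strictMono ha).monotone (Nat.zero_le _)).trans_lt hkb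
    · obtain ⟨i, hi⟩ := Nat.exists_eq_succ_of_ne_zero h0.ne'
      have := Nat.find_min hex (m := i) (by omega)
      rw [hi]
      exact not_le.1 this
  have hj2 : max k m ≤ Nat.find hex := by
    by_contra! hlt
    exact (hkb.trans_le (Nat.find_spec hex)).not_ge ((L.h_strictMono ha).monotone hlt)
  have hmem : iso b (Nat.pair 0 (Nat.find hex)) ∈ basic (node a 0 : LadderSpace L) k :=
    Nb.own ha ((le_max_left _ _).trans hj2) hj1 (Nat.find_spec hex)
  exact hk hmem (hA b hbA _ (((le_max_right _ _).trans hj2).trans (Nat.right_le_pair _ _)))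

/-- Near a tip the value of `f` is shared by almost all of its column. After fixing a common bound
`m` for uncountably many columns, a node over a common limit of the two families of columns gives
the contradiction. -/
theorem isDirection_tip (L : LadderData) : (typeI L).IsDirection (range tip) := by
  have hub : (typeI L).Unbounded (range tip) := unbounded_iff.2 fun b => by
    obtain ⟨a, ha⟩ := exists_gt b
    exact ⟨tip a, mem_range_self a, ha⟩
  refine TypeI.isDirection_of_rigid (isClubDiscrete_of_subset_tip hub subset_rfl).1
    fun f hf a ha => ?_
  obtain ⟨b, hab⟩ := exists_gt a
  refine ⟨b, ?_⟩
  by_contra hb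
  have key : ∀ V : Set LongRay, IsOpen V → ¬ {x | x ∈ range tip ∧ f x ∈ V}.Countable →
      ∃ A : Set Om1, ∃ m : ℕ, (∀ b ∈ A, ∀ i, m ≤ i → f (iso b i) ∈ V) ∧ ∀ c, ∃ b ∈ A, c < b := by
    intro V hV hVc
    have hu : ¬ {b | f (tip b) ∈ V}.Countable := by
      refine fun h => hVc ((h.image tip).mono ?_)
      rintro _ ⟨⟨b, rfl⟩, h⟩
      exact ⟨b, h, rfl⟩
    obtain ⟨m, hm⟩ := exists_uncountable_fiber hu
      (fun b m => ∀ i, m ≤ i → f (iso b i) ∈ V) fun b hb => (hV.preimage hf).2 b hb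
    exact ⟨_, m, fun b hb => hb.2, unbounded_of_uncountable hm⟩
  obtain ⟨A, m, hA, hA'⟩ := key _ isOpen_Iio ha
  obtain ⟨B, n, hB, hB'⟩ := key _ isOpen_Ioi hb
  obtain ⟨G, hG⟩ := exists_closure_limit hA'
  obtain ⟨G', hG'⟩ := exists_closure_limit hB'
  obtain ⟨H, hH, hH'⟩ := exists_closure_subset_two G G'
  obtain ⟨d, hd, -⟩ := exists_mem_closure H a
  have h1 := le_apply_node hf isClosed_Iic (fun b hb i hi => Iio_subset_Iic_self (hA b hb i hi))
    hd.1 (hG d (hH hd))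
  have h2 := le_apply_node hf isClosed_Ici (fun b hb i hi => Ioi_subset_Ici_self (hB b hb i hi))
    hd.1 (hG' d (hH' hd))
  exact not_le.2 hab (LongRay.pt_le_iff.1 (le_trans h2 h1))

theorem hasDiscreteDirection (L : LadderData) : (typeI L).HasDiscreteDirection where
  t2 := inferInstance
  locallyMetrizable x := ⟨_, basic_mem_nhds x 0, (metrizable_separable_basic x).1⟩
  locallySeparable x := ⟨_, basic_mem_nhds x 0, (metrizable_separable_basic x).2⟩
  discreteDirection :=
    ⟨_, isDirection_tip L, (isClubDiscrete_of_subset_tip (isDirection_tip L).1.2 subset_rfl).2⟩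

/-- Every unbounded set of nodes contains a club discrete set. -/
theorem exists_isClubDiscrete_of_node {E : Set (LadderSpace L)} (hE : (typeI L).Unbounded E)
    (hnode : ∀ x ∈ E, ∃ a n, x = node a n) : ∃ E' ⊆ E, (typeI L).IsClubDiscrete E' := by
  obtain ⟨e, b, he⟩ := exists_sparse (Y := LadderSpace L) ht (fun _ x => x ∈ E)
    fun _ c => unbounded_iff.1 hE c
  have hht : StrictMono fun i => ht (e i) := fun i j hij =>
    ((he j).2.2 i hij).trans_lt (he j).2.1
  have hQ : ¬ (univ : Set Om1).Countable := uncountable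
  -- Thinning to a constant rational approximation, taken at the gap `b i` below each node, is what
  -- prevents accumulation.
  obtain ⟨Q, hQ⟩ := exists_uncountable_fiber hQ (fun i Q => L.q (ht (e i)) (b i) = Q)
    fun i _ => ⟨_, rfl⟩
  refine ⟨e '' {i | i ∈ univ ∧ L.q (ht (e i)) (b i) = Q}, ?_,
    TypeI.isClubDiscrete_of_locally ?_ fun x => ?_⟩
  · rintro _ ⟨i, _, rfl⟩
    exact (he i).1
  · refine unbounded_iff.2 fun c => ?_
    obtain ⟨_, ⟨i, hi, rfl⟩, hc⟩ := unbounded_of_uncountable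
      (s := (fun i => ht (e i)) '' {i | i ∈ univ ∧ L.q (ht (e i)) (b i) = Q})
      (fun h => hQ (countable_of_injective_of_countable_image hht.injective.injOn h)) c
    exact ⟨_, ⟨i, hi, rfl⟩, hc⟩
  · by_contra! hcon
    have hx : ∃ a n, x = node a n := by
      obtain ⟨_, ⟨hy, ⟨i, hi, rfl⟩⟩, hyx⟩ := not_subset.1 (hcon _ (basic_mem_nhds x 0))
      obtain ⟨a, n, han⟩ := hnode _ (he i).1
      rw [han] at hy hyx
      cases x with
      | iso c i => exact absurd hy hyx
      | tip c => obtain h | ⟨i, _, h⟩ := hy <;> cases h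
      | node a n => exact ⟨a, n, rfl⟩
    obtain ⟨a, n, rfl⟩ := hx
    have key : ∀ k, IsLim a ∧ ∃ i, L.q (ht (e i)) (b i) = Q ∧ ∃ j, k ≤ j ∧ Block a n j (e i) := by
      intro k
      obtain ⟨_, ⟨hy, ⟨i, hi, rfl⟩⟩, hyx⟩ := not_subset.1 (hcon _ (basic_mem_nhds (node a n) k))
      obtain ⟨ha, h⟩ := (nb_iff.1 hy).resolve_left hyx
      exact ⟨ha, i, hi.2, h⟩
    have ha := (key 0).1
    -- Beyond block `k` all heights exceed `γ a n`, so the gap below any later node of the sequence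
    -- does so too.
    obtain ⟨k, hk⟩ := L.h_cofinal ha _ (L.γ_lt n ha)
    obtain ⟨-, i, hi, j, hj, hB⟩ := key k
    obtain ⟨-, i', hi', j', hj', hB'⟩ := key (j + 1)
    have hlt : ht (e i) < ht (e i') := hB.ht_mem.2.trans_lt
      (((L.h_strictMono ha).monotone hj').trans_lt hB'.ht_mem.1)
    have hii : i < i' := hht.lt_iff_lt.1 hlt
    have hγ : L.γ a n < b i' := (hk.trans_le ((L.h_strictMono ha).monotone hj)).trans
      (hB.ht_mem.1.trans_le ((he i').2.2 i hii))
    obtain ⟨c, p, hc⟩ := hnode _ (he i).1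
    obtain ⟨c', p', hc'⟩ := hnode _ (he i').1
    have h1 := (hB.spec hc).2.2
    have h2 := (hB'.spec hc').2.1
    have e1 : ht (e i) = c := by rw [hc]; rfl
    have e2 : ht (e i') = c' := by rw [hc']; rfl
    have l1 := (he i).2.1
    have l2 := (he i').2.1
    rw [e1] at hi l1
    rw [e2] at hi' l2
    -- For nodes at heights `c` and `c'` in blocks `j < j'` this yields `Q < r c ≤ x a (j + 1) ≤ x a
    -- j' < q c' (γ a n) ≤ Q`.
    have h3 := h2 (hγ.trans l2)
    have h4 : (L.q c' (L.γ a n) : ℝ) ≤ L.q c' (b i') := by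
      exact_mod_cast L.q_mono hγ.le l2
    have h5 := L.q_lt l1
    rw [hi] at h5
    rw [hi'] at h4
    have h6 := (L.x_strictMono ha).monotone hj'
    linarith

/-- If neither the tips nor the nodes of `C` are unbounded, a final part of `C` consists of isolated
points and is discrete as it stands. -/
theorem exists_isClubDiscrete {C : Set (LadderSpace L)} (hC : (typeI L).IsClub C) :
    ∃ E ⊆ C, (typeI L).IsClubDiscrete E := by
  by_cases h1 : (typeI L).Unbounded (C ∩ range tip)
  · exact ⟨_, inter_subset_left, isClubDiscrete_of_subset_tip h1 inter_subset_right⟩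
  by_cases h2 : (typeI L).Unbounded (C ∩ {x | ∃ a n, x = node a n})
  · obtain ⟨E, hE, hE'⟩ := exists_isClubDiscrete_of_node h2 fun x hx => hx.2
    exact ⟨E, hE.trans inter_subset_left, hE'⟩
  obtain ⟨a, ha⟩ := (typeI L).not_unbounded_iff.1 h1
  obtain ⟨b, hb⟩ := (typeI L).not_unbounded_iff.1 h2
  refine ⟨C \ (typeI L).stage (max a b), sdiff_subset,
    TypeI.isClubDiscrete_of_locally (hC.2.diff_stage _) fun x => ?_⟩
  by_cases hx : x ∈ C \ (typeI L).stage (max a b)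
  · cases x with
    | iso c i => exact ⟨_, basic_mem_nhds _ 0, inter_subset_left⟩
    | tip c =>
      exact absurd ((typeI L).stage_mono (le_max_left _ _) (ha ⟨hx.1, mem_range_self c⟩)) hx.2
    | node c n =>
      exact absurd ((typeI L).stage_mono (le_max_right _ _) (hb ⟨hx.1, c, n, rfl⟩)) hx.2
  · refine ⟨(C \ (typeI L).stage (max a b))ᶜ, IsOpen.mem_nhds ?_ hx, ?_⟩
    · exact (hC.1.sdiff ((typeI L).isOpen_stage _)).isOpen_compl
    · rintro y ⟨h, h'⟩
      exact absurd h' h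

end LadderSpace

end

/-! ### Collectionwise Hausdorffness of the ladder space -/

noncomputable section

open Om1

/-- Separating a set of points which falls into countable groups having disjoint neighbourhoods. -/
theorem exists_pairwiseDisjoint_of_countable_groups {X ι : Type*} [TopologicalSpace X] {E : Set X}
    (ν : X → ι) (hν : ∀ v, {e ∈ E | ν e = v}.Countable) (B : X → Set X)
    (hB : ∀ e ∈ E, IsClopen (B e) ∧ e ∈ B e ∧ B e ∩ E ⊆ {e} ∧ ∀ x ∈ B e, ν x = ν e) :
    ∃ U : X → Set X, (∀ x ∈ E, IsOpen (U x) ∧ x ∈ U x) ∧ E.PairwiseDisjoint U := by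
  have hinj : ∀ v, ∃ g : X → ℕ, InjOn g {e ∈ E | ν e = v} := fun v =>
    (countable_iff_exists_injOn.1 (hν v))
  choose g hg using hinj
  -- The finitely many members of the group of `e` enumerated before `e`; their neighbourhoods are
  -- subtracted.
  let P : X → Set X := fun e => {e' | (e' ∈ E ∧ ν e' = ν e) ∧ g (ν e) e' < g (ν e) e}
  have hfin : ∀ e, (P e).Finite := fun e => by
    refine Set.Finite.of_finite_image (f := g (ν e)) ((finite_Iio (g (ν e) e)).subset ?_)
      ((hg (ν e)).mono fun x hx => hx.1)
    rintro _ ⟨x, hx, rfl⟩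
    exact hx.2
  refine ⟨fun e => B e \ ⋃ e' ∈ P e, B e', fun e he => ⟨?_, (hB e he).2.1, ?_⟩, ?_⟩
  · refine (hB e he).1.isOpen.sdiff ((hfin e).isClosed_biUnion fun e' he' => ?_)
    exact (hB e' he'.1.1).1.isClosed
  · intro hmem
    obtain ⟨e', he', h⟩ := mem_iUnion₂.1 hmem
    have : e = e' := (hB e' he'.1.1).2.2.1 ⟨h, he⟩
    subst this
    exact lt_irrefl _ he'.2
  · intro e he e' he' hne
    have key : ∀ e ∈ E, ∀ e' ∈ E, ν e = ν e' → g (ν e) e < g (ν e) e' →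
        ∀ x ∈ B e, x ∉ B e' \ ⋃ e'' ∈ P e', B e'' := fun e he e' he' h hlt x hx hx' =>
      hx'.2 (mem_iUnion₂.2 ⟨e, ⟨⟨he, h⟩, h ▸ hlt⟩, hx⟩)
    refine disjoint_left.2 fun x hx hx' => ?_
    have h : ν e = ν e' := ((hB e he).2.2.2 x hx.1).symm.trans ((hB e' he').2.2.2 x hx'.1)
    rcases lt_trichotomy (g (ν e) e) (g (ν e) e') with hlt | heq | hlt
    · exact key e he e' he' h hlt x hx.1 hx'
    · exact hne (hg (ν e) ⟨he, rfl⟩ ⟨he', h.symm⟩ heq)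
    · exact key e' he' e he h.symm (h ▸ hlt) x hx'.1 hx

namespace LadderSpace

variable {L : LadderData}

/-- Stationarily many members of a stationary set have fertile guesses of a stationary subset. -/
theorem exists_fertile {S : Set Om1} (hS : Stationary S) (n : ℕ) :
    ∃ T ⊆ S, ∃ a n', L.Fertile a n' ∧ L.A a n' ⊆ T ∧ L.m a n' = n := by
  obtain ⟨γ₀, hS₀⟩ := hS.exists_fiber (fun a b => L.γ a n = b) fun a _ ha => ⟨_, L.γ_lt n ha, rfl⟩
  set T := {a ∈ S | L.γ a n = γ₀} with hT
  -- Press down once for every rational interval that `r` hits stationarily often. As there are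
  -- countably many intervals, one ordinal `γ₁` then serves for all of them.
  have hc : ∀ p : ℚ × ℚ, ∃ c, Stationary {b ∈ T | p.1 < L.r b ∧ L.r b < p.2} →
      Stationary {b ∈ {b ∈ T | p.1 < L.r b ∧ L.r b < p.2} | (c < b ∧ (p.1 : ℝ) < L.q b c)} := by
    intro p
    by_cases hp : Stationary {b ∈ T | p.1 < L.r b ∧ L.r b < p.2}
    · obtain ⟨c, hc⟩ := hp.exists_fiber (fun b c => c < b ∧ (p.1 : ℝ) < L.q b c) fun b hb hlim => by
        obtain ⟨c, hc, hc'⟩ := L.q_cofinal hlim _ hb.2.1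
        exact ⟨c, hc, hc, hc'⟩
      exact ⟨c, fun _ => hc⟩
    · exact ⟨γ₀, fun h => absurd h hp⟩
  choose c hc using hc
  obtain ⟨γ₁, hγ₁⟩ := exists_gt_of_countable ((countable_range c).union (countable_singleton γ₀))
  have hγc : ∀ p, c p < γ₁ := fun p => hγ₁ _ (Or.inl ⟨p, rfl⟩)
  have hγ0 : γ₀ < γ₁ := hγ₁ _ (Or.inr rfl)
  have hG : ∀ p : ℚ × ℚ, ∃ G, Stationary {b ∈ T | p.1 < L.r b ∧ L.r b < p.2} →
      ∀ d ∈ Closure G, ∀ a < d, ∃ b ∈ {b ∈ T | (p.1 < L.r b ∧ L.r b < p.2) ∧ IsLim b ∧ γ₁ < b ∧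
        (p.1 : ℝ) < L.q b γ₁}, a < b ∧ b < d := by
    intro p
    by_cases hp : Stationary {b ∈ T | p.1 < L.r b ∧ L.r b < p.2}
    · obtain ⟨G, hG⟩ := exists_closure_limit (A := {b ∈ T | (p.1 < L.r b ∧ L.r b < p.2) ∧ IsLim b ∧
        γ₁ < b ∧ (p.1 : ℝ) < L.q b γ₁}) fun a => by
          obtain ⟨b, ⟨hb, hbG⟩, hab⟩ := ((hc p hp).inter_closure id).unbounded (max a γ₁)
          have h1 : γ₁ < b := (le_max_right _ _).trans_lt hab
          refine ⟨b, ⟨hb.1.1, hb.1.2, hbG.1, h1, ?_⟩, (le_max_left _ _).trans_lt hab⟩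
          refine hb.2.2.trans_le ?_
          exact_mod_cast L.q_mono (hγc p).le h1
      exact ⟨G, fun _ => hG⟩
    · exact ⟨id, fun h => absurd h hp⟩
  choose G hG using hG
  -- Almost every `a` in `T` has stationarily many members of `T` with `r`-value in `(y, r a)`. The
  -- exceptional `a` either lie together in one nonstationary set given by a rational cut, or else
  -- no two of them can have different values of `r`.
  have hbad : ∀ y : ℚ, ¬ Stationary {a ∈ T | y < L.r a ∧
      ¬ Stationary {b ∈ T | y < L.r b ∧ L.r b < L.r a}} := by
    intro y hy
    obtain ⟨o, ho⟩ := hy.exists_of_countable_cover (fun a (o : Option ℚ) => match o with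
      | some y' => L.r a < y' ∧ ¬ Stationary {b ∈ T | y < L.r b ∧ L.r b < y'}
      | none => ∀ y' : ℚ, ¬ Stationary {b ∈ T | y < L.r b ∧ L.r b < y'} → y' ≤ L.r a)
      fun a _ => by
        by_cases h : ∃ y' : ℚ, L.r a < y' ∧ ¬ Stationary {b ∈ T | y < L.r b ∧ L.r b < y'}
        · obtain ⟨y', h⟩ := h
          exact ⟨some y', h⟩
        · push Not at h
          refine ⟨none, fun y' hy' => ?_⟩
          by_contra hlt
          exact hy' (h y' (not_le.1 hlt))
    cases o with
    | some y' =>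
      obtain ⟨a, ha, -⟩ := ho id
      exact ha.2.2 (ho.mono fun b hb => ⟨hb.1.1, hb.1.2.1, hb.2.1⟩)
    | none =>
      obtain ⟨a, ha, -⟩ := ho.unbounded (Classical.arbitrary Om1)
      obtain ⟨b, hb, hab⟩ := ho.unbounded a
      have key : ∀ a b, a ∈ T ∧ (y < L.r a ∧
          ¬ Stationary {b ∈ T | y < L.r b ∧ L.r b < L.r a}) → (∀ y' : ℚ,
          ¬ Stationary {b ∈ T | y < L.r b ∧ L.r b < y'} → y' ≤ L.r b) → ¬ L.r b < L.r a := by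
        intro a b ha hb hlt
        obtain ⟨y', h1, h2⟩ := exists_rat_btwn hlt
        refine h1.not_ge (hb y' fun hst => ha.2.2 (hst.mono fun d hd => ?_))
        exact ⟨hd.1, hd.2.1, hd.2.2.trans h2⟩
      rcases lt_trichotomy (L.r a) (L.r b) with h | h | h
      · exact key b a hb.1 ha.2 h
      · exact hab.ne (L.r_injective h)
      · exact key a b ha.1 hb.2 h
  obtain ⟨o, ho⟩ := hS₀.exists_of_countable_cover (fun a (o : Option ℚ) => match o with
    | some y => y < L.r a ∧ ¬ Stationary {b ∈ T | y < L.r b ∧ L.r b < L.r a}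
    | none => ∀ y : ℚ, y < L.r a → Stationary {b ∈ T | y < L.r b ∧ L.r b < L.r a}) fun a _ => by
      by_cases h : ∃ y : ℚ, y < L.r a ∧ ¬ Stationary {b ∈ T | y < L.r b ∧ L.r b < L.r a}
      · obtain ⟨y, h⟩ := h
        exact ⟨some y, h⟩
      · push Not at h
        exact ⟨none, h⟩
  cases o with
  | some y => exact absurd ho (hbad y)
  | none =>
    obtain ⟨G₁, hG₁⟩ := exists_closure_subset G
    obtain ⟨G₂, hG₂⟩ := L.guess T
    obtain ⟨G₃, h31, h32⟩ := exists_closure_subset_two G₁ G₂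
    obtain ⟨G₄, h43, h4⟩ := exists_closure_subset_two G₃ fun _ => γ₁
    obtain ⟨a, ha, haG⟩ := ho G₄
    have hlim : IsLim a := haG.1
    have hγa : γ₁ < a := by
      obtain ⟨b, hb⟩ := hlim.1
      exact (h4 haG).2 b hb
    -- The guess for `T` decorated by `n` and `γ₁`: then `γ b n = γ₀ < γ₁ < b` for the chosen `b` in
    -- `T`, as usability demands.
    obtain ⟨n', hA, hm, hγ⟩ := hG₂ a (h32 (h43 haG)) n γ₁ hγa
    refine ⟨T, fun b hb => hb.1, a, n', ⟨hlim, fun d hd y hy => ?_⟩,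
      hA ▸ inter_subset_left, hm⟩
    obtain ⟨y₁, hy1, hy1'⟩ := exists_rat_btwn hy
    have hst := ha.2 y₁ hy1'
    obtain ⟨y₂, hy2⟩ := hst.exists_of_countable_cover
      (fun b (y₂ : ℚ) => L.r b < y₂ ∧ (y₂ : ℝ) < L.r a) fun b hb => exists_rat_btwn hb.2.2
    have hy2' : (y₂ : ℝ) < L.r a := by
      obtain ⟨b, hb, -⟩ := hy2 id
      exact hb.2.2
    have hst' : Stationary {b ∈ T | y₁ < L.r b ∧ L.r b < y₂} :=
      hy2.mono fun b hb => ⟨hb.1.1, hb.1.2.1, hb.2.1⟩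
    obtain ⟨b, ⟨hbT, hbr, hblim, hbγ, hbq⟩, hdb, hba⟩ := hG (y₁, y₂) hst' a
      (hG₁ (y₁, y₂) (h31 (h43 haG))) d hd
    refine ⟨b, ?_, hdb, hba, hblim, ?_, ?_, ?_, hbr.2.trans hy2'⟩
    · rw [hA]; exact ⟨hbT, hba⟩
    · rw [hm, hγ, show L.γ b n = γ₀ from hbT.2]; exact hγ0.le
    · rw [hγ]; exact hbγ
    · rw [hγ]; exact hy1.trans hbq

/-- At a fertile guess of a stationary subset of these heights, the guessing node is a limit of the
nodes of `E` absorbed by its neighbourhoods. -/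
theorem not_stationary_of_isClosed_discrete {E : Set (LadderSpace L)} (hE : IsClosed E)
    (hE' : DiscreteTopology ↥E) (n : ℕ) : ¬ Stationary {a | node a n ∈ E} := by
  intro hS
  obtain ⟨T, hT, a, n', hF, hA, hm⟩ := exists_fertile (L := L) hS n
  have h := (isClosed_and_discrete_iff.1 ⟨hE, isDiscrete_iff_discreteTopology.2 hE'⟩)
    (node a n' : LadderSpace L)
  rw [Filter.disjoint_principal_right, mem_nhdsWithin_iff_eventually] at h
  obtain ⟨V, hV, hVo, hmem⟩ := mem_nhds_iff.1 h
  obtain ⟨k, hk⟩ := exists_basic_subset hVo hmem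
  have hj : (Nat.unpair (Nat.pair n' k)).1 = n' := by simp
  have hF' : L.Fertile a (Nat.unpair (Nat.pair n' k)).1 := by rwa [hj]
  have hU := L.z_usable _ hF'
  have hNb := Nb.step hF' (Nat.right_le_pair n' k) Nb.self
  rw [hj, hm] at hNb
  have hz := hU.1
  rw [hj] at hz
  refine hV (hk hNb) (fun he => ?_) (hT (hA hz))
  have : L.z a (Nat.pair n' k) = a := congrArg ht he
  exact hU.2.2.1.ne this

/-- A club avoids the heights of all nodes in `E`. Points between the same consecutive members of
the club form countable groups, and the members of `E` have neighbourhoods within their groups. -/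
theorem collectionwiseHausdorff (L : LadderData) : CollectionwiseHausdorff (LadderSpace L) := by
  intro E hE hE'
  have hG : ∀ n, ∃ G, {a | (node a n : LadderSpace L) ∈ E} ∩ Closure G = ∅ := by
    intro n
    have := not_stationary_of_isClosed_discrete hE hE' n
    simp only [Stationary, not_forall, not_nonempty_iff_eq_empty] at this
    exact this
  choose G' hG' using hG
  obtain ⟨G, hG⟩ := exists_closure_subset G'
  let ν : LadderSpace L → Set Om1 := fun x => {d | d ∈ Closure G ∧ ht x ≤ d}
  have hB : ∀ e, ∃ k, e ∈ E → basic e k ∩ E ⊆ {e} ∧ ∀ x ∈ basic e k, ν x = ν e := by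
    intro e
    by_cases he : e ∈ E
    swap
    · exact ⟨0, fun h => absurd h he⟩
    have h := (isClosed_and_discrete_iff.1 ⟨hE, isDiscrete_iff_discreteTopology.2 hE'⟩) e
    rw [Filter.disjoint_principal_right, mem_nhdsWithin_iff_eventually] at h
    obtain ⟨V, hV, hVo, hmem⟩ := mem_nhds_iff.1 h
    obtain ⟨k, hk⟩ := exists_basic_subset hVo hmem
    have hl : ∃ l, ∀ x ∈ basic e l, ν x = ν e := by
      cases e with
      | iso b i =>
        refine ⟨0, fun x hx => ?_⟩
        rw [mem_singleton_iff.1 hx]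
      | tip b => exact ⟨0, fun x hx => by obtain rfl | ⟨i, _, rfl⟩ := hx <;> rfl⟩
      | node a n =>
        by_cases ha : IsLim a
        -- Otherwise closure points of `G` would be cofinal in `a`, which would make `a` a closure
        -- point and contradict that its node is in `E`.
        · have hac : ∃ c < a, ∀ d ∈ Closure G, c < d → a ≤ d := by
            by_contra! hcon
            have : a ∈ {a | (node a n : LadderSpace L) ∈ E} ∩ Closure (G' n) := by
              refine ⟨he, hG n ⟨ha, fun c hc => ?_⟩⟩
              obtain ⟨d, hd, hcd, hda⟩ := hcon c hc
              exact (hd.2 c hcd).trans hda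
            rw [hG' n] at this
            exact this
          obtain ⟨c, hc, hcd⟩ := hac
          obtain ⟨l, hl⟩ := exists_lt_ht_of_mem_basic (x := (node a n : LadderSpace L)) hc
          refine ⟨l, fun x hx => Set.ext fun d => and_congr_right fun hd => ⟨fun h => ?_, fun h => ?_⟩⟩
          · exact hcd d hd ((hl x hx).trans_le h)
          · exact (ht_le_of_mem_basic hx).trans h
        · refine ⟨0, fun x hx => ?_⟩
          obtain rfl | ⟨h, _⟩ := nb_iff.1 hx
          · rfl
          · exact absurd h ha
    obtain ⟨l, hl⟩ := hl
    refine ⟨max k l, fun _ => ⟨fun x hx => ?_, fun x hx => hl x (basic_anti e (le_max_right _ _) hx)⟩⟩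
    by_contra hne
    exact hV (hk (basic_anti e (le_max_left _ _) hx.1)) hne hx.2
  choose k hk using hB
  refine exists_pairwiseDisjoint_of_countable_groups ν (fun v => ?_) (fun e => basic e (k e))
    fun e he => ⟨isClopen_basic _ _, mem_basic _ _, hk e he⟩
  rcases {e ∈ E | ν e = v}.eq_empty_or_nonempty with h | ⟨e, he⟩
  · rw [h]; exact countable_empty
  · obtain ⟨d, hd, hed⟩ := exists_mem_closure G (ht e)
    refine (countable_ht_le d).mono fun x hx => ?_
    have : d ∈ ν x := by
      rw [hx.2, ← he.2]
      exact ⟨hd, hed.le⟩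
    exact this.2

end LadderSpace

theorem DiamondStar.exists_collectionwiseHausdorff (h : DiamondStar) :
    ∃ (X : Type) (_ : TopologicalSpace X) (F : TypeI X),
      F.ClubsContainDiscrete ∧ CollectionwiseHausdorff X := by
  obtain ⟨D⟩ := h.exists_guessData
  obtain ⟨L, -⟩ := D.exists_ladderData
  exact ⟨LadderSpace L, inferInstance, LadderSpace.typeI L, ⟨LadderSpace.hasDiscreteDirection L,
    fun C hC => LadderSpace.exists_isClubDiscrete hC⟩, LadderSpace.collectionwiseHausdorff L⟩

end

/-! ### Locally Euclidean spaces -/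

noncomputable section

/-- Each point is covered by an open copy of the Euclidean space of dimension `n`. -/
def LocEuclidean (n : ℕ) (X : Type*) [TopologicalSpace X] : Prop :=
  ∀ x : X, ∃ e : EuclideanSpace ℝ (Fin n) → X, IsOpenEmbedding e ∧ x ∈ range e

section LocEuclidean

variable {n m : ℕ} {X Y : Type*} [TopologicalSpace X] [TopologicalSpace Y]

theorem isOpenEmbedding_univBall (p : EuclideanSpace ℝ (Fin n)) (r : ℝ) :
    IsOpenEmbedding (OpenPartialHomeomorph.univBall p r) :=
  OpenPartialHomeomorph.isOpenEmbedding _ (OpenPartialHomeomorph.univBall_source p r)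

theorem range_univBall (p : EuclideanSpace ℝ (Fin n)) {r : ℝ} (hr : 0 < r) :
    range (OpenPartialHomeomorph.univBall p r) = Metric.ball p r := by
  rw [← image_univ, ← OpenPartialHomeomorph.univBall_source p r,
    OpenPartialHomeomorph.image_source_eq_target, OpenPartialHomeomorph.univBall_target p hr]

theorem LocEuclidean.exists_subset (h : LocEuclidean n X) {x : X} {V : Set X} (hV : V ∈ 𝓝 x) :
    ∃ e : EuclideanSpace ℝ (Fin n) → X, IsOpenEmbedding e ∧ e 0 = x ∧ range e ⊆ V := by
  obtain ⟨e, he, p, rfl⟩ := h x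
  obtain ⟨r, hr, hrV⟩ := Metric.mem_nhds_iff.1 (he.continuous.continuousAt.preimage_mem_nhds hV)
  refine ⟨e ∘ OpenPartialHomeomorph.univBall p r, he.comp (isOpenEmbedding_univBall p r), ?_, ?_⟩
  · simp [OpenPartialHomeomorph.univBall_apply_zero]
  · rw [range_comp, range_univBall p hr]
    exact image_subset_iff.2 hrV

theorem locEuclidean_iff : LocEuclidean n X ↔
    ∀ x : X, ∃ U ∈ 𝓝 x, Nonempty (↥U ≃ₜ EuclideanSpace ℝ (Fin n)) := by
  refine forall_congr' fun x => ⟨?_, ?_⟩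
  · rintro ⟨e, he, hx⟩
    exact ⟨range e, he.isOpen_range.mem_nhds hx, ⟨he.toIsEmbedding.toHomeomorph.symm⟩⟩
  · rintro ⟨U, hU, ⟨h⟩⟩
    have hxU : x ∈ U := mem_of_mem_nhds hU
    have hO : (Subtype.val ⁻¹' interior U : Set U) ∈ 𝓝 (⟨x, hxU⟩ : U) :=
      (isOpen_interior.preimage continuous_subtype_val).mem_nhds (mem_interior_iff_mem_nhds.2 hU)
    have hO' : h.symm ⁻¹' (Subtype.val ⁻¹' interior U) ∈ 𝓝 (h ⟨x, hxU⟩) :=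
      h.symm.continuous.continuousAt.preimage_mem_nhds (by rwa [h.symm_apply_apply])
    obtain ⟨r, hr, hrV⟩ := Metric.mem_nhds_iff.1 hO'
    have hb := isOpenEmbedding_univBall (h ⟨x, hxU⟩) r
    refine ⟨fun p => (h.symm (OpenPartialHomeomorph.univBall (h ⟨x, hxU⟩) r p)).1,
      ⟨IsEmbedding.subtypeVal.comp (h.symm.isEmbedding.comp hb.toIsEmbedding), ?_⟩,
      0, by simp [OpenPartialHomeomorph.univBall_apply_zero]⟩
    have hr' : range (fun p => h.symm (OpenPartialHomeomorph.univBall (h ⟨x, hxU⟩) r p)) ⊆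
        Subtype.val ⁻¹' interior U := by
      rintro _ ⟨p, rfl⟩
      exact hrV (range_univBall _ hr ▸ mem_range_self p)
    obtain ⟨W, hW, hWr⟩ := isOpen_induced_iff.1
      (h.symm.isOpenEmbedding.comp hb).isOpen_range
    have : range (fun p => (h.symm (OpenPartialHomeomorph.univBall (h ⟨x, hxU⟩) r p)).1) =
        W ∩ interior U := by
      ext y
      constructor
      · rintro ⟨p, rfl⟩
        exact ⟨hWr.ge (mem_range_self p), hr' (mem_range_self p)⟩
      · rintro ⟨hy, hy'⟩
        obtain ⟨p, hp⟩ := hWr.le (show (⟨y, interior_subset hy'⟩ : U) ∈ Subtype.val ⁻¹' W from hy)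
        exact ⟨p, congrArg Subtype.val hp⟩
    rw [this]
    exact hW.inter isOpen_interior

theorem LocEuclidean.of_isOpenEmbedding (h : LocEuclidean n X) {j : Y → X}
    (hj : IsOpenEmbedding j) : LocEuclidean n Y := by
  intro y
  obtain ⟨e, he, hey, her⟩ := h.exists_subset (hj.isOpen_range.mem_nhds (mem_range_self y))
  choose e' he' using fun p => her (mem_range_self p)
  have hc : j ∘ e' = e := funext he'
  refine ⟨e', IsOpenEmbedding.of_comp e' hj (hc ▸ he), 0, hj.injective ?_⟩
  rw [he', hey]

theorem locEuclidean_of_finrank_eq {V : Type*} [NormedAddCommGroup V] [NormedSpace ℝ V]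
    [FiniteDimensional ℝ V] (h : Module.finrank ℝ V = n) : LocEuclidean n V := by
  intro x
  let e : EuclideanSpace ℝ (Fin n) ≃L[ℝ] V := ContinuousLinearEquiv.ofFinrankEq (by simp [h])
  exact ⟨e, e.toHomeomorph.isOpenEmbedding, e.surjective x⟩

theorem LocEuclidean.prod (hX : LocEuclidean n X) (hY : LocEuclidean m Y) :
    LocEuclidean (n + m) (X × Y) := by
  rintro ⟨x, y⟩
  obtain ⟨e, he, p, rfl⟩ := hX x
  obtain ⟨f, hf, q, rfl⟩ := hY y
  let g : EuclideanSpace ℝ (Fin (n + m)) ≃L[ℝ]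
      EuclideanSpace ℝ (Fin n) × EuclideanSpace ℝ (Fin m) :=
    ContinuousLinearEquiv.ofFinrankEq (by simp)
  refine ⟨Prod.map e f ∘ g, (he.prodMap hf).comp g.toHomeomorph.isOpenEmbedding,
    g.symm (p, q), by simp⟩

theorem locEuclidean_real : LocEuclidean 1 ℝ := locEuclidean_of_finrank_eq (by simp)

theorem locEuclidean_of_chartedSpace [ChartedSpace (EuclideanSpace ℝ (Fin n)) X] :
    LocEuclidean n X := by
  refine locEuclidean_iff.2 fun x => ?_
  let φ := chartAt (EuclideanSpace ℝ (Fin n)) x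
  have hx := mem_chart_source (EuclideanSpace ℝ (Fin n)) x
  obtain ⟨r, hr, hrV⟩ := Metric.mem_nhds_iff.1 (φ.open_target.mem_nhds (φ.map_source hx))
  let ψ := (OpenPartialHomeomorph.univBall (φ x) r).trans φ.symm
  have hψ : ψ.source = univ := by
    simp only [ψ, OpenPartialHomeomorph.trans_source, OpenPartialHomeomorph.univBall_source,
      univ_inter, OpenPartialHomeomorph.symm_source]
    refine eq_univ_of_forall fun p => hrV ?_
    rw [← range_univBall _ hr]
    exact mem_range_self p
  have he := OpenPartialHomeomorph.isOpenEmbedding ψ hψ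
  refine ⟨range ψ, he.isOpen_range.mem_nhds ⟨0, ?_⟩, ⟨he.toIsEmbedding.toHomeomorph.symm⟩⟩
  simp [ψ, OpenPartialHomeomorph.univBall_apply_zero, φ.left_inv hx]

theorem locEuclidean_circle : LocEuclidean 1 Circle := locEuclidean_of_chartedSpace

/-- Countably many charts cover `K`. The point is that sets over `K` in products with the line
become hereditarily Lindelöf, and hence bounded in Type I spaces. -/
theorem LocEuclidean.exists_isOpen_secondCountable (h : LocEuclidean n X) {K : Set X}
    (hK : IsLindelof K) : ∃ Ω, IsOpen Ω ∧ K ⊆ Ω ∧ SecondCountableTopology ↥Ω := by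
  choose e he hx using h
  obtain ⟨t, ht, hKt⟩ := hK.elim_countable_subcover (fun x => range (e x))
    (fun x => (he x).isOpen_range) fun x _ => mem_iUnion.2 ⟨x, hx x⟩
  refine ⟨⋃ x ∈ t, range (e x), isOpen_biUnion fun x _ => (he x).isOpen_range, hKt, ?_⟩
  have : Countable t := ht.to_subtype
  have hsc : ∀ x : t, SecondCountableTopology
      ↥(Subtype.val ⁻¹' range (e x) : Set ↥(⋃ x ∈ t, range (e x))) := by
    intro x
    let φ : ↥(Subtype.val ⁻¹' range (e x) : Set ↥(⋃ x ∈ t, range (e x))) → range (e x) :=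
      fun y => ⟨y.1.1, y.2⟩
    have hval : IsEmbedding fun y : ↥(Subtype.val ⁻¹' range (e x) :
        Set ↥(⋃ x ∈ t, range (e x))) => y.1.1 :=
      IsEmbedding.subtypeVal.comp IsEmbedding.subtypeVal
    have hφ : IsEmbedding φ :=
      IsEmbedding.of_comp (g := Subtype.val) (by fun_prop) continuous_subtype_val hval
    have : SecondCountableTopology (range (e x)) :=
      (he x).toIsEmbedding.toHomeomorph.symm.isEmbedding.secondCountableTopology
    exact hφ.secondCountableTopology
  refine TopologicalSpace.secondCountableTopology_of_countable_cover (fun x : t =>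
    ((he x).isOpen_range.preimage continuous_subtype_val)) (eq_univ_of_forall fun y => ?_)
  obtain ⟨x, hx, hy⟩ := mem_iUnion₂.1 y.2
  exact mem_iUnion.2 ⟨⟨x, hx⟩, hy⟩

theorem LocEuclidean.locallyMetrizable {X : Type} [TopologicalSpace X] (h : LocEuclidean n X) :
    LocallyMetrizable X := fun x => by
  obtain ⟨e, he, hx⟩ := h x
  exact ⟨range e, he.isOpen_range.mem_nhds hx,
    he.toIsEmbedding.toHomeomorph.symm.isEmbedding.metrizableSpace⟩

theorem LocEuclidean.locallySeparable {X : Type} [TopologicalSpace X] (h : LocEuclidean n X) :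
    LocallySeparable X := fun x => by
  obtain ⟨e, he, hx⟩ := h x
  exact ⟨range e, he.isOpen_range.mem_nhds hx,
    he.toIsEmbedding.toHomeomorph.surjective.denseRange.separableSpace
      he.toIsEmbedding.toHomeomorph.continuous⟩

/-- The map `x ↦ b - (b - a) / (1 + x)` is strictly increasing with order-connected range, so it is
an embedding for the order topologies. -/
theorem exists_isOpenEmbedding_Ici {a b : ℝ} (hab : a < b) :
    ∃ φ : Ici (0 : ℝ) → Icc a b, IsOpenEmbedding φ ∧ range φ = {t | t.1 < b} := by
  have hpos : ∀ x : Ici (0 : ℝ), 0 < 1 + x.1 := fun x => by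
    have : (0 : ℝ) ≤ x.1 := x.2
    linarith
  have hb : ∀ x : Ici (0 : ℝ), b - (b - a) / (1 + x.1) ∈ Icc a b := fun x => by
    have h0 : (0 : ℝ) ≤ x.1 := x.2
    have h1 : (b - a) / (1 + x.1) ≤ b - a := div_le_self (by linarith) (by linarith)
    have h2 : 0 < (b - a) / (1 + x.1) := div_pos (by linarith) (hpos x)
    constructor <;> linarith
  let φ : Ici (0 : ℝ) → Icc a b := fun x => ⟨_, hb x⟩
  have hmono : StrictMono φ := fun x y hxy => by
    have hxy' : x.1 < y.1 := hxy
    have : (b - a) / (1 + y.1) < (b - a) / (1 + x.1) :=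
      div_lt_div_of_pos_left (by linarith) (hpos x) (by linarith)
    exact Subtype.mk_lt_mk.2 (by linarith)
  have hrange : range φ = {t | t.1 < b} := by
    ext t
    constructor
    · rintro ⟨x, rfl⟩
      have h2 : 0 < (b - a) / (1 + x.1) := div_pos (by linarith) (hpos x)
      show b - (b - a) / (1 + x.1) < b
      linarith
    · intro ht
      have ht' : 0 < b - t.1 := sub_pos.2 ht
      have hta : a ≤ t.1 := t.2.1
      refine ⟨⟨(t.1 - a) / (b - t.1), div_nonneg (by linarith) ht'.le⟩, Subtype.ext ?_⟩
      show b - (b - a) / (1 + (t.1 - a) / (b - t.1)) = t.1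
      have : 1 + (t.1 - a) / (b - t.1) = (b - a) / (b - t.1) := by
        field_simp; ring
      rw [this, div_div_eq_mul_div, mul_comm, mul_div_assoc, div_self (by linarith)]
      ring
  have hoc : OrdConnected (range φ) := by
    rw [hrange]
    exact ⟨fun x _ y hy z hz => lt_of_le_of_lt (show z.1 ≤ y.1 from hz.2) hy⟩
  refine ⟨φ, ⟨hmono.isEmbedding_of_ordConnected hoc, ?_⟩, hrange⟩
  rw [hrange]
  exact isOpen_lt continuous_subtype_val continuous_const

end LocEuclidean

end

/-! ### Manifolds with boundary and `ω`-bounded spaces -/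

noncomputable section

theorem isTopManifold_iff {X : Type} [TopologicalSpace X] {n : ℕ} :
    IsTopManifold X n ↔ T2Space X ∧ ConnectedSpace X ∧ LocEuclidean n X :=
  ⟨fun h => ⟨h.t2, h.connected, locEuclidean_iff.2 h.chart⟩,
    fun h => ⟨h.1, h.2.1, locEuclidean_iff.1 h.2.2⟩⟩

theorem IsTopManifoldWithBoundary.of_homeomorph {X Y : Type} [TopologicalSpace X]
    [TopologicalSpace Y] {n : ℕ} (h : IsTopManifoldWithBoundary X n) (φ : X ≃ₜ Y) :
    IsTopManifoldWithBoundary Y n where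
  t2 := have := h.t2; φ.symm.isEmbedding.t2Space
  connected := have := h.connected; φ.surjective.connectedSpace φ.continuous
  chart y := by
    obtain ⟨U, hU, hc⟩ := h.chart (φ.symm y)
    refine ⟨φ '' U, ?_, ?_⟩
    · rw [← φ.apply_symm_apply y]
      exact φ.isOpenMap.image_mem_nhds hU
    · rcases hc with ⟨⟨ψ⟩⟩ | ⟨k, hk, ⟨ψ⟩⟩
      · exact Or.inl ⟨(φ.image U).symm.trans ψ⟩
      · exact Or.inr ⟨k, hk, ⟨(φ.image U).symm.trans ψ⟩⟩

/-- Half-space charts suffice at all points: one covers everything below the upper end of the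
interval, and its reflection covers the upper end. -/
theorem isTopManifoldWithBoundary_prod_Icc {P : Type} [TopologicalSpace P] [T2Space P]
    [ConnectedSpace P] {n : ℕ} (hP : LocEuclidean n P) {a b : ℝ} (hab : a < b) :
    IsTopManifoldWithBoundary (P × Icc a b) (n + 1) := by
  have : ConnectedSpace (Icc a b) :=
    isConnected_iff_connectedSpace.1 (isConnected_Icc hab.le)
  refine ⟨inferInstance, inferInstance, ?_⟩
  rintro ⟨x, t⟩
  have key : ∀ φ : Ici (0 : ℝ) → Icc a b, IsOpenEmbedding φ → t ∈ range φ →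
      ∃ U ∈ 𝓝 (x, t), Nonempty (↥U ≃ₜ EuclideanSpace ℝ (Fin n) × ↥(Ici (0 : ℝ))) := by
    intro φ hφ ht
    obtain ⟨e, he, hx⟩ := hP x
    have h := he.prodMap hφ
    refine ⟨range (Prod.map e φ), h.isOpen_range.mem_nhds ?_,
      ⟨h.toIsEmbedding.toHomeomorph.symm⟩⟩
    rw [range_prodMap]
    exact ⟨hx, ht⟩
  obtain ⟨φ, hφ, hr⟩ := exists_isOpenEmbedding_Ici hab
  by_cases htb : t.1 < b
  · obtain ⟨U, hU, h⟩ := key φ hφ (hr ▸ htb)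
    exact ⟨U, hU, Or.inr ⟨n, rfl, h⟩⟩
  · let ρ : Icc a b ≃ₜ Icc a b :=
      { toFun := fun s => ⟨a + b - s.1, by have := s.2.1; have := s.2.2; constructor <;> linarith⟩
        invFun := fun s => ⟨a + b - s.1, by have := s.2.1; have := s.2.2; constructor <;> linarith⟩
        left_inv := fun s => Subtype.ext (by simp)
        right_inv := fun s => Subtype.ext (by simp)
        continuous_toFun := by fun_prop
        continuous_invFun := by fun_prop }
    obtain ⟨U, hU, h⟩ := key (ρ ∘ φ) (ρ.isOpenEmbedding.comp hφ) (by
      have : ρ.symm t ∈ range φ := by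
        rw [hr]
        show a + b - t.1 < b
        linarith
      obtain ⟨s, hs⟩ := this
      exact ⟨s, by rw [Function.comp_apply, hs, ρ.apply_symm_apply]⟩)
    exact ⟨U, hU, Or.inr ⟨n, rfl, h⟩⟩

theorem OmegaBounded.of_homeomorph {X Y : Type} [TopologicalSpace X] [TopologicalSpace Y]
    (h : OmegaBounded X) (φ : X ≃ₜ Y) : OmegaBounded Y := fun S hS => by
  have := (h _ (hS.image φ.symm)).image φ.continuous
  rwa [φ.image_closure, ← image_comp, φ.self_comp_symm, image_id] at this

theorem OmegaBounded.prod_compact {X K : Type} [TopologicalSpace X] [TopologicalSpace K]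
    [CompactSpace K] (h : OmegaBounded X) : OmegaBounded (X × K) := fun S hS => by
  refine ((h _ (hS.image Prod.fst)).prod isCompact_univ).of_isClosed_subset isClosed_closure ?_
  rw [← isClosed_univ.closure_eq (X := K), ← closure_prod_eq]
  exact closure_mono fun x hx => ⟨⟨x, hx, rfl⟩, trivial⟩

theorem OmegaBounded.of_compact (X : Type) [TopologicalSpace X] [CompactSpace X] :
    OmegaBounded X := fun _ _ => isClosed_closure.isCompact

/-- A countable union of `ω`-bounded subspaces is `ω₁`-compact. -/
theorem omega1Compact_of_iUnion {X : Type} [TopologicalSpace X] [T2Space X] {K : ℕ → Set X}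
    (hK : ∀ i, OmegaBounded ↥(K i)) : Omega1Compact ↥(⋃ i, K i) := by
  intro D hD hD'
  -- A countably infinite part of `D` in `K i` would have compact closure there, and a compact set
  -- meets a closed discrete set in a finite set.
  have hfin : ∀ i, (D ∩ Subtype.val ⁻¹' K i).Finite := by
    intro i
    by_contra hinf
    obtain ⟨S, hS, hSinf, hSc⟩ : ∃ S ⊆ D ∩ Subtype.val ⁻¹' K i, S.Infinite ∧ S.Countable := by
      let f := (Set.not_finite.1 hinf).natEmbedding
      refine ⟨range fun n => (f n).1, ?_, ?_, countable_range _⟩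
      · rintro _ ⟨n, rfl⟩
        exact Subtype.coe_prop _
      · exact infinite_range_of_injective
          (Subtype.val_injective.comp f.injective)
    let ψ : ↥(K i) → ↥(⋃ i, K i) := fun x => ⟨x.1, mem_iUnion.2 ⟨i, x.2⟩⟩
    have hψ : Continuous ψ := by fun_prop
    have hC := (hK i (ψ ⁻¹' S) (hSc.preimage_of_injOn fun x _ y _ h => by
      exact Subtype.ext (congrArg (fun z => z.1) h))).image hψ
    have hCS : S ⊆ ψ '' closure (ψ ⁻¹' S) := fun x hx =>
      ⟨⟨x.1, (hS hx).2⟩, subset_closure hx, rfl⟩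
    have hfin : (ψ '' closure (ψ ⁻¹' S) ∩ D).Finite := by
      refine (hC.inter_right hD).finite ?_
      exact (isDiscrete_iff_discreteTopology.2 hD').mono inter_subset_right
    exact hSinf (hfin.subset fun x hx => ⟨hCS hx, (hS hx).1⟩)
  refine (countable_iUnion fun i => (hfin i).countable).mono fun x hx => ?_
  obtain ⟨i, hi⟩ := mem_iUnion.1 x.2
  exact mem_iUnion.2 ⟨i, hx, hi⟩

end

/-! ### The gated product of a surface with the line -/

noncomputable section

/-- The product with the line, with walls erected at the integers; the walls have a gate. -/
def Gated {N : Type} (O : Set N) : Set (N × ℝ) := {p | p.1 ∈ O ∨ ∀ i : ℤ, p.2 ≠ i}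

section Gated

variable {N : Type} {O : Set N}

theorem not_int_of_mem_Ioo {t : ℝ} {i : ℤ} (h : t ∈ Ioo (i : ℝ) (i + 1)) (k : ℤ) : t ≠ k := by
  rintro rfl
  have h1 : i < k := by exact_mod_cast h.1
  have h2 : k < i + 1 := by exact_mod_cast h.2
  omega

theorem mem_gated_of_mem_Ioo {p : N × ℝ} {i : ℤ} (h : p.2 ∈ Ioo (i : ℝ) (i + 1)) : p ∈ Gated O :=
  Or.inr (not_int_of_mem_Ioo h)

theorem exists_mem_Ioo {t : ℝ} (h : ∀ i : ℤ, t ≠ i) : ∃ i : ℤ, t ∈ Ioo (i : ℝ) (i + 1) :=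
  ⟨⌊t⌋, lt_of_le_of_ne (Int.floor_le t) (h _).symm, Int.lt_floor_add_one t⟩

variable [TopologicalSpace N]

theorem isOpen_gated (hO : IsOpen O) : IsOpen (Gated O) := by
  have : Gated O = Prod.fst ⁻¹' O ∪ Prod.snd ⁻¹' (range ((↑) : ℤ → ℝ))ᶜ := by
    ext p
    refine or_congr Iff.rfl ?_
    simp [eq_comm]
  rw [this]
  exact (hO.preimage continuous_fst).union
    (Int.isClosedEmbedding_coe_real.isClosed_range.isOpen_compl.preimage continuous_snd)

theorem dense_not_int : Dense {t : ℝ | ∀ i : ℤ, t ≠ i} := by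
  have : {t : ℝ | ∀ i : ℤ, t ≠ i} = (range ((↑) : ℤ → ℝ))ᶜ := by
    ext t
    simp [eq_comm]
  rw [this]
  exact (countable_range _).dense_compl ℝ

theorem dense_gated : Dense (Gated O) := by
  refine Dense.mono ?_ (dense_univ.prod dense_not_int : Dense ((univ : Set N) ×ˢ _))
  exact fun p hp => Or.inr hp.2

/-- A vertical line through the gates meets every open slab and every horizontal copy of `O`. -/
theorem isConnected_gated [ConnectedSpace N] (hO : IsConnected O) : IsConnected (Gated O) := by
  obtain ⟨y, hy⟩ := hO.nonempty
  have hline : IsPreconnected ({y} ×ˢ univ : Set (N × ℝ)) :=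
    isPreconnected_singleton.prod isPreconnected_univ
  have hsub : ({y} ×ˢ univ : Set (N × ℝ)) ⊆ Gated O := fun p hp =>
    Or.inl ((show p.1 = y from hp.1) ▸ hy)
  refine ⟨⟨(y, 0), Or.inl hy⟩, isPreconnected_of_forall (y, 0) fun p hp => ?_⟩
  have key : ∀ A : Set (N × ℝ), A ⊆ Gated O → p ∈ A → IsPreconnected A → (y, p.2) ∈ A →
      ∃ t ⊆ Gated O, (y, (0 : ℝ)) ∈ t ∧ p ∈ t ∧ IsPreconnected t := fun A hA hpA hAc hyA =>
    ⟨_, union_subset hsub hA, Or.inl ⟨rfl, trivial⟩, Or.inr hpA,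
      hline.union (y, p.2) ⟨rfl, trivial⟩ hyA hAc⟩
  by_cases hpO : p.1 ∈ O
  · exact key (O ×ˢ {p.2}) (fun q hq => Or.inl hq.1) ⟨hpO, rfl⟩
      (hO.isPreconnected.prod isPreconnected_singleton) ⟨hy, rfl⟩
  · obtain ⟨i, hi⟩ := exists_mem_Ioo (hp.resolve_left hpO)
    exact key (univ ×ˢ Ioo (i : ℝ) (i + 1)) (fun q hq => mem_gated_of_mem_Ioo hq.2)
      ⟨trivial, hi⟩ (isPreconnected_univ.prod isPreconnected_Ioo) ⟨trivial, hi⟩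

end Gated

theorem exists_isOpenEmbedding_circle_prod_complex :
    ∃ φ : Circle × ℝ → ℂ, IsOpenEmbedding φ := by
  have hn : ∀ w : ({0}ᶜ : Set ℂ), ‖w.1‖ ≠ 0 := fun w => norm_ne_zero_iff.2 w.2
  have hc : ∀ w : ({0}ᶜ : Set ℂ), w.1 / ‖w.1‖ ∈ Submonoid.unitSphere ℂ := fun w => by
    simp [Submonoid.unitSphere, hn w]
  let φ : Circle × ℝ ≃ₜ ({0}ᶜ : Set ℂ) :=
    { toFun := fun p => ⟨Real.exp p.2 * p.1, by simp⟩
      invFun := fun w => ((⟨w.1 / ‖w.1‖, hc w⟩ : Circle), Real.log ‖w.1‖)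
      left_inv := fun p => by
        have : ‖(Real.exp p.2 * p.1 : ℂ)‖ = Real.exp p.2 := by
          rw [norm_mul, Circle.norm_coe, mul_one, Complex.norm_real, Real.norm_eq_abs,
            Real.abs_exp]
        refine Prod.ext (Circle.ext ?_) ?_
        · show (Real.exp p.2 * p.1 : ℂ) / ‖(Real.exp p.2 * p.1 : ℂ)‖ = p.1
          rw [this, mul_div_cancel_left₀]
          exact Complex.ofReal_ne_zero.2 (Real.exp_ne_zero _)
        · show Real.log ‖(Real.exp p.2 * p.1 : ℂ)‖ = p.2
          rw [this, Real.log_exp]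
      right_inv := fun w => by
        refine Subtype.ext ?_
        show (Real.exp (Real.log ‖w.1‖) * (w.1 / ‖w.1‖) : ℂ) = w.1
        rw [Real.exp_log (norm_pos_iff.2 w.2), mul_div_cancel₀]
        exact Complex.ofReal_ne_zero.2 (hn w)
      continuous_toFun := by fun_prop
      continuous_invFun := by
        refine Continuous.prodMk (Continuous.subtype_mk ?_ _) ?_
        · exact continuous_subtype_val.div (by fun_prop)
            fun w => Complex.ofReal_ne_zero.2 (hn w)
        · exact (continuous_subtype_val.norm).log hn }
  exact ⟨_, (isOpen_compl_singleton.isOpenEmbedding_subtypeVal).comp φ.isOpenEmbedding⟩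

/-- The gate is an annulus because it is then exhausted by the compact pieces `Circle × [-n, n]`,
which are manifolds with boundary of the same form as the slabs. -/
theorem LocEuclidean.exists_annulus {N : Type*} [TopologicalSpace N] [Nonempty N]
    (h : LocEuclidean 2 N) : ∃ κ : Circle × ℝ → N, IsOpenEmbedding κ := by
  obtain ⟨e, he, -⟩ := h (Classical.arbitrary N)
  obtain ⟨φ, hφ⟩ := exists_isOpenEmbedding_circle_prod_complex
  let l : ℂ ≃L[ℝ] EuclideanSpace ℝ (Fin 2) := ContinuousLinearEquiv.ofFinrankEq (by simp)
  exact ⟨e ∘ l ∘ φ, he.comp (l.toHomeomorph.isOpenEmbedding.comp hφ)⟩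

theorem isLindelof_of_subset_range {X Z : Type*} [TopologicalSpace X] [TopologicalSpace Z]
    [SecondCountableTopology Z] {f : Z → X} (hf : Continuous f) {S : Set X} (hS : S ⊆ range f) :
    IsLindelof S := by
  rw [← image_preimage_eq_of_subset hS]
  exact (HereditarilyLindelofSpace.isLindelof _).image hf

theorem LocallyMetrizable.firstCountable {X : Type} [TopologicalSpace X]
    (h : LocallyMetrizable X) : FirstCountableTopology X := by
  refine ⟨fun x => ?_⟩
  obtain ⟨U, hU, _⟩ := h x
  rw [← map_nhds_subtype_coe_eq_nhds (mem_of_mem_nhds hU) hU]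
  infer_instance

/-- In a first countable space closedness is tested by sequences, and a sequence in `K` stays in a
compact subset of `K`. -/
theorem OmegaBounded.isClosed {X : Type} [TopologicalSpace X] [T2Space X]
    [FirstCountableTopology X] {K : Set X} (hK : OmegaBounded ↥K) : IsClosed K := by
  refine IsSeqClosed.isClosed fun u x hu hx => ?_
  have hc := (hK (range fun n => ⟨u n, hu n⟩) (countable_range _)).image continuous_subtype_val
  have := hc.isClosed.mem_of_tendsto hx (Filter.Eventually.of_forall fun n =>
    ⟨⟨u n, hu n⟩, subset_closure (mem_range_self n), rfl⟩)
  obtain ⟨y, -, rfl⟩ := this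
  exact y.2


/-! ### Slabs, gates, and inheriting the absence of directions -/

section Slabs

variable {N X : Type}

/-- A closed interval inside a slab. -/
abbrev SlabInterval (q : ℤ × ℕ) : Set ℝ :=
  Icc (q.1 + 1 / (q.2 + 3 : ℝ)) (q.1 + 1 - 1 / (q.2 + 3 : ℝ))

theorem slabInterval_lt (q : ℤ × ℕ) :
    (q.1 + 1 / (q.2 + 3 : ℝ)) < (q.1 + 1 - 1 / (q.2 + 3 : ℝ)) := by
  have : 1 / (q.2 + 3 : ℝ) ≤ 1 / 3 :=
    one_div_le_one_div_of_le (by norm_num) (by linarith [Nat.cast_nonneg (α := ℝ) q.2])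
  linarith

theorem slabInterval_subset (q : ℤ × ℕ) : SlabInterval q ⊆ Ioo (q.1 : ℝ) (q.1 + 1) := by
  have : 0 < 1 / (q.2 + 3 : ℝ) := by positivity
  exact fun t ht => ⟨by linarith [ht.1], by linarith [ht.2]⟩

theorem exists_mem_slabInterval {t : ℝ} {i : ℤ} (h : t ∈ Ioo (i : ℝ) (i + 1)) :
    ∃ n : ℕ, t ∈ SlabInterval (i, n) := by
  obtain ⟨n, hn⟩ := exists_nat_one_div_lt (lt_min (sub_pos.2 h.1) (sub_pos.2 h.2))
  have h1 : 1 / (n + 3 : ℝ) ≤ 1 / (n + 1 : ℝ) :=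
    one_div_le_one_div_of_le (by positivity) (by linarith)
  have h2 := hn.trans_le (min_le_left _ _)
  have h3 := hn.trans_le (min_le_right _ _)
  exact ⟨n, by constructor <;> dsimp only <;> linarith⟩

variable {κ : Circle × ℝ → N} {j : ↥(Gated (range κ)) → X}

/-- The part of a slab over a closed interval. -/
def slabMap (j : ↥(Gated (range κ)) → X) (q : ℤ × ℕ) (p : N × SlabInterval q) : X :=
  j ⟨(p.1, p.2.1), mem_gated_of_mem_Ioo (slabInterval_subset q p.2.2)⟩

/-- A part of the gate in a wall. -/
def gateMap (j : ↥(Gated (range κ)) → X) (q : ℤ × ℕ)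
    (p : Circle × Icc (-(q.2 + 1 : ℝ)) (q.2 + 1)) : X :=
  j ⟨(κ (p.1, p.2.1), q.1), Or.inl (mem_range_self _)⟩

theorem range_eq_slabs_union_gates :
    range j = ⋃ q : ℤ × ℕ, range (slabMap j q) ∪ range (gateMap j q) := by
  refine subset_antisymm ?_ (iUnion_subset fun q => union_subset ?_ ?_)
  · rintro _ ⟨⟨⟨y, t⟩, hp⟩, rfl⟩
    by_cases ht : ∀ i : ℤ, t ≠ i
    · obtain ⟨i, hi⟩ := exists_mem_Ioo ht
      obtain ⟨n, hn⟩ := exists_mem_slabInterval hi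
      exact mem_iUnion.2 ⟨(i, n), Or.inl ⟨(y, ⟨t, hn⟩), rfl⟩⟩
    · obtain ⟨⟨z, r⟩, rfl⟩ : y ∈ range κ := hp.resolve_right ht
      push Not at ht
      obtain ⟨i, rfl⟩ := ht
      obtain ⟨n, hn⟩ := exists_nat_gt |r|
      have := abs_lt.1 hn
      refine mem_iUnion.2 ⟨(i, n), Or.inr ⟨(z, ⟨r, ?_⟩), rfl⟩⟩
      constructor <;> dsimp only <;> linarith
  · rintro _ ⟨p, rfl⟩
    exact mem_range_self _
  · rintro _ ⟨p, rfl⟩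
    exact mem_range_self _

variable [TopologicalSpace N] [TopologicalSpace X]

theorem isEmbedding_slabMap (hj : IsEmbedding j) (q : ℤ × ℕ) : IsEmbedding (slabMap j q) := by
  refine hj.comp (IsEmbedding.of_comp (g := Subtype.val) (by fun_prop) continuous_subtype_val ?_)
  exact IsEmbedding.id.prodMap IsEmbedding.subtypeVal

theorem isEmbedding_gateMap (hκ : IsEmbedding κ) (hj : IsEmbedding j) (q : ℤ × ℕ) :
    IsEmbedding (gateMap j q) := by
  have h : IsEmbedding fun p : Circle × Icc (-(q.2 + 1 : ℝ)) (q.2 + 1) => κ (p.1, p.2.1) :=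
    hκ.comp (IsEmbedding.id.prodMap IsEmbedding.subtypeVal)
  have h' : IsEmbedding fun p : Circle × Icc (-(q.2 + 1 : ℝ)) (q.2 + 1) =>
      (κ (p.1, p.2.1), (q.1 : ℝ)) :=
    IsEmbedding.of_comp (g := Prod.fst) (by have := h.continuous; fun_prop) continuous_fst h
  refine hj.comp (IsEmbedding.of_comp (g := Subtype.val) ?_ continuous_subtype_val h')
  exact h'.continuous.subtype_mk _

theorem omegaBounded_range {Y : Type} [TopologicalSpace Y] {f : Y → X} (hf : IsEmbedding f)
    (hY : OmegaBounded Y) : OmegaBounded ↥(range f) :=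
  hY.of_homeomorph hf.toHomeomorph

theorem exists_pieces [T2Space N] [ConnectedSpace N] (hN : LocEuclidean 2 N)
    (hN' : OmegaBounded N) (hκ : IsEmbedding κ) (hj : IsEmbedding j) :
    ∃ K : ℕ → Set X, range j = ⋃ i, K i ∧
      ∀ i, OmegaBounded ↥(K i) ∧ ∃ m, IsTopManifoldWithBoundary ↥(K i) m := by
  have hs : ∀ q, IsEmbedding (slabMap j q) := isEmbedding_slabMap hj
  have hg : ∀ q, IsEmbedding (gateMap j q) := isEmbedding_gateMap hκ hj
  obtain ⟨e, he⟩ := exists_surjective_nat (Bool × ℤ × ℕ)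
  let K : Bool × ℤ × ℕ → Set X := fun q => match q with
    | (true, q) => range (slabMap j q)
    | (false, q) => range (gateMap j q)
  have hK : ∀ q, OmegaBounded ↥(K q) ∧ ∃ m, IsTopManifoldWithBoundary ↥(K q) m := by
    rintro ⟨_ | _, q⟩
    · have : (-(q.2 + 1 : ℝ)) < q.2 + 1 := by linarith [Nat.cast_nonneg (α := ℝ) q.2]
      exact ⟨omegaBounded_range (hg q) (OmegaBounded.of_compact _), _,
        (isTopManifoldWithBoundary_prod_Icc locEuclidean_circle this).of_homeomorph
          (hg q).toHomeomorph⟩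
    · exact ⟨omegaBounded_range (hs q) hN'.prod_compact, _,
        (isTopManifoldWithBoundary_prod_Icc hN (slabInterval_lt q)).of_homeomorph
          (hs q).toHomeomorph⟩
  refine ⟨fun i => K (e i), ?_, fun i => hK (e i)⟩
  rw [range_eq_slabs_union_gates, he.iUnion_comp K]
  refine subset_antisymm (iUnion_subset fun q => union_subset ?_ ?_) (iUnion_subset ?_)
  · exact subset_iUnion_of_subset (true, q) subset_rfl
  · exact subset_iUnion_of_subset (false, q) subset_rfl
  · rintro ⟨_ | _, q⟩
    · exact subset_iUnion_of_subset q subset_union_right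
    · exact subset_iUnion_of_subset q subset_union_left

theorem isManifoldUnionOmegaBounded_gated [T2Space N] [ConnectedSpace N] (hN : LocEuclidean 2 N)
    (hN' : OmegaBounded N) (hκ : IsOpenEmbedding κ) (hj : IsEmbedding j) [T2Space X] :
    IsManifoldUnionOmegaBounded (range j) ∧ Omega1Compact ↥(range j) := by
  obtain ⟨K, hK, hK'⟩ := exists_pieces hN hN' hκ.toIsEmbedding hj
  refine ⟨⟨⟨3, isTopManifold_iff.2 ⟨inferInstance, ?_, ?_⟩⟩, K, hK, hK'⟩, ?_⟩
  · have := isConnected_iff_connectedSpace.1 (isConnected_gated (isConnected_range hκ.continuous))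
    exact isConnected_iff_connectedSpace.1 (isConnected_range hj.continuous)
  · exact ((hN.prod locEuclidean_real).of_isOpenEmbedding
      (isOpen_gated hκ.isOpen_range).isOpenEmbedding_subtypeVal).of_isOpenEmbedding
        hj.toHomeomorph.symm.isOpenEmbedding
  · rw [hK]
    exact omega1Compact_of_iUnion fun i => (hK' i).1

/-- If functions on slabs can be extended, the absence of directions in `N` is inherited. -/
theorem exists_isClubDiscrete_of_slabs [T2Space N] (hN : LocEuclidean 2 N) (hN' : OmegaBounded N)
    {F' : TypeI N} (hF' : ∀ D, ¬ F'.IsDirection D) (hκ : IsOpenEmbedding κ) (hj : IsEmbedding j)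
    [T2Space X] [FirstCountableTopology X] {F : TypeI X}
    (hout : ∀ E, IsClosed E → F.Unbounded (E \ range j) → ∃ E' ⊆ E, F.IsClubDiscrete E')
    (hext : ∀ (i : ℤ) (g : N → LongRay), Continuous g → ∃ f : X → LongRay, Continuous f ∧
      ∀ A : Set ↥(Gated (range κ)), (∀ p ∈ A, p.1.2 ∈ Ioo (i : ℝ) (i + 1)) →
        (BddAbove (f '' (j '' A)) ↔ BddAbove (g '' ((fun p => p.1.1) '' A))))
    {D : Set X} (hD : F.IsDirection D) : ∃ E ⊆ D, F.IsClubDiscrete E := by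
  by_contra hcon
  have hDj : ¬ F.Unbounded (D \ range j) := fun h => hcon (hout D hD.1.1 h)
  -- Countably many pieces cover the range of `j`, and the gates are Lindelöf, hence bounded. So `D`
  -- is unbounded in one closed slab.
  obtain ⟨q, hq⟩ : ∃ q, F.Unbounded (D ∩ range (slabMap j q)) := by
    have hcov : D ⊆ ⋃ o : Option (Bool × ℤ × ℕ), match o with
        | none => (range j)ᶜ
        | some (true, q) => range (slabMap j q)
        | some (false, q) => range (gateMap j q) := by
      intro x _
      by_cases hx : x ∈ range j
      · rw [range_eq_slabs_union_gates] at hx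
        obtain ⟨q, hq | hq⟩ := mem_iUnion.1 hx
        · exact mem_iUnion.2 ⟨some (true, q), hq⟩
        · exact mem_iUnion.2 ⟨some (false, q), hq⟩
      · exact mem_iUnion.2 ⟨none, hx⟩
    obtain ⟨o, ho⟩ := hD.1.2.exists_of_countable_cover hcov
    rcases o with _ | ⟨_ | _, q⟩
    · exact absurd ho hDj
    · exfalso
      have hL : IsLindelof (D ∩ range (gateMap j q)) :=
        isLindelof_of_subset_range (isEmbedding_gateMap hκ.toIsEmbedding hj q).continuous
          inter_subset_right
      obtain ⟨a, ha⟩ := F.exists_subset_stage_of_isLindelof hL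
      exact F.not_unbounded_iff.2 ⟨a, ha⟩ ho
    · exact ⟨q, ho⟩
  have hs := isEmbedding_slabMap hj q
  have hsc : IsClosedEmbedding (slabMap j q) :=
    ⟨hs, (omegaBounded_range hs hN'.prod_compact).isClosed⟩
  have hE : IsClosed (slabMap j q ⁻¹' D) := hD.1.1.preimage hs.continuous
  -- The projection is closed because the fibre is a compact interval. It is unbounded, for
  -- otherwise this part of `D` would be Lindelöf.
  have hC₀ : F'.IsClub (Prod.fst '' (slabMap j q ⁻¹' D)) := by
    refine ⟨isClosedMap_fst_of_compactSpace _ hE, ?_⟩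
    by_contra hb
    obtain ⟨a, ha⟩ := F'.not_unbounded_iff.1 hb
    obtain ⟨Ω, -, hΩ, _⟩ := hN.exists_isOpen_secondCountable (F'.isLindelof_closure_stage a)
    have hL : IsLindelof (D ∩ range (slabMap j q)) := by
      refine isLindelof_of_subset_range (Z := Ω × SlabInterval q)
        (f := slabMap j q ∘ Prod.map Subtype.val id) (hs.continuous.comp (by fun_prop)) ?_
      rintro _ ⟨hx, ⟨p, rfl⟩⟩
      exact ⟨(⟨p.1, hΩ (subset_closure (ha ⟨p, hx, rfl⟩))⟩, p.2), rfl⟩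
    obtain ⟨a, ha⟩ := F.exists_subset_stage_of_isLindelof hL
    exact F.not_unbounded_iff.2 ⟨a, ha⟩ hq
  have hnd := hF' (Prod.fst '' (slabMap j q ⁻¹' D))
  simp only [TypeI.IsDirection, not_and, not_forall] at hnd
  obtain ⟨C, hCC, hC, hnot⟩ := hnd hC₀
  have hg : ¬ UfoLE (Prod.fst '' (slabMap j q ⁻¹' D)) C := fun h =>
    hnot h fun f _ hb hb' => hb (hb'.mono (image_mono hCC))
  simp only [UfoLE, not_forall, not_not] at hg
  obtain ⟨g, hgc, hgD, hgC⟩ := hg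
  obtain ⟨f, hf, hfg⟩ := hext q.1 g hgc
  have hbdd : ∀ B : Set (N × SlabInterval q),
      BddAbove (f '' (slabMap j q '' B)) ↔ BddAbove (g '' (Prod.fst '' B)) := by
    intro B
    have := hfg ((fun p : N × SlabInterval q => ⟨(p.1, p.2.1),
      mem_gated_of_mem_Ioo (slabInterval_subset q p.2.2)⟩) '' B) (by
        rintro _ ⟨p, -, rfl⟩
        exact slabInterval_subset q p.2.2)
    rwa [← image_comp j, ← image_comp (fun p : ↥(Gated (range κ)) => p.1.1)] at this
  -- The part of `D` over `C` in the slab is a club on which the extended map is bounded, though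
  -- that map is unbounded on `D`.
  have hE' : F.IsClub (slabMap j q '' (slabMap j q ⁻¹' D ∩ Prod.fst ⁻¹' C)) := by
    have hcl := hsc.isClosedMap _ (hE.inter (hC.1.preimage continuous_fst))
    refine ⟨hcl, ?_⟩
    by_contra hb
    obtain ⟨a, ha⟩ := F.not_unbounded_iff.1 hb
    have hL : IsLindelof (slabMap j q '' (slabMap j q ⁻¹' D ∩ Prod.fst ⁻¹' C)) :=
      (F.isLindelof_closure_stage a).of_isClosed_subset hcl (ha.trans subset_closure)
    have hL' := (hs.isInducing.isLindelof_iff.2 hL).image continuous_fst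
    rw [image_inter_preimage, inter_eq_right.2 hCC] at hL'
    obtain ⟨b, hb⟩ := F'.exists_subset_stage_of_isLindelof hL'
    exact F'.not_unbounded_iff.2 ⟨b, hb⟩ hC.2
  refine (hD.2 _ (by rintro _ ⟨p, hp, rfl⟩; exact hp.1) hE').1 f hf (fun hb => hgD ?_) ?_
  · refine (hbdd _).1 (hb.mono (image_mono ?_))
    rintro _ ⟨p, hp, rfl⟩
    exact hp
  · refine (hbdd _).2 (hgC.mono (image_mono ?_))
    rintro _ ⟨p, hp, rfl⟩
    exact hp.2

end Slabs

end

/-! ### Layers of a surface and points at the ends of layers -/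

noncomputable section

open Om1

/-- Regular second countable spaces with one point added. -/
theorem metrizable_separable_of_punctured {Y Z : Type*} [TopologicalSpace Y] [T2Space Y]
    [TopologicalSpace Z] [SecondCountableTopology Z] [RegularSpace Z] (d : Y) (B : ℕ → Set Y)
    (hB : ∀ k, IsClopen (B k)) (hbasis : ∀ U ∈ 𝓝 d, ∃ k, B k ⊆ U) (hmem : ∀ k, d ∈ B k)
    {e : Z → Y} (he : IsOpenEmbedding e) (hr : ∀ y, y ≠ d → y ∈ range e) :
    TopologicalSpace.MetrizableSpace Y ∧ TopologicalSpace.SeparableSpace Y := by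
  have hsc : SecondCountableTopology Y := by
    have hbas : TopologicalSpace.IsTopologicalBasis
        ((fun u => e '' u) '' TopologicalSpace.countableBasis Z ∪ range B) := by
      refine TopologicalSpace.isTopologicalBasis_of_isOpen_of_nhds ?_ fun y U hy hU => ?_
      · rintro _ (⟨u, hu, rfl⟩ | ⟨k, rfl⟩)
        · exact he.isOpenMap _ (TopologicalSpace.isOpen_of_mem_countableBasis hu)
        · exact (hB k).isOpen
      · by_cases hyd : y = d
        · subst hyd
          obtain ⟨k, hk⟩ := hbasis U (hU.mem_nhds hy)
          exact ⟨B k, Or.inr ⟨k, rfl⟩, hmem k, hk⟩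
        · obtain ⟨z, rfl⟩ := hr y hyd
          obtain ⟨u, hu, hzu, huU⟩ := (TopologicalSpace.isBasis_countableBasis Z).exists_subset_of_mem_open
            (show z ∈ e ⁻¹' U from hy) (hU.preimage he.continuous)
          exact ⟨e '' u, Or.inl ⟨u, hu, rfl⟩, ⟨z, hzu, rfl⟩, image_subset_iff.2 huU⟩
    exact hbas.secondCountableTopology
      (((TopologicalSpace.countable_countableBasis Z).image _).union (countable_range _))
  have hreg : RegularSpace Y := RegularSpace.of_exists_mem_nhds_isClosed_subset fun y U hU => by
    by_cases hyd : y = d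
    · subst hyd
      obtain ⟨k, hk⟩ := hbasis U hU
      exact ⟨B k, (hB k).isOpen.mem_nhds (hmem k), (hB k).isClosed, hk⟩
    · obtain ⟨z, rfl⟩ := hr y hyd
      obtain ⟨k, hk⟩ := hbasis {e z}ᶜ (isOpen_compl_singleton.mem_nhds (Ne.symm hyd))
      have hz : e ⁻¹' (U ∩ (B k)ᶜ) ∈ 𝓝 z := he.continuous.continuousAt.preimage_mem_nhds
        (Filter.inter_mem hU ((hB k).compl.isOpen.mem_nhds fun h => hk h rfl))
      obtain ⟨t, ht, htc, hts⟩ := exists_mem_nhds_isClosed_subset hz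
      refine ⟨e '' t, he.isOpenMap.image_mem_nhds ht, ⟨?_⟩,
        image_subset_iff.2 fun w hw => (hts hw).1⟩
      have : (e '' t)ᶜ = e '' tᶜ ∪ B k := by
        ext w
        constructor
        · intro hw
          by_cases hwd : w = d
          · exact Or.inr (hwd ▸ hmem k)
          · obtain ⟨v, rfl⟩ := hr w hwd
            exact Or.inl ⟨v, fun hv => hw ⟨v, hv, rfl⟩, rfl⟩
        · rintro (⟨v, hv, rfl⟩ | hw) ⟨v', hv', h⟩
          · exact hv (he.injective h ▸ hv')
          · exact (hts hv').2 (h ▸ hw)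
      rw [this]
      exact (he.isOpenMap _ htc.isOpen_compl).union (hB k).isOpen
  have : T3Space Y := {}
  exact ⟨TopologicalSpace.metrizableSpace_of_t3_secondCountable Y, inferInstance⟩

theorem LocEuclidean.weaklyLocallyCompactSpace {n : ℕ} {X : Type*} [TopologicalSpace X]
    (h : LocEuclidean n X) : WeaklyLocallyCompactSpace X := ⟨fun x => by
  obtain ⟨e, he, p, rfl⟩ := h x
  exact ⟨e '' Metric.closedBall p 1, (isCompact_closedBall p 1).image he.continuous,
    he.isOpenMap.image_mem_nhds (Metric.closedBall_mem_nhds p one_pos)⟩⟩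

theorem Om1.exists_succ (a : Om1) : ∃ b, a < b ∧ ∀ c, a < c → b ≤ c := by
  obtain ⟨b, hb, hmin⟩ := WellFounded.has_min (wellFounded_lt (α := Om1)) (Ioi a) (exists_gt a)
  exact ⟨b, hb, fun c hc => not_lt.1 (hmin c hc)⟩

/-- The successor of a countable ordinal. -/
def Om1.next (a : Om1) : Om1 := (Om1.exists_succ a).choose

theorem Om1.lt_next (a : Om1) : a < a.next := (Om1.exists_succ a).choose_spec.1

theorem Om1.next_le {a b : Om1} (h : a < b) : a.next ≤ b := (Om1.exists_succ a).choose_spec.2 b h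

namespace TypeI

variable {N : Type} [TopologicalSpace N] (F : TypeI N)

/-- The part of a Type I space between two consecutive stages. -/
def layer (a : Om1) : Set N := F.stage a.next \ closure (F.stage a)

theorem isOpen_layer (a : Om1) : IsOpen (F.layer a) := (F.isOpen_stage _).sdiff isClosed_closure

theorem disjoint_layer_of_lt {a b : Om1} (h : a < b) : Disjoint (F.layer a) (F.layer b) :=
  disjoint_left.2 fun _ hx hx' => hx'.2 (subset_closure (F.stage_mono (Om1.next_le h) hx.1))

theorem disjoint_layer {a b : Om1} (h : a ≠ b) : Disjoint (F.layer a) (F.layer b) := by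
  rcases h.lt_or_gt with h | h
  · exact F.disjoint_layer_of_lt h
  · exact (F.disjoint_layer_of_lt h).symm

theorem stage_ne_univ (a : Om1) : F.stage a ≠ univ := fun h =>
  F.not_unbounded_iff.2 ⟨a, h.ge⟩ F.unbounded_univ

theorem layer_nonempty [ConnectedSpace N] {a : Om1} (h : (F.stage a).Nonempty) :
    (F.layer a).Nonempty := by
  by_contra hcon
  have hsub : F.stage a.next ⊆ closure (F.stage a) :=
    sdiff_eq_empty.1 (not_nonempty_iff_eq_empty.1 hcon)
  have heq := subset_antisymm hsub (F.closure_stage_subset a.lt_next)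
  have hcl : IsClopen (F.stage a.next) := ⟨heq ▸ isClosed_closure, F.isOpen_stage _⟩
  rcases isClopen_iff.1 hcl with h' | h'
  · exact (h.mono (F.stage_mono a.lt_next.le)).ne_empty h'
  · exact F.stage_ne_univ _ h'

/-- At limit stages there is a point which is a limit of any cofinal family of layers. -/
theorem exists_limit_of_layers [ConnectedSpace N] {n : ℕ} (hN : LocEuclidean n N) {a₀ l : Om1}
    (h₀ : (F.stage a₀).Nonempty) (hl : IsLim l) (ha₀ : a₀ < l) :
    ∃ z, ∀ A : Set Om1, (∀ b < l, ∃ a ∈ A, b < a ∧ a < l) → z ∈ closure (⋃ a ∈ A, F.layer a) := by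
  have hΩ : IsOpen (⋃ b ∈ Iio l, F.stage b) := isOpen_biUnion fun b _ => F.isOpen_stage b
  -- By connectedness the union of the earlier stages has a boundary point; the sequence need not be
  -- continuous at `l`.
  obtain ⟨z, hz, hz'⟩ : ∃ z ∈ closure (⋃ b ∈ Iio l, F.stage b), z ∉ ⋃ b ∈ Iio l, F.stage b := by
    by_contra! hcon
    have hcl : IsClopen (⋃ b ∈ Iio l, F.stage b) := ⟨isClosed_of_closure_subset hcon, hΩ⟩
    rcases isClopen_iff.1 hcl with h' | h'
    · obtain ⟨y, hy⟩ := h₀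
      exact (h' ▸ mem_iUnion₂.2 ⟨a₀, ha₀, hy⟩ : y ∈ (∅ : Set N))
    · refine F.stage_ne_univ l (univ_subset_iff.1 (h'.symm.subset.trans ?_))
      exact iUnion₂_subset fun b hb => F.stage_mono (le_of_lt hb)
  refine ⟨z, fun A hA => mem_closure_iff.2 fun V hV hzV => ?_⟩
  obtain ⟨e, he, he0, heV⟩ := hN.exists_subset (hV.mem_nhds hzV)
  have hzC : z ∈ range e := ⟨0, he0⟩
  obtain ⟨y, hyC, hy⟩ := mem_closure_iff.1 hz _ he.isOpen_range hzC
  obtain ⟨b, hb, hyb⟩ := mem_iUnion₂.1 hy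
  obtain ⟨a, haA, hba, hal⟩ := hA b hb
  have hnext : a.next < l := by
    obtain ⟨c, hac, hcl⟩ := hl.2 a hal
    exact (Om1.next_le hac).trans_lt hcl
  have hzn : z ∉ F.stage a.next := fun h => hz' (mem_iUnion₂.2 ⟨_, hnext, h⟩)
  -- A connected neighbourhood of `z` that enters stage `a` and also leaves stage `a.next` must
  -- cross the layer in between.
  obtain ⟨w, hwC, hw⟩ := (isPreconnected_range he.continuous) (F.stage a.next)
    (closure (F.stage a))ᶜ (F.isOpen_stage _) isClosed_closure.isOpen_compl
    (fun w _ => by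
      by_cases hw : w ∈ closure (F.stage a)
      · exact Or.inl (F.closure_stage_subset a.lt_next hw)
      · exact Or.inr hw)
    ⟨y, hyC, F.stage_mono (hba.le.trans a.lt_next.le) hyb⟩
    ⟨z, hzC, fun h => hzn (F.closure_stage_subset a.lt_next h)⟩
  exact ⟨w, heV hwC, mem_iUnion₂.2 ⟨a, haA, hw⟩⟩

end TypeI

/-- The gated product, with one point added at the end of each of a family of open sets. -/
def EndSpace {N I : Type} (O : Set N) (_ : I → Set N) : Type := ↥(Gated O) ⊕ I

namespace EndSpace

variable {N I : Type} {O : Set N} {W : I → Set N}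

/-- The points of the gated product. -/
def inl (p : ↥(Gated O)) : EndSpace O W := Sum.inl p

/-- The added points. -/
def inr (i : I) : EndSpace O W := Sum.inr i

theorem inl_injective : Function.Injective (inl : ↥(Gated O) → EndSpace O W) := Sum.inl_injective

theorem inr_injective : Function.Injective (inr : I → EndSpace O W) := Sum.inr_injective

theorem inl_ne_inr {p : ↥(Gated O)} {i : I} : (inl p : EndSpace O W) ≠ inr i := Sum.inl_ne_inr

theorem eq_inl_or_inr (x : EndSpace O W) : (∃ p, x = inl p) ∨ ∃ i, x = inr i := by
  cases x with
  | inl p => exact Or.inl ⟨p, rfl⟩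
  | inr i => exact Or.inr ⟨i, rfl⟩

/-- The trace of the basic neighbourhoods of the added points. -/
def tail (O W : Set N) (k : ℤ) : Set ↥(Gated O) :=
  {p | p.1.1 ∈ W ∧ (k : ℝ) < p.1.2 ∧ ∀ n : ℤ, p.1.2 ≠ n}

theorem tail_mono {O W : Set N} {k l : ℤ} (h : k ≤ l) : tail O W l ⊆ tail O W k :=
  fun _ hp => ⟨hp.1, (Int.cast_le.2 h).trans_lt hp.2.1, hp.2.2⟩

variable [TopologicalSpace N]

instance : TopologicalSpace (EndSpace O W) where
  IsOpen U := IsOpen (inl ⁻¹' U) ∧ ∀ i, inr i ∈ U → ∃ k, tail O (W i) k ⊆ inl ⁻¹' U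
  isOpen_univ := ⟨isOpen_univ, fun _ _ => ⟨0, subset_univ _⟩⟩
  isOpen_inter := fun U V hU hV => ⟨hU.1.inter hV.1, fun i hi => by
    obtain ⟨k, hk⟩ := hU.2 i hi.1
    obtain ⟨l, hl⟩ := hV.2 i hi.2
    exact ⟨max k l, subset_inter ((tail_mono (le_max_left _ _)).trans hk)
      ((tail_mono (le_max_right _ _)).trans hl)⟩⟩
  isOpen_sUnion := fun 𝒰 h𝒰 => by
    refine ⟨?_, fun i ⟨U, hU, hi⟩ => ?_⟩
    · rw [preimage_sUnion]
      exact isOpen_biUnion fun U hU => (h𝒰 U hU).1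
    · obtain ⟨k, hk⟩ := (h𝒰 U hU).2 i hi
      exact ⟨k, fun p hp => ⟨U, hU, hk hp⟩⟩

theorem isOpen_iff {U : Set (EndSpace O W)} : IsOpen U ↔
    IsOpen (inl ⁻¹' U) ∧ ∀ i, inr i ∈ U → ∃ k, tail O (W i) k ⊆ inl ⁻¹' U := Iff.rfl

theorem isOpenEmbedding_inl : IsOpenEmbedding (inl : ↥(Gated O) → EndSpace O W) := by
  refine .of_continuous_injective_isOpenMap
    (continuous_def.2 fun U hU => (isOpen_iff.1 hU).1) inl_injective fun V hV => ?_
  refine isOpen_iff.2 ⟨by rwa [preimage_image_eq _ inl_injective], ?_⟩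
  rintro i ⟨p, -, hp⟩
  exact absurd hp inl_ne_inr

/-- The basic neighbourhoods of the added points. -/
def nbhd (i : I) (k : ℤ) : Set (EndSpace O W) := insert (inr i) (inl '' tail O (W i) k)

theorem isOpen_tail {W : Set N} (hW : IsOpen W) (k : ℤ) : IsOpen (tail O W k) := by
  have : tail O W k = Subtype.val ⁻¹' (Prod.fst ⁻¹' W ∩ Prod.snd ⁻¹' Ioi (k : ℝ) ∩
      Gated (∅ : Set N)) := by
    ext p
    exact ⟨fun h => ⟨⟨h.1, h.2.1⟩, Or.inr h.2.2⟩,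
      fun h => ⟨h.1.1, h.1.2, h.2.resolve_left (notMem_empty _)⟩⟩
  rw [this]
  exact (((hW.preimage continuous_fst).inter (isOpen_Ioi.preimage continuous_snd)).inter
    (isOpen_gated isOpen_empty)).preimage continuous_subtype_val

theorem isOpen_nbhd (hW : ∀ i, IsOpen (W i)) (i : I) (k : ℤ) :
    IsOpen (nbhd i k : Set (EndSpace O W)) := by
  have hpre : inl ⁻¹' (nbhd i k : Set (EndSpace O W)) = tail O (W i) k := by
    ext p
    constructor
    · rintro (h | ⟨q, hq, h⟩)
      · exact absurd h inl_ne_inr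
      · exact inl_injective h ▸ hq
    · exact fun h => Or.inr ⟨p, h, rfl⟩
  refine isOpen_iff.2 ⟨hpre ▸ isOpen_tail (hW i) k, fun l hl => ?_⟩
  obtain h | ⟨p, _, h⟩ := hl
  · exact ⟨k, hpre ▸ (inr_injective h) ▸ subset_rfl⟩
  · exact absurd h inl_ne_inr

theorem exists_nbhd_subset {U : Set (EndSpace O W)} {i : I} (hU : U ∈ 𝓝 (inr i)) :
    ∃ k, nbhd i k ⊆ U := by
  obtain ⟨V, hVU, hV, hiV⟩ := mem_nhds_iff.1 hU
  obtain ⟨k, hk⟩ := (isOpen_iff.1 hV).2 i hiV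
  exact ⟨k, (insert_subset hiV (image_subset_iff.2 hk)).trans hVU⟩

theorem t2Space [T2Space N] (hW : ∀ i, IsOpen (W i)) (hdis : Pairwise (Function.onFun Disjoint W)) :
    T2Space (EndSpace O W) := by
  have key : ∀ (p : ↥(Gated O)) (i : I), ∃ u v : Set (EndSpace O W), IsOpen u ∧ IsOpen v ∧
      inl p ∈ u ∧ inr i ∈ v ∧ Disjoint u v := by
    intro p i
    obtain ⟨k, hk⟩ := exists_int_gt p.1.2
    refine ⟨inl '' {q | q.1.2 < k}, nbhd i k, isOpenEmbedding_inl.isOpenMap _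
      (isOpen_lt (by fun_prop) continuous_const), isOpen_nbhd hW i k, ⟨p, hk, rfl⟩,
      mem_insert _ _, disjoint_left.2 ?_⟩
    rintro _ ⟨q, hq, rfl⟩ (h | ⟨q', hq', h⟩)
    · exact inl_ne_inr h
    · rw [inl_injective h] at hq'
      exact lt_asymm hq hq'.2.1
  refine ⟨fun x y hxy => ?_⟩
  obtain ⟨p, rfl⟩ | ⟨i, rfl⟩ := eq_inl_or_inr x <;>
    obtain ⟨q, rfl⟩ | ⟨l, rfl⟩ := eq_inl_or_inr y
  · obtain ⟨u, v, hu, hv, hpu, hqv, hd⟩ := t2_separation (fun h => hxy (congrArg inl h) : p ≠ q)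
    exact ⟨_, _, isOpenEmbedding_inl.isOpenMap u hu, isOpenEmbedding_inl.isOpenMap v hv,
      ⟨p, hpu, rfl⟩, ⟨q, hqv, rfl⟩, disjoint_image_of_injective inl_injective hd⟩
  · exact key p l
  · obtain ⟨u, v, hu, hv, h1, h2, hd⟩ := key q i
    exact ⟨v, u, hv, hu, h2, h1, hd.symm⟩
  · refine ⟨_, _, isOpen_nbhd hW i 0, isOpen_nbhd hW l 0, mem_insert _ _, mem_insert _ _,
      disjoint_left.2 ?_⟩
    rintro _ (rfl | ⟨p, hp, rfl⟩) (h | ⟨q, hq, h⟩)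
    · exact hxy h
    · exact inl_ne_inr h
    · exact inl_ne_inr h
    · rw [inl_injective h] at hq
      exact disjoint_left.1 (hdis fun h => hxy (congrArg inr h)) hp.1 hq.1

theorem dense_range_inl (hW : ∀ i, (W i).Nonempty) :
    Dense (range (inl : ↥(Gated O) → EndSpace O W)) := by
  intro x
  obtain ⟨p, rfl⟩ | ⟨i, rfl⟩ := eq_inl_or_inr x
  · exact subset_closure (mem_range_self p)
  · refine mem_closure_iff_nhds.2 fun U hU => ?_
    obtain ⟨k, hk⟩ := exists_nbhd_subset hU
    obtain ⟨w, hw⟩ := hW i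
    have ht : (k + 1 / 2 : ℝ) ∈ Ioo (k : ℝ) (k + 1) := by constructor <;> linarith
    exact ⟨_, hk (Or.inr ⟨⟨(w, k + 1 / 2), mem_gated_of_mem_Ioo ht⟩,
      ⟨hw, ht.1, not_int_of_mem_Ioo ht⟩, rfl⟩), mem_range_self _⟩

/-- The punctured neighbourhood embeds in a second countable open part of `N` times the line, and
the end point has a countable base of clopen sets. -/
theorem metrizable_separable_nbhd [T2Space N] [T2Space (EndSpace O W)] (hN : LocEuclidean 2 N)
    (hW : ∀ i, IsOpen (W i)) {i : I} {K : Set N} (hK : IsLindelof K) (hWK : W i ⊆ K) :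
    TopologicalSpace.MetrizableSpace ↥(nbhd i 0 : Set (EndSpace O W)) ∧
      TopologicalSpace.SeparableSpace ↥(nbhd i 0 : Set (EndSpace O W)) := by
  have := hN.weaklyLocallyCompactSpace
  obtain ⟨Ω, -, hΩ, _⟩ := hN.exists_isOpen_secondCountable hK
  let Z : Set ↥(Gated O) := tail O (W i) 0
  let φ : Z → Ω × ℝ := fun p => (⟨p.1.1.1, hΩ (hWK p.2.1)⟩, p.1.1.2)
  have hφ : IsEmbedding φ := by
    have h : IsEmbedding fun p : Z => p.1.1 := IsEmbedding.subtypeVal.comp IsEmbedding.subtypeVal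
    exact IsEmbedding.of_comp (g := Prod.map Subtype.val id) (by fun_prop) (by fun_prop) h
  have : SecondCountableTopology Z := hφ.secondCountableTopology
  have : RegularSpace Z := hφ.isInducing.regularSpace
  let e : Z → ↥(nbhd i 0 : Set (EndSpace O W)) := fun p => ⟨inl p.1, Or.inr ⟨p.1, p.2, rfl⟩⟩
  have he : IsOpenEmbedding e := by
    refine IsOpenEmbedding.of_comp e (isOpen_nbhd hW i 0).isOpenEmbedding_subtypeVal ?_
    exact isOpenEmbedding_inl.comp (isOpen_tail (hW i) 0).isOpenEmbedding_subtypeVal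
  refine metrizable_separable_of_punctured ⟨inr i, mem_insert _ _⟩
    (fun k : ℕ => Subtype.val ⁻¹' nbhd i k) (fun k => ⟨⟨?_⟩, ?_⟩) (fun U hU => ?_)
    (fun k => mem_insert _ _) he ?_
  -- Omitting the integer heights from the tails is what makes them clopen here: no point of the
  -- neighbourhood has height exactly `k`.
  · have : (Subtype.val ⁻¹' nbhd i k : Set ↥(nbhd i 0 : Set (EndSpace O W)))ᶜ =
        e '' {p | p.1.1.2 < k} := by
      ext y
      constructor
      · intro hy
        obtain ⟨y, h | ⟨p, hp, rfl⟩⟩ := y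
        · exact absurd (Or.inl h) hy
        · refine ⟨⟨p, hp⟩, ?_, rfl⟩
          have h1 : ¬ (k : ℝ) < p.1.2 := fun h => hy (Or.inr ⟨p, ⟨hp.1, by simpa using h, hp.2.2⟩, rfl⟩)
          exact lt_of_le_of_ne (not_lt.1 h1) (by simpa using hp.2.2 k)
      · rintro ⟨p, hp, rfl⟩ (h | ⟨q, hq, h⟩)
        · exact inl_ne_inr h
        · rw [inl_injective h] at hq
          have h1 := hq.2.1
          simp only [Int.cast_natCast] at h1
          exact lt_asymm hp h1
    rw [this]
    exact he.isOpenMap _ (isOpen_lt (by fun_prop) continuous_const)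
  · exact (isOpen_nbhd hW i k).preimage continuous_subtype_val
  · obtain ⟨V, hV, hVU⟩ := (mem_nhds_subtype _ _ _).1 hU
    obtain ⟨k, hk⟩ := exists_nbhd_subset hV
    refine ⟨k.toNat, fun y hy => hVU (hk ?_)⟩
    exact insert_subset_insert (image_mono (tail_mono (Int.self_le_toNat k))) hy
  · rintro ⟨y, h | ⟨p, hp, rfl⟩⟩ hne
    · exact absurd (Subtype.ext h) hne
    · exact ⟨⟨p, hp⟩, rfl⟩

end EndSpace

end

/-! ### The space with end points: Type I structure, direction, extension of maps -/

noncomputable section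

open Om1

theorem LocEuclidean.isLindelof_fst_preimage {N : Type} [TopologicalSpace N]
    (hN : LocEuclidean 2 N) {K : Set N} (hK : IsLindelof K) (Y : Set (N × ℝ)) :
    IsLindelof (Subtype.val ⁻¹' (Prod.fst ⁻¹' K) : Set Y) := by
  obtain ⟨Ω, -, hΩ, _⟩ := hN.exists_isOpen_secondCountable hK
  let Z : Set (Ω × ℝ) := {p | (p.1.1, p.2) ∈ Y}
  exact isLindelof_of_subset_range (Z := Z) (f := fun p => ⟨(p.1.1.1, p.1.2), p.2⟩) (by fun_prop)
    fun p hp => ⟨⟨(⟨p.1.1, hΩ hp⟩, p.1.2), p.2⟩, rfl⟩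

namespace EndSpace

variable {N : Type} [TopologicalSpace N] {O : Set N} (F : TypeI N) (a₀ : Om1)

/-- The gated product of a Type I space, with points added at the ends of the layers. -/
abbrev OfTypeI (O : Set N) (F : TypeI N) (a₀ : Om1) : Type :=
  EndSpace O fun i : Ici a₀ => F.layer i.1

/-- The stages of the space: everything over a set `A` of the base together with the added points
with index in `B`. -/
def cyl (A : Set N) (B : Set Om1) : Set (OfTypeI O F a₀) :=
  inl '' (Subtype.val ⁻¹' (Prod.fst ⁻¹' A)) ∪ inr '' (Subtype.val ⁻¹' B)

variable {F a₀}

theorem inl_mem_cyl {A : Set N} {B : Set Om1} {p : ↥(Gated O)} :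
    (inl p : OfTypeI O F a₀) ∈ cyl F a₀ A B ↔ p.1.1 ∈ A := by
  constructor
  · rintro (⟨q, hq, h⟩ | ⟨i, _, h⟩)
    · exact inl_injective h ▸ hq
    · exact absurd h.symm inl_ne_inr
  · exact fun h => Or.inl ⟨p, h, rfl⟩

theorem inr_mem_cyl {A : Set N} {B : Set Om1} {i : Ici a₀} :
    (inr i : OfTypeI O F a₀) ∈ cyl F a₀ A B ↔ i.1 ∈ B := by
  constructor
  · rintro (⟨q, _, h⟩ | ⟨l, hl, h⟩)
    · exact absurd h inl_ne_inr
    · exact inr_injective h ▸ hl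
  · exact fun h => Or.inr ⟨i, h, rfl⟩

theorem isOpen_cyl {A : Set N} (hA : IsOpen A) {B : Set Om1} (h : ∀ b ∈ B, F.layer b ⊆ A) :
    IsOpen (cyl F a₀ A B : Set (OfTypeI O F a₀)) := by
  refine isOpen_iff.2 ⟨?_, fun i hi => ⟨0, fun p hp => inl_mem_cyl.2 (h _ (inr_mem_cyl.1 hi) hp.1)⟩⟩
  have : inl ⁻¹' (cyl F a₀ A B : Set (OfTypeI O F a₀)) =
      Subtype.val ⁻¹' (Prod.fst ⁻¹' A) := Set.ext fun p => inl_mem_cyl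
  rw [this]
  exact (hA.preimage continuous_fst).preimage continuous_subtype_val

theorem isClosed_cyl_closure (a : Om1) :
    IsClosed (cyl F a₀ (closure (F.stage a)) (Iic a) : Set (OfTypeI O F a₀)) := by
  refine ⟨?_⟩
  have : (cyl F a₀ (closure (F.stage a)) (Iic a) : Set (OfTypeI O F a₀))ᶜ =
      cyl F a₀ (closure (F.stage a))ᶜ (Ioi a) := by
    ext x
    rw [mem_compl_iff]
    obtain ⟨p, rfl⟩ | ⟨i, rfl⟩ := eq_inl_or_inr x
    · rw [inl_mem_cyl, inl_mem_cyl, mem_compl_iff]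
    · rw [inr_mem_cyl, inr_mem_cyl, mem_Iic, not_le, mem_Ioi]
  rw [this]
  exact isOpen_cyl isClosed_closure.isOpen_compl fun b hb y hy h =>
    hy.2 (closure_mono (F.stage_mono (le_of_lt hb)) h)

/-- The Type I structure of the gated product with end points. -/
def typeI (hN : LocEuclidean 2 N) (O : Set N) (F : TypeI N) (a₀ : Om1) :
    TypeI (OfTypeI O F a₀) :=
  TypeI.ofStages (fun a => cyl F a₀ (F.stage a) (Iio a))
    (fun a => cyl F a₀ (closure (F.stage a)) (Iic a))
    (fun a => isOpen_cyl (F.isOpen_stage a) fun _ hb _ hy => F.stage_mono (next_le hb) hy.1)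
    (fun a => by
      refine ((hN.isLindelof_fst_preimage (F.isLindelof_closure_stage a) _).image
        isOpenEmbedding_inl.continuous).union (Countable.isLindelof (Countable.image ?_ _))
      exact (countable_Iic a).preimage_of_injOn Subtype.val_injective.injOn)
    (fun a => closure_minimal (union_subset_union (image_mono (preimage_mono
      (preimage_mono subset_closure))) (image_mono (preimage_mono Iio_subset_Iic_self)))
        (isClosed_cyl_closure a))
    (fun a b h => union_subset_union (image_mono (preimage_mono
      (preimage_mono (F.closure_stage_subset h)))) (image_mono (preimage_mono
        (Iic_subset_Iio.2 h))))
    (fun x => by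
      obtain ⟨p, rfl⟩ | ⟨i, rfl⟩ := eq_inl_or_inr x
      · obtain ⟨a, ha⟩ := F.exists_mem_stage p.1.1
        exact ⟨a, inl_mem_cyl.2 ha⟩
      · obtain ⟨a, ha⟩ := exists_gt i.1
        exact ⟨a, inr_mem_cyl.2 ha⟩)
    (fun a => ⟨inr ⟨max a₀ a, mem_Ici.2 (le_max_left _ _)⟩, fun h =>
      (le_max_right a₀ a).not_gt (inr_mem_cyl.1 h)⟩)

variable (hN : LocEuclidean 2 N)

theorem stage_typeI (a : Om1) :
    (typeI hN O F a₀).stage a = cyl F a₀ (F.stage a) (Iio a) := TypeI.stage_ofStages a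

theorem isClubDiscrete_of_subset_inr {E : Set (OfTypeI O F a₀)}
    (hE : (typeI hN O F a₀).Unbounded E) (h : E ⊆ range inr) :
    (typeI hN O F a₀).IsClubDiscrete E := by
  refine TypeI.isClubDiscrete_of_locally hE fun x => ?_
  obtain ⟨p, rfl⟩ | ⟨i, rfl⟩ := eq_inl_or_inr x
  · refine ⟨range inl, isOpenEmbedding_inl.isOpen_range.mem_nhds (mem_range_self p), ?_⟩
    rintro _ ⟨⟨q, rfl⟩, hy⟩
    obtain ⟨i, hi⟩ := h hy
    exact absurd hi.symm inl_ne_inr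
  · have hW : ∀ i : Ici a₀, IsOpen (F.layer i.1) := fun i => F.isOpen_layer i.1
    refine ⟨nbhd i 0, (isOpen_nbhd hW i 0).mem_nhds (mem_insert _ _), ?_⟩
    rintro y ⟨hy | ⟨p, _, rfl⟩, hyE⟩
    · exact hy
    · obtain ⟨i, hi⟩ := h hyE
      exact absurd hi.symm inl_ne_inr

/-- An end point passes its value on to its layer at all non-integer heights beyond some `k`. With a
common `k` for uncountably many layers, restrict `f` to one slice `N × {t}`; a limit point of both
families of layers in that slice gives the contradiction. -/
theorem isDirection_inr [ConnectedSpace N] (h₀ : (F.stage a₀).Nonempty) :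
    (typeI hN O F a₀).IsDirection (range inr) := by
  have hub : (typeI hN O F a₀).Unbounded (range inr) := by
    refine (TypeI.unbounded_iff _).2 fun a => ⟨_, mem_range_self ⟨max a₀ a, mem_Ici.2 (le_max_left _ _)⟩, ?_⟩
    rw [stage_typeI, inr_mem_cyl]
    exact (le_max_right a₀ a).not_gt
  refine TypeI.isDirection_of_rigid (isClubDiscrete_of_subset_inr hN hub subset_rfl).1
    fun f hf a ha => ?_
  obtain ⟨b, hab⟩ := exists_gt a
  refine ⟨b, ?_⟩
  by_contra hb
  have key : ∀ V : Set LongRay, IsOpen V → ¬ {x | x ∈ range inr ∧ f x ∈ V}.Countable →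
      ∃ A : Set Om1, ∃ k : ℤ, (∀ c, ∃ d ∈ A, c < d) ∧
        ∀ d ∈ A, ∀ p : ↥(Gated O), p ∈ tail O (F.layer d) k → f (inl p) ∈ V := by
    intro V hV hVc
    have hu : ¬ {i | f (inr i) ∈ V}.Countable := by
      refine fun h => hVc ((h.image inr).mono ?_)
      rintro _ ⟨⟨i, rfl⟩, h⟩
      exact ⟨i, h, rfl⟩
    obtain ⟨k, hk⟩ := exists_uncountable_fiber hu
      (fun i k => tail O (F.layer i.1) k ⊆ inl ⁻¹' (f ⁻¹' V))
      fun i hi => (isOpen_iff.1 (hV.preimage hf)).2 i hi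
    refine ⟨Subtype.val '' {i | i ∈ {i | f (inr i) ∈ V} ∧
      tail O (F.layer i.1) k ⊆ inl ⁻¹' (f ⁻¹' V)}, k, unbounded_of_uncountable fun h => hk
        (countable_of_injective_of_countable_image Subtype.val_injective.injOn h), ?_⟩
    rintro _ ⟨i, hi, rfl⟩ p hp
    exact hi.2 hp
  obtain ⟨A, k, hA, hA'⟩ := key _ isOpen_Iio ha
  obtain ⟨B, l, hB, hB'⟩ := key _ isOpen_Ioi hb
  obtain ⟨G, hG⟩ := exists_closure_limit hA
  obtain ⟨G', hG'⟩ := exists_closure_limit hB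
  obtain ⟨H, hH, hH'⟩ := exists_closure_subset_two G G'
  obtain ⟨d, hd, had⟩ := exists_mem_closure H a₀
  obtain ⟨z, hz⟩ := F.exists_limit_of_layers hN h₀ hd.1 had
  have ht : (((max k l : ℤ) : ℝ) + 1 / 2) ∈ Ioo ((max k l : ℤ) : ℝ) ((max k l : ℤ) + 1) := by
    constructor <;> linarith
  let u : N → LongRay := fun y => f (inl ⟨(y, (max k l : ℤ) + 1 / 2), mem_gated_of_mem_Ioo ht⟩)
  have hu : Continuous u :=
    hf.comp (isOpenEmbedding_inl.continuous.comp (by fun_prop))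
  have h1 : u z ≤ LongRay.pt a := by
    refine closure_minimal (s := ⋃ c ∈ A, F.layer c) (iUnion₂_subset fun c hc y hy => ?_)
      (isClosed_Iic.preimage hu) (hz A (hG d (hH hd)))
    exact Iio_subset_Iic_self (hA' c hc _ (tail_mono (le_max_left k l)
      ⟨hy, ht.1, not_int_of_mem_Ioo ht⟩))
  have h2 : LongRay.pt b ≤ u z := by
    refine closure_minimal (s := ⋃ c ∈ B, F.layer c) (iUnion₂_subset fun c hc y hy => ?_)
      (isClosed_Ici.preimage hu) (hz B (hG' d (hH' hd)))
    exact Ioi_subset_Ici_self (hB' c hc _ (tail_mono (le_max_right k l)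
      ⟨hy, ht.1, not_int_of_mem_Ioo ht⟩))
  exact not_le.2 hab (LongRay.pt_le_iff.1 (h2.trans h1))

/-- A continuous function on a slab, cut off by a bound for its values in the gates, extends. -/
theorem exists_extension (hO : IsOpen O) {c : LongRay} (i : ℤ) {g : N → LongRay}
    (hg : Continuous g) (hc : ∀ y ∈ O, g y ≤ c) :
    ∃ f : OfTypeI O F a₀ → LongRay, Continuous f ∧
      ∀ p : ↥(Gated O), p.1.2 ∈ Ioo (i : ℝ) (i + 1) → f (inl p) = max (g p.1.1) c := by
  classical
  let f₀ : ↥(Gated O) → LongRay := fun p =>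
    if p.1.2 ∈ Ioo (i : ℝ) (i + 1) then max (g p.1.1) c else c
  let f : OfTypeI O F a₀ → LongRay := Sum.elim f₀ fun _ => c
  have hf₀ : Continuous f₀ := by
    refine continuous_iff_continuousAt.2 fun p => ?_
    by_cases h1 : p.1.2 ∈ Ioo (i : ℝ) (i + 1)
    · have : ContinuousAt (fun p : ↥(Gated O) => max (g p.1.1) c) p :=
        (by fun_prop : Continuous fun p : ↥(Gated O) => max (g p.1.1) c).continuousAt
      refine this.congr ?_
      filter_upwards [(isOpen_Ioo.preimage (by fun_prop :
        Continuous fun p : ↥(Gated O) => p.1.2)).mem_nhds h1] with q hq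
      exact (if_pos hq).symm
    · refine (continuousAt_const (y := c)).congr ?_
      by_cases h2 : p.1.2 ∈ Icc (i : ℝ) (i + 1)
      -- On a wall bounding the slab the point must be in a gate, where `g ≤ c` makes both
      -- definitions agree.
      · have hpO : p.1.1 ∈ O := by
          refine p.2.resolve_right fun h => h1 ⟨lt_of_le_of_ne h2.1 (h i).symm,
            lt_of_le_of_ne h2.2 ?_⟩
          have := h (i + 1)
          rwa [Int.cast_add, Int.cast_one] at this
        filter_upwards [(hO.preimage (by fun_prop :
          Continuous fun p : ↥(Gated O) => p.1.1)).mem_nhds hpO] with q hq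
        by_cases h3 : q.1.2 ∈ Ioo (i : ℝ) (i + 1)
        · exact ((if_pos h3).trans (max_eq_right (hc _ hq))).symm
        · exact (if_neg h3).symm
      · filter_upwards [(isClosed_Icc.isOpen_compl.preimage (by fun_prop :
          Continuous fun p : ↥(Gated O) => p.1.2)).mem_nhds h2] with q hq
        exact (if_neg fun h => hq (Ioo_subset_Icc_self h)).symm
  refine ⟨f, continuous_def.2 fun V hV => isOpen_iff.2 ⟨hV.preimage hf₀, fun l hl => ⟨i + 1, ?_⟩⟩,
    fun p hp => if_pos hp⟩
  intro p hp
  have : f₀ p = c := if_neg fun h => lt_asymm h.2 (by simpa using hp.2.1)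
  show f₀ p ∈ V
  rw [this]
  exact hl

end EndSpace

theorem LongRay.bddAbove_image_max {X : Type*} (g : X → LongRay) (c : LongRay) (A : Set X) :
    BddAbove ((fun x => max (g x) c) '' A) ↔ BddAbove (g '' A) := by
  constructor
  · rintro ⟨b, hb⟩
    refine ⟨b, ?_⟩
    rintro _ ⟨x, hx, rfl⟩
    exact (le_max_left _ _).trans (hb ⟨x, hx, rfl⟩)
  · rintro ⟨b, hb⟩
    refine ⟨max b c, ?_⟩
    rintro _ ⟨x, hx, rfl⟩
    exact max_le_max (hb ⟨x, hx, rfl⟩) le_rfl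

/-- The gates are Lindelöf, so a map on `N` has a bound `c` there and its maximum with `c` extends
from any slab. Sets of end points are always discrete, which covers the directions unbounded outside
the gated product. -/
theorem IsDirectionlessSurface.exists_directionsContainDiscrete {N : Type} [TopologicalSpace N]
    (hN : IsDirectionlessSurface N) :
    ∃ (X : Type) (_ : TopologicalSpace X) (F : TypeI X) (M : Set X),
      F.DirectionsContainDiscrete M ∧ IsManifoldUnionOmegaBounded M := by
  obtain ⟨hman, hω, F, hF⟩ := hN
  obtain ⟨_, _, hloc⟩ := isTopManifold_iff.1 hman
  obtain ⟨κ, hκ⟩ := hloc.exists_annulus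
  obtain ⟨a₀, ha₀⟩ := F.exists_mem_stage (Classical.arbitrary N)
  have h₀ : (F.stage a₀).Nonempty := ⟨_, ha₀⟩
  have hW : ∀ i : Ici a₀, IsOpen (F.layer i.1) := fun i => F.isOpen_layer i.1
  have hne : ∀ i : Ici a₀, (F.layer i.1).Nonempty := fun i =>
    F.layer_nonempty (h₀.mono (F.stage_mono i.2))
  have hT2 : T2Space (EndSpace.OfTypeI (range κ) F a₀) := EndSpace.t2Space hW fun i l h =>
    F.disjoint_layer fun h' => h (Subtype.ext h')
  have hloc3 : LocEuclidean 3 ↥(Gated (range κ)) :=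
    (hloc.prod locEuclidean_real).of_isOpenEmbedding
      (isOpen_gated hκ.isOpen_range).isOpenEmbedding_subtypeVal
  have hms : ∀ x : EndSpace.OfTypeI (range κ) F a₀, ∃ U ∈ 𝓝 x,
      TopologicalSpace.MetrizableSpace ↥U ∧ TopologicalSpace.SeparableSpace ↥U := by
    intro x
    obtain ⟨p, rfl⟩ | ⟨i, rfl⟩ := EndSpace.eq_inl_or_inr x
    · obtain ⟨e, he, hp⟩ := hloc3 p
      have he' := EndSpace.isOpenEmbedding_inl (W := fun i : Ici a₀ => F.layer i.1).comp he
      refine ⟨_, he'.isOpen_range.mem_nhds ?_,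
        he'.toIsEmbedding.toHomeomorph.symm.isEmbedding.metrizableSpace,
        he'.toIsEmbedding.toHomeomorph.surjective.denseRange.separableSpace
          he'.toIsEmbedding.toHomeomorph.continuous⟩
      rw [range_comp]
      exact mem_image_of_mem _ hp
    · exact ⟨_, (EndSpace.isOpen_nbhd hW i 0).mem_nhds (mem_insert _ _),
        EndSpace.metrizable_separable_nbhd hloc hW (F.isLindelof_closure_stage i.1.next)
          (sdiff_subset.trans subset_closure)⟩
  have hmet : LocallyMetrizable (EndSpace.OfTypeI (range κ) F a₀) := fun x => by
    obtain ⟨U, hU, h, -⟩ := hms x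
    exact ⟨U, hU, h⟩
  have hfc := hmet.firstCountable
  have hdir := EndSpace.isDirection_inr hloc (O := range κ) h₀
  have hj := EndSpace.isOpenEmbedding_inl (O := range κ) (W := fun i : Ici a₀ => F.layer i.1)
  obtain ⟨hM, hc⟩ := isManifoldUnionOmegaBounded_gated hloc hω hκ hj.toIsEmbedding
  refine ⟨_, inferInstance, EndSpace.typeI hloc (range κ) F a₀, range EndSpace.inl,
    ⟨⟨hT2, hmet, fun x => ?_, ⟨_, hdir,
      (EndSpace.isClubDiscrete_of_subset_inr hloc hdir.1.2 subset_rfl).2⟩⟩,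
      EndSpace.dense_range_inl hne, hc, fun D hD => ?_⟩, hM⟩
  · obtain ⟨U, hU, -, h⟩ := hms x
    exact ⟨U, hU, h⟩
  · refine exists_isClubDiscrete_of_slabs hloc hω hF hκ hj.toIsEmbedding (fun E _ hE' => ?_)
      (fun i g hg => ?_) hD
    · refine ⟨_, sdiff_subset, EndSpace.isClubDiscrete_of_subset_inr hloc hE' fun x hx => ?_⟩
      obtain ⟨p, rfl⟩ | ⟨i, rfl⟩ := EndSpace.eq_inl_or_inr x
      · exact absurd (mem_range_self p) hx.2
      · exact mem_range_self i
    · obtain ⟨c, hc⟩ := LongRay.bddAbove_image_of_isLindelof hg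
        (isLindelof_of_subset_range hκ.continuous (subset_refl (range κ)))
      obtain ⟨f, hf, hfg⟩ := EndSpace.exists_extension (F := F) (a₀ := a₀) hκ.isOpen_range i hg
        fun y hy => hc ⟨y, hy, rfl⟩
      refine ⟨f, hf, fun A hA => ?_⟩
      rw [← LongRay.bddAbove_image_max g c, ← image_comp, ← image_comp]
      refine iff_of_eq (congrArg BddAbove (image_congr fun p hp => hfg p (hA p hp)))

end

/-! ### Tubes with planes glued to their ends -/

noncomputable section

open Om1

/-- The Euclidean plane. -/
abbrev Plane : Type := EuclideanSpace ℝ (Fin 2)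

/-- Tubes running along the product of a surface with the line, one for each countable ordinal,
separated by a map of the surface into the long ray. -/
structure TubeSystem (N : Type) [TopologicalSpace N] where
  O : Set N
  isOpen_O : IsOpen O
  isConnected_O : IsConnected O
  s : N → LongRay
  continuous_s : Continuous s
  isLindelof_s : ∀ a, IsLindelof {y | s y ≤ LongRay.pt a}
  level : Om1 → Om1
  level_strictMono : StrictMono level
  tube : Om1 → Plane × ℝ → N
  isOpenEmbedding_tube : ∀ a, IsOpenEmbedding fun x : Plane × ℝ => (tube a x, x.2)
  lt_s_tube : ∀ a x, LongRay.pt (level a) < s (tube a x)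
  s_tube_lt : ∀ a x, s (tube a x) < LongRay.pt (level a).next

namespace TubeSystem

variable {N : Type} [TopologicalSpace N] (S : TubeSystem N)

/-- A tube in the product with the line. -/
def tubeMap (a : Om1) (x : Plane × ℝ) : N × ℝ := (S.tube a x, x.2)

/-- The gated product together with the tubes. -/
def Pierced : Set (N × ℝ) := Gated S.O ∪ ⋃ a, range (S.tubeMap a)

theorem tubeMap_mem (a : Om1) (x : Plane × ℝ) : S.tubeMap a x ∈ S.Pierced :=
  Or.inr (mem_iUnion.2 ⟨a, mem_range_self x⟩)

theorem isOpen_pierced : IsOpen S.Pierced :=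
  (isOpen_gated S.isOpen_O).union (isOpen_iUnion fun a => (S.isOpenEmbedding_tube a).isOpen_range)

theorem eq_of_tube_eq {a b : Om1} {x y : Plane × ℝ} (h : S.tube a x = S.tube b y) : a = b := by
  have key : ∀ {a b : Om1} {x y : Plane × ℝ}, S.tube a x = S.tube b y → ¬ a < b := by
    intro a b x y h hab
    have h1 := (S.lt_s_tube b y).trans_eq (congrArg S.s h.symm)
    exact (h1.trans (S.s_tube_lt a x)).not_ge
      (LongRay.pt_le_iff.2 (next_le (S.level_strictMono hab)))
  rcases lt_trichotomy a b with h' | h' | h'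
  · exact absurd h' (key h)
  · exact h'
  · exact absurd h' (key h.symm)

/-- The pierced product, with a plane added at the end of each of the tubes. -/
def Space : Type := ↥S.Pierced ⊕ (Om1 × Plane)

namespace Space

variable {S}

/-- The points of the pierced product. -/
def inl (p : ↥S.Pierced) : S.Space := Sum.inl p

/-- The points of the planes at the ends of the tubes. -/
def inr (a : Om1) (p : Plane) : S.Space := Sum.inr (a, p)

/-- The chart at the end of a tube. -/
def chart (a : Om1) (x : Plane × ℝ) : S.Space :=
  open scoped Classical in
  if x.2 = 0 then inr a x.1 else inl ⟨S.tubeMap a (x.1, x.2⁻¹), S.tubeMap_mem _ _⟩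

theorem chart_zero (a : Om1) (p : Plane) : (chart a (p, 0) : S.Space) = inr a p := if_pos rfl

theorem chart_of_ne {x : Plane × ℝ} (hx : x.2 ≠ 0) (a : Om1) :
    (chart a x : S.Space) = inl ⟨S.tubeMap a (x.1, x.2⁻¹), S.tubeMap_mem _ _⟩ := if_neg hx

theorem chart_inv {t : ℝ} (ht : t ≠ 0) (a : Om1) (p : Plane) :
    (chart a (p, t⁻¹) : S.Space) = inl ⟨S.tubeMap a (p, t), S.tubeMap_mem _ _⟩ := by
  rw [chart_of_ne (inv_ne_zero ht)]
  simp only [inv_inv]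

theorem inl_injective : Function.Injective (inl : ↥S.Pierced → S.Space) := Sum.inl_injective

theorem inl_ne_inr {p : ↥S.Pierced} {a : Om1} {q : Plane} : inl p ≠ inr a q := Sum.inl_ne_inr

theorem inr_eq_iff {a b : Om1} {p q : Plane} : (inr a p : S.Space) = inr b q ↔ a = b ∧ p = q :=
  Sum.inr_injective.eq_iff.trans Prod.mk_inj

theorem eq_inl_or_inr (x : S.Space) : (∃ p, x = inl p) ∨ ∃ a p, x = inr a p := by
  rcases x with p | ⟨a, p⟩
  · exact Or.inl ⟨p, rfl⟩
  · exact Or.inr ⟨a, p, rfl⟩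

instance : TopologicalSpace S.Space where
  IsOpen U := IsOpen (inl ⁻¹' U) ∧ ∀ a, IsOpen (chart a ⁻¹' U)
  isOpen_univ := ⟨isOpen_univ, fun _ => isOpen_univ⟩
  isOpen_inter := fun U V hU hV => ⟨hU.1.inter hV.1, fun a => (hU.2 a).inter (hV.2 a)⟩
  isOpen_sUnion := fun 𝒰 h𝒰 => by
    refine ⟨?_, fun a => ?_⟩
    · rw [preimage_sUnion]
      exact isOpen_biUnion fun U hU => (h𝒰 U hU).1
    · rw [preimage_sUnion]
      exact isOpen_biUnion fun U hU => (h𝒰 U hU).2 a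

theorem isOpen_iff {U : Set S.Space} :
    IsOpen U ↔ IsOpen (inl ⁻¹' U) ∧ ∀ a, IsOpen (chart a ⁻¹' U) := Iff.rfl

theorem continuous_iff {Y : Type*} [TopologicalSpace Y] {f : S.Space → Y} :
    Continuous f ↔ Continuous (f ∘ inl) ∧ ∀ a, Continuous (f ∘ chart a) := by
  simp only [continuous_def, isOpen_iff, preimage_comp]
  exact ⟨fun h => ⟨fun U hU => (h U hU).1, fun a U hU => (h U hU).2 a⟩,
    fun h U hU => ⟨h.1 U hU, fun a => h.2 a U hU⟩⟩

theorem isOpenEmbedding_inl : IsOpenEmbedding (inl : ↥S.Pierced → S.Space) := by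
  refine .of_continuous_injective_isOpenMap (continuous_iff.1 continuous_id).1 inl_injective
    fun V hV => isOpen_iff.2 ⟨by rwa [preimage_image_eq _ inl_injective], fun a => ?_⟩
  let g : {x : Plane × ℝ // x.2 ≠ 0} → ↥S.Pierced := fun x =>
    ⟨S.tubeMap a (x.1.1, x.1.2⁻¹), S.tubeMap_mem _ _⟩
  have hg : Continuous g := by
    refine Continuous.subtype_mk ((S.isOpenEmbedding_tube a).continuous.comp ?_) _
    exact (by fun_prop : Continuous fun x : {x : Plane × ℝ // x.2 ≠ 0} => x.1.1).prodMk
      ((by fun_prop : Continuous fun x : {x : Plane × ℝ // x.2 ≠ 0} => x.1.2).inv₀ fun x => x.2)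
  have : chart a ⁻¹' (inl '' V) = Subtype.val '' (g ⁻¹' V) := by
    ext x
    constructor
    · rintro ⟨p, hp, h⟩
      by_cases hx : x.2 = 0
      · rw [chart, if_pos hx] at h
        exact absurd h inl_ne_inr
      · rw [chart_of_ne hx] at h
        refine ⟨⟨x, hx⟩, ?_, rfl⟩
        show (⟨S.tubeMap a (x.1, x.2⁻¹), S.tubeMap_mem _ _⟩ : ↥S.Pierced) ∈ V
        rwa [← inl_injective h]
    · rintro ⟨x, hx, rfl⟩
      exact ⟨_, hx, (chart_of_ne x.2 a).symm⟩
  rw [this]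
  exact (isOpen_ne.preimage continuous_snd).isOpenEmbedding_subtypeVal.isOpenMap _
    (hV.preimage hg)

theorem chart_eq_chart {a b : Om1} {x y : Plane × ℝ} (h : (chart a x : S.Space) = chart b y) :
    a = b ∧ x = y := by
  by_cases hx : x.2 = 0 <;> by_cases hy : y.2 = 0
  · rw [chart, chart, if_pos hx, if_pos hy, inr_eq_iff] at h
    exact ⟨h.1, Prod.ext h.2 (hx.trans hy.symm)⟩
  · rw [chart, if_pos hx, chart_of_ne hy] at h
    exact absurd h.symm inl_ne_inr
  · rw [chart_of_ne hx, chart, if_pos hy] at h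
    exact absurd h inl_ne_inr
  · rw [chart_of_ne hx, chart_of_ne hy] at h
    have h' : S.tubeMap a (x.1, x.2⁻¹) = S.tubeMap b (y.1, y.2⁻¹) :=
      congrArg Subtype.val (inl_injective h)
    obtain rfl := S.eq_of_tube_eq (congrArg Prod.fst h')
    have h2 : (x.1, x.2⁻¹) = (y.1, y.2⁻¹) := (S.isOpenEmbedding_tube a).injective h'
    exact ⟨rfl, Prod.ext (Prod.mk.inj h2).1 (inv_injective (Prod.mk.inj h2).2)⟩

theorem isOpenEmbedding_chart (a : Om1) : IsOpenEmbedding (chart a : Plane × ℝ → S.Space) := by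
  refine .of_continuous_injective_isOpenMap ((continuous_iff.1 continuous_id).2 a)
    (fun x y h => (chart_eq_chart h).2) fun V hV => isOpen_iff.2 ⟨?_, fun b => ?_⟩
  · let g : {x : Plane × ℝ // x.2 ≠ 0} → Plane × ℝ := fun x => (x.1.1, x.1.2⁻¹)
    have hg : Continuous g :=
      (by fun_prop : Continuous fun x : {x : Plane × ℝ // x.2 ≠ 0} => x.1.1).prodMk
        ((by fun_prop : Continuous fun x : {x : Plane × ℝ // x.2 ≠ 0} => x.1.2).inv₀ fun x => x.2)
    have : (inl : ↥S.Pierced → S.Space) ⁻¹' (chart a '' V) =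
        Subtype.val ⁻¹' (S.tubeMap a '' (Subtype.val '' (g ⁻¹' V))) := by
      ext p
      constructor
      · rintro ⟨x, hx, h⟩
        by_cases hx0 : x.2 = 0
        · rw [chart, if_pos hx0] at h
          exact absurd h.symm inl_ne_inr
        · rw [chart_of_ne hx0] at h
          refine ⟨_, ⟨⟨(x.1, x.2⁻¹), inv_ne_zero hx0⟩, ?_, rfl⟩,
            congrArg Subtype.val (inl_injective h)⟩
          show (x.1, x.2⁻¹⁻¹) ∈ V
          rwa [inv_inv]
      · rintro ⟨_, ⟨x, hx, rfl⟩, h⟩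
        exact ⟨_, hx, (chart_inv x.2 a _).trans (congrArg inl (Subtype.ext h))⟩
    rw [this]
    refine ((S.isOpenEmbedding_tube a).isOpenMap _ ?_).preimage continuous_subtype_val
    exact (isOpen_ne.preimage continuous_snd).isOpenEmbedding_subtypeVal.isOpenMap _
      (hV.preimage hg)
  · by_cases hab : a = b
    · subst hab
      rwa [preimage_image_eq _ fun x y h => (chart_eq_chart h).2]
    · convert isOpen_empty
      refine eq_empty_of_forall_notMem fun x => ?_
      rintro ⟨y, _, h⟩
      exact hab (chart_eq_chart h).1

theorem disjoint_range_chart {a b : Om1} (h : a ≠ b) :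
    Disjoint (range (chart a : Plane × ℝ → S.Space)) (range (chart b)) := by
  refine disjoint_left.2 ?_
  rintro _ ⟨x, rfl⟩ ⟨y, hy⟩
  exact h (chart_eq_chart hy).1.symm

theorem inr_mem_range_chart (a : Om1) (p : Plane) : (inr a p : S.Space) ∈ range (chart a) :=
  ⟨(p, 0), chart_zero a p⟩

instance [T2Space N] : T2Space S.Space := by
  have key : ∀ (p : ↥S.Pierced) (a : Om1) (q : Plane), ∃ u v : Set S.Space, IsOpen u ∧ IsOpen v ∧
      inl p ∈ u ∧ inr a q ∈ v ∧ Disjoint u v := by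
    intro p a q
    have hc : 0 < |p.1.2| + 1 := by positivity
    -- The chart inverts heights, so near the plane `|t|` is larger than `|p.1.2| + 1`.
    refine ⟨inl '' {r | |r.1.2| < |p.1.2| + 1}, chart a '' {x | |x.2| < (|p.1.2| + 1)⁻¹},
      isOpenEmbedding_inl.isOpenMap _ (isOpen_lt (by fun_prop) continuous_const),
      (isOpenEmbedding_chart a).isOpenMap _ (isOpen_lt (by fun_prop) continuous_const),
      ⟨p, show |p.1.2| < |p.1.2| + 1 from lt_add_one _, rfl⟩, ⟨(q, 0), by simpa using hc, chart_zero a q⟩, disjoint_left.2 ?_⟩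
    rintro _ ⟨r, hr, rfl⟩ ⟨x, hx, h⟩
    by_cases hx0 : x.2 = 0
    · rw [chart, if_pos hx0] at h
      exact inl_ne_inr h.symm
    · rw [chart_of_ne hx0] at h
      rw [← inl_injective h] at hr
      have h1 : |x.2⁻¹| < |p.1.2| + 1 := hr
      rw [abs_inv] at h1
      exact lt_asymm h1 ((lt_inv_comm₀ hc (abs_pos.2 hx0)).2 hx)
  refine ⟨fun x y hxy => ?_⟩
  obtain ⟨p, rfl⟩ | ⟨a, p, rfl⟩ := eq_inl_or_inr x <;>
    obtain ⟨q, rfl⟩ | ⟨b, q, rfl⟩ := eq_inl_or_inr y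
  · obtain ⟨u, v, hu, hv, hpu, hqv, hd⟩ := t2_separation (fun h => hxy (congrArg inl h) : p ≠ q)
    exact ⟨_, _, isOpenEmbedding_inl.isOpenMap u hu, isOpenEmbedding_inl.isOpenMap v hv,
      ⟨p, hpu, rfl⟩, ⟨q, hqv, rfl⟩, disjoint_image_of_injective inl_injective hd⟩
  · exact key p b q
  · obtain ⟨u, v, hu, hv, h1, h2, hd⟩ := key q a p
    exact ⟨v, u, hv, hu, h2, h1, hd.symm⟩
  · by_cases hab : a = b
    · subst hab
      have hpq : p ≠ q := fun h => hxy (h ▸ rfl)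
      obtain ⟨u, v, hu, hv, hpu, hqv, hd⟩ := t2_separation
        (fun h => hpq (congrArg Prod.fst h) : (p, (0 : ℝ)) ≠ (q, 0))
      have hc := isOpenEmbedding_chart (S := S) a
      exact ⟨_, _, hc.isOpenMap u hu, hc.isOpenMap v hv, ⟨_, hpu, chart_zero a p⟩,
        ⟨_, hqv, chart_zero a q⟩, disjoint_image_of_injective hc.injective hd⟩
    · exact ⟨_, _, (isOpenEmbedding_chart a).isOpen_range, (isOpenEmbedding_chart b).isOpen_range,
        inr_mem_range_chart a p, inr_mem_range_chart b q, disjoint_range_chart hab⟩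

theorem locEuclidean (hN : LocEuclidean 2 N) : LocEuclidean 3 S.Space := by
  intro x
  obtain ⟨p, rfl⟩ | ⟨a, p, rfl⟩ := eq_inl_or_inr x
  · obtain ⟨e, he, q, rfl⟩ := (hN.prod locEuclidean_real).of_isOpenEmbedding
      S.isOpen_pierced.isOpenEmbedding_subtypeVal p
    exact ⟨inl ∘ e, isOpenEmbedding_inl.comp he, q, rfl⟩
  · obtain ⟨e, he, q, hq⟩ :=
      ((locEuclidean_of_finrank_eq (by simp) : LocEuclidean 2 Plane).prod locEuclidean_real) (p, 0)
    exact ⟨chart a ∘ e, (isOpenEmbedding_chart a).comp he, q, by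
      rw [Function.comp_apply, hq, chart_zero]⟩

/-- The inclusion of the gated product. -/
def gatedMap (p : ↥(Gated S.O)) : S.Space := inl ⟨p.1, Or.inl p.2⟩

theorem isOpenEmbedding_gatedMap : IsOpenEmbedding (gatedMap : ↥(Gated S.O) → S.Space) := by
  refine isOpenEmbedding_inl.comp (IsOpenEmbedding.of_comp _
    S.isOpen_pierced.isOpenEmbedding_subtypeVal ?_)
  exact (isOpen_gated S.isOpen_O).isOpenEmbedding_subtypeVal

theorem dense_range_gatedMap : Dense (range (gatedMap : ↥(Gated S.O) → S.Space)) := by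
  have hinl : range inl ⊆ closure (range (gatedMap : ↥(Gated S.O) → S.Space)) := by
    rintro _ ⟨p, rfl⟩
    refine mem_closure_iff.2 fun U hU hpU => ?_
    have hV := S.isOpen_pierced.isOpenEmbedding_subtypeVal.isOpenMap _
      (hU.preimage isOpenEmbedding_inl.continuous)
    obtain ⟨_, ⟨q, hq, rfl⟩, hqG⟩ := dense_gated.inter_open_nonempty _ hV ⟨p.1, p, hpU, rfl⟩
    exact ⟨inl q, hq, ⟨q.1, hqG⟩, rfl⟩
  intro x
  obtain ⟨p, rfl⟩ | ⟨a, p, rfl⟩ := eq_inl_or_inr x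
  · exact hinl (mem_range_self p)
  · refine closure_minimal hinl isClosed_closure (mem_closure_iff.2 fun U hU hpU => ?_)
    have hd : Dense {x : Plane × ℝ | x.2 ≠ 0} :=
      (dense_compl_singleton (0 : ℝ)).preimage isOpenMap_snd
    obtain ⟨x, hx, hx0⟩ := hd.inter_open_nonempty _ ((isOpen_iff.1 hU).2 a)
      ⟨(p, 0), by rwa [mem_preimage, chart_zero]⟩
    exact ⟨_, hx, _, (chart_of_ne hx0 a).symm⟩

theorem connectedSpace [ConnectedSpace N] : ConnectedSpace S.Space := by
  have := isConnected_iff_connectedSpace.1 (isConnected_gated S.isConnected_O)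
  have hp : PreconnectedSpace S.Space :=
    DenseRange.preconnectedSpace dense_range_gatedMap isOpenEmbedding_gatedMap.continuous
  exact { toNonempty := ⟨gatedMap (Classical.arbitrary _)⟩ }

end Space

end TubeSystem

end

/-! ### Cells of the glued space, and homotopies into the long ray -/

noncomputable section

open Om1

namespace TubeSystem.Space

variable {N : Type} [TopologicalSpace N] {S : TubeSystem N}

/-- Everything over a set `A` of the base, together with the planes with index in `B`. -/
def cyl (A : Set N) (B : Set Om1) : Set S.Space :=
  inl '' (Subtype.val ⁻¹' (Prod.fst ⁻¹' A)) ∪ ⋃ b ∈ B, range (inr b)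

theorem inl_mem_cyl {A : Set N} {B : Set Om1} {p : ↥S.Pierced} :
    (inl p : S.Space) ∈ cyl A B ↔ p.1.1 ∈ A := by
  constructor
  · rintro (⟨q, hq, h⟩ | h)
    · exact inl_injective h ▸ hq
    · obtain ⟨b, -, q, hq⟩ := mem_iUnion₂.1 h
      exact absurd hq.symm inl_ne_inr
  · exact fun h => Or.inl ⟨p, h, rfl⟩

theorem inr_mem_cyl {A : Set N} {B : Set Om1} {a : Om1} {p : Plane} :
    (inr a p : S.Space) ∈ cyl A B ↔ a ∈ B := by
  constructor
  · rintro (⟨q, _, h⟩ | h)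
    · exact absurd h inl_ne_inr
    · obtain ⟨b, hb, q, hq⟩ := mem_iUnion₂.1 h
      rwa [(inr_eq_iff.1 hq).1] at hb
  · exact fun h => Or.inr (mem_iUnion₂.2 ⟨a, h, p, rfl⟩)

theorem isOpen_cyl {A : Set N} (hA : IsOpen A) {B : Set Om1}
    (h : ∀ b x, S.tube b x ∈ A ↔ b ∈ B) : IsOpen (cyl A B : Set S.Space) := by
  refine isOpen_iff.2 ⟨?_, fun a => ?_⟩
  · have : inl ⁻¹' (cyl A B : Set S.Space) = Subtype.val ⁻¹' (Prod.fst ⁻¹' A) :=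
      Set.ext fun p => inl_mem_cyl
    rw [this]
    exact (hA.preimage continuous_fst).preimage continuous_subtype_val
  · have : chart a ⁻¹' (cyl A B : Set S.Space) = {_x | a ∈ B} := by
      ext x
      rw [mem_preimage]
      by_cases hx : x.2 = 0
      · rw [chart, if_pos hx]
        exact inr_mem_cyl
      · rw [chart_of_ne hx, inl_mem_cyl]
        exact h a _
    rw [this]
    exact isOpen_const

/-- No ordinal lies strictly between `level b` and its successor, so each tube is wholly below or
wholly above the level `a`. This lets a stage contain either all or nothing of a tube and its plane.
-/
theorem s_tube_lt_pt_iff (a b : Om1) (x : Plane × ℝ) :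
    S.s (S.tube b x) < LongRay.pt a ↔ (S.level b).next ≤ a :=
  ⟨fun h => next_le (LongRay.pt_lt_iff.1 ((S.lt_s_tube b x).trans h)),
    fun h => (S.s_tube_lt b x).trans_le (LongRay.pt_le_iff.2 h)⟩

theorem s_tube_le_pt_iff (a b : Om1) (x : Plane × ℝ) :
    S.s (S.tube b x) ≤ LongRay.pt a ↔ (S.level b).next ≤ a :=
  ⟨fun h => next_le (LongRay.pt_lt_iff.1 ((S.lt_s_tube b x).trans_le h)),
    fun h => ((s_tube_lt_pt_iff a b x).2 h).le⟩

theorem isOpen_cyl_lt (a : Om1) :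
    IsOpen (cyl {y | S.s y < LongRay.pt a} {b | (S.level b).next ≤ a} : Set S.Space) :=
  isOpen_cyl (isOpen_Iio.preimage S.continuous_s) fun b x => s_tube_lt_pt_iff a b x

theorem isClosed_cyl_le (a : Om1) :
    IsClosed (cyl {y | S.s y ≤ LongRay.pt a} {b | (S.level b).next ≤ a} : Set S.Space) := by
  refine ⟨?_⟩
  have : (cyl {y | S.s y ≤ LongRay.pt a} {b | (S.level b).next ≤ a} : Set S.Space)ᶜ =
      cyl {y | S.s y ≤ LongRay.pt a}ᶜ {b | (S.level b).next ≤ a}ᶜ := by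
    ext x
    rw [mem_compl_iff]
    obtain ⟨p, rfl⟩ | ⟨a, p, rfl⟩ := eq_inl_or_inr x
    · rw [inl_mem_cyl, inl_mem_cyl, mem_compl_iff]
    · rw [inr_mem_cyl, inr_mem_cyl, mem_compl_iff]
  rw [this]
  exact isOpen_cyl (isClosed_Iic.preimage S.continuous_s).isOpen_compl
    fun b x => not_congr (s_tube_le_pt_iff a b x)

theorem cyl_mono {A A' : Set N} {B B' : Set Om1} (hA : A ⊆ A') (hB : B ⊆ B') :
    (cyl A B : Set S.Space) ⊆ cyl A' B' :=
  union_subset_union (image_mono (preimage_mono (preimage_mono hA)))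
    (biUnion_subset_biUnion_left hB)

theorem isLindelof_cyl (hN : LocEuclidean 2 N) {A : Set N} (hA : IsLindelof A) {B : Set Om1}
    (hB : B.Countable) : IsLindelof (cyl A B : Set S.Space) := by
  refine ((hN.isLindelof_fst_preimage hA _).image isOpenEmbedding_inl.continuous).union
    (Countable.isLindelof_biUnion hB fun b _ => ?_)
  have : range (inr b : Plane → S.Space) = range fun p => chart b (p, 0) :=
    congrArg range (funext fun p => (chart_zero b p).symm)
  rw [this]
  exact isLindelof_range ((isOpenEmbedding_chart b).continuous.comp (by fun_prop))

theorem countable_next_level_le (a : Om1) : {b | (S.level b).next ≤ a}.Countable :=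
  (countable_Iic a).mono fun _ hb => S.level_strictMono.le_apply.trans ((lt_next _).le.trans hb)

/-- The Type I structure of the space. -/
def typeI (hN : LocEuclidean 2 N) (S : TubeSystem N) : TypeI S.Space :=
  TypeI.ofStages
    (fun a => cyl {y | S.s y < LongRay.pt a} {b | (S.level b).next ≤ a})
    (fun a => cyl {y | S.s y ≤ LongRay.pt a} {b | (S.level b).next ≤ a})
    isOpen_cyl_lt
    (fun a => isLindelof_cyl hN (S.isLindelof_s a) (countable_next_level_le a))
    (fun a => closure_minimal
      (cyl_mono (fun y (hy : S.s y < LongRay.pt a) => show S.s y ≤ LongRay.pt a from hy.le) subset_rfl)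
      (isClosed_cyl_le a))
    (fun a b h => cyl_mono (fun y (hy : S.s y ≤ LongRay.pt a) =>
      show S.s y < LongRay.pt b from hy.trans_lt (LongRay.pt_lt_iff.2 h))
      fun c (hc : (S.level c).next ≤ a) => show (S.level c).next ≤ b from hc.trans h.le)
    (fun x => by
      obtain ⟨p, rfl⟩ | ⟨a, p, rfl⟩ := eq_inl_or_inr x
      · obtain ⟨a, ha⟩ := LongRay.exists_lt_pt (S.s p.1.1)
        exact ⟨a, inl_mem_cyl.2 ha⟩
      · exact ⟨(S.level a).next, inr_mem_cyl.2 (le_refl (S.level a).next)⟩)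
    (fun a => ⟨inr a 0, fun h => (S.level_strictMono.le_apply (x := a)).not_gt
      ((lt_next _).trans_le (inr_mem_cyl.1 h))⟩)

/-- The part of the space over the layer containing a tube. -/
def cell (a : Om1) : Set S.Space :=
  cyl (S.s ⁻¹' Ioo (LongRay.pt (S.level a)) (LongRay.pt (S.level a).next)) {a}

theorem isOpen_cell (a : Om1) : IsOpen (cell a : Set S.Space) := by
  refine isOpen_cyl (isOpen_Ioo.preimage S.continuous_s) fun b x => ⟨fun h => ?_, ?_⟩
  · have h1 := LongRay.pt_lt_iff.1 (h.1.trans (S.s_tube_lt b x))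
    have h2 := LongRay.pt_lt_iff.1 ((S.lt_s_tube b x).trans h.2)
    rcases lt_trichotomy a b with hab | hab | hab
    · exact absurd h2 (next_le (S.level_strictMono hab)).not_gt
    · exact hab.symm
    · exact absurd h1 (next_le (S.level_strictMono hab)).not_gt
  · rintro rfl
    exact ⟨S.lt_s_tube b x, S.s_tube_lt b x⟩

theorem inr_mem_cell {a b : Om1} {p : Plane} : (inr a p : S.Space) ∈ cell b ↔ a = b := inr_mem_cyl

theorem eq_of_mem_cell {a b : Om1} {x : S.Space} (ha : x ∈ cell a) (hb : x ∈ cell b) : a = b := by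
  obtain ⟨p, rfl⟩ | ⟨c, p, rfl⟩ := eq_inl_or_inr x
  · have ha := inl_mem_cyl.1 ha
    have hb := inl_mem_cyl.1 hb
    rcases lt_trichotomy a b with hab | hab | hab
    · exact absurd (hb.1.trans ha.2) (LongRay.pt_le_iff.2 (next_le (S.level_strictMono hab))).not_gt
    · exact hab
    · exact absurd (ha.1.trans hb.2) (LongRay.pt_le_iff.2 (next_le (S.level_strictMono hab))).not_gt
  · exact (inr_mem_cell.1 ha).symm.trans (inr_mem_cell.1 hb)

theorem exists_mem_cell {x : S.Space} (hx : x ∉ range (gatedMap : ↥(Gated S.O) → S.Space)) :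
    ∃ a, x ∈ cell a := by
  obtain ⟨⟨p, hp | hp⟩, rfl⟩ | ⟨a, p, rfl⟩ := eq_inl_or_inr x
  · exact absurd ⟨⟨p, hp⟩, rfl⟩ hx
  · obtain ⟨a, x, rfl⟩ := mem_iUnion.1 hp
    exact ⟨a, inl_mem_cyl.2 ⟨S.lt_s_tube a x, S.s_tube_lt a x⟩⟩
  · exact ⟨a, inr_mem_cell.2 rfl⟩

variable (hN : LocEuclidean 2 N)

theorem stage_typeI (a : Om1) : (typeI hN S).stage a =
    cyl {y | S.s y < LongRay.pt a} {b | (S.level b).next ≤ a} := TypeI.stage_ofStages a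

theorem cell_subset_stage {a b : Om1} (h : (S.level b).next ≤ a) :
    cell b ⊆ (typeI hN S).stage a := by
  rw [stage_typeI]
  intro x hx
  obtain ⟨p, rfl⟩ | ⟨c, p, rfl⟩ := eq_inl_or_inr x
  · exact inl_mem_cyl.2 ((inl_mem_cyl.1 hx).2.trans_le (LongRay.pt_le_iff.2 h))
  · have : c = b := inr_mem_cell.1 hx
    exact inr_mem_cyl.2 (this ▸ h)

/-- The gated product is open and misses `E`; all other points lie in the pairwise disjoint open
cells. -/
theorem isClubDiscrete_of_subsingleton [T2Space N] {E : Set S.Space}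
    (hE : (typeI hN S).Unbounded E) (h : E ⊆ (range (gatedMap : ↥(Gated S.O) → S.Space))ᶜ)
    (h' : ∀ a, (E ∩ cell a).Subsingleton) : (typeI hN S).IsClubDiscrete E := by
  refine TypeI.isClubDiscrete_of_locally hE fun x => ?_
  by_cases hx : x ∈ range (gatedMap : ↥(Gated S.O) → S.Space)
  · exact ⟨_, isOpenEmbedding_gatedMap.isOpen_range.mem_nhds hx, fun y hy => absurd hy.1 (h hy.2)⟩
  · obtain ⟨a, ha⟩ := exists_mem_cell hx
    refine ⟨cell a ∩ ((E ∩ cell a) \ {x})ᶜ, Filter.inter_mem ((isOpen_cell a).mem_nhds ha)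
      (((h' a).anti sdiff_subset).finite.isClosed.isOpen_compl.mem_nhds fun hh => hh.2 rfl), ?_⟩
    rintro y ⟨⟨hy, hy'⟩, hyE⟩
    by_contra hyx
    exact hy' ⟨⟨hyE, hy⟩, hyx⟩

/-- Pick one point of `E` outside the gated product in each cell where there is one. -/
theorem exists_isClubDiscrete_subset [T2Space N] {E : Set S.Space}
    (hE : (typeI hN S).Unbounded (E \ range (gatedMap : ↥(Gated S.O) → S.Space))) :
    ∃ E' ⊆ E, (typeI hN S).IsClubDiscrete E' := by
  classical
  let B : Set Om1 := {b | ((E \ range (gatedMap : ↥(Gated S.O) → S.Space)) ∩ cell b).Nonempty}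
  choose f hf using fun b : B => b.2
  refine ⟨range f, ?_, isClubDiscrete_of_subsingleton hN ?_ ?_ fun a => ?_⟩
  · rintro _ ⟨b, rfl⟩
    exact (hf b).1.1
  · rw [TypeI.unbounded_iff] at hE ⊢
    intro a
    obtain ⟨x, hx, hxa⟩ := hE a.next
    obtain ⟨b, hb⟩ := exists_mem_cell hx.2
    refine ⟨_, mem_range_self ⟨b, x, hx, hb⟩, fun h => hxa (cell_subset_stage hN ?_ hb)⟩
    rw [stage_typeI] at h
    have hfb := (hf ⟨b, x, hx, hb⟩).2
    obtain ⟨p, hp⟩ | ⟨c, p, hp⟩ := eq_inl_or_inr (f ⟨b, x, hx, hb⟩)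
    · rw [hp] at h hfb
      have := LongRay.pt_lt_iff.1 ((inl_mem_cyl.1 hfb).1.trans (inl_mem_cyl.1 h))
      exact (next_le this).trans (lt_next _).le
    · rw [hp] at h hfb
      obtain rfl : c = b := inr_mem_cell.1 hfb
      exact (show (S.level c).next ≤ a from inr_mem_cyl.1 h).trans (lt_next _).le
  · rintro _ ⟨b, rfl⟩
    exact (hf b).1.2
  · rintro _ ⟨⟨b, rfl⟩, hb⟩ _ ⟨⟨c, rfl⟩, hc⟩
    have h1 := eq_of_mem_cell hb (hf b).2
    have h2 := eq_of_mem_cell hc (hf c).2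
    rw [Subtype.ext (h1.symm.trans h2)]

theorem isClubDiscrete_centres [T2Space N] :
    (typeI hN S).IsClubDiscrete (range fun a : Om1 => (inr a 0 : S.Space)) := by
  refine isClubDiscrete_of_subsingleton hN ?_ ?_ ?_
  · refine (TypeI.unbounded_iff _).2 fun a => ⟨_, mem_range_self a, fun h => ?_⟩
    rw [stage_typeI, inr_mem_cyl] at h
    exact (S.level_strictMono.le_apply (x := a)).not_gt ((lt_next _).trans_le h)
  · rintro _ ⟨a, rfl⟩ ⟨p, hp⟩
    exact inl_ne_inr hp
  · rintro a _ ⟨⟨b, rfl⟩, hb⟩ _ ⟨⟨c, rfl⟩, hc⟩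
    have h1 : b = a := inr_mem_cell.1 hb
    have h2 : c = a := inr_mem_cell.1 hc
    rw [h1, h2]

end TubeSystem.Space

/-- A homotopy from an `ω`-bounded space into the long ray moves bounded sets to bounded sets. -/
theorem OmegaBounded.exists_bound {N : Type} [TopologicalSpace N] [T2Space N]
    (hN : OmegaBounded N) {c d : ℝ} {Φ : N × Icc c d → LongRay} (hΦ : Continuous Φ) (a : Om1) :
    ∃ b, ∀ y t t', Φ (y, t) ≤ LongRay.pt a → Φ (y, t') < LongRay.pt b := by
  -- For each single `ξ` a short enough time moves values at most `ξ` only below `ξ.next`: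
  -- counterexamples for all `n` would accumulate, by `ω`-boundedness, at one with equal times.
  have h1 : ∀ ξ : Om1, ∃ n : ℕ, ∀ y t t', |t.1 - t'.1| ≤ 1 / (n + 1 : ℝ) →
      Φ (y, t) ≤ LongRay.pt ξ → Φ (y, t') < LongRay.pt ξ.next := by
    intro ξ
    by_contra! hcon
    let K : ℕ → Set (N × (Icc c d × Icc c d)) := fun n =>
      {p | |p.2.1.1 - p.2.2.1| ≤ 1 / (n + 1 : ℝ) ∧ Φ (p.1, p.2.1) ≤ LongRay.pt ξ ∧
        LongRay.pt ξ.next ≤ Φ (p.1, p.2.2)}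
    have hK : ∀ n, IsClosed (K n) := fun n => by
      have c1 : Continuous fun p : N × (Icc c d × Icc c d) => |p.2.1.1 - p.2.2.1| := by fun_prop
      have c2 : Continuous fun p : N × (Icc c d × Icc c d) => Φ (p.1, p.2.1) := by fun_prop
      have c3 : Continuous fun p : N × (Icc c d × Icc c d) => Φ (p.1, p.2.2) := by fun_prop
      exact (isClosed_le c1 continuous_const).inter
        ((isClosed_le c2 continuous_const).inter (isClosed_le continuous_const c3))
    have hne : ∀ n, ∃ p, p ∈ K n := fun n => by
      obtain ⟨y, t, t', h1, h2, h3⟩ := hcon n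
      exact ⟨(y, t, t'), h1, h2, h3⟩
    choose p hp using hne
    have hanti : ∀ {m n : ℕ}, m ≤ n → K n ⊆ K m := fun {m n} hmn q hq =>
      ⟨hq.1.trans (one_div_le_one_div_of_le (by positivity) (by
        have : (m : ℝ) ≤ n := by exact_mod_cast hmn
        linarith)), hq.2⟩
    have hcomp := (OmegaBounded.prod_compact (K := Icc c d × Icc c d) hN) (range p)
      (countable_range p)
    obtain ⟨q, hq⟩ := IsCompact.nonempty_iInter_of_sequence_nonempty_isCompact_isClosed
      (fun n => closure (range p) ∩ K n)
      (fun n => inter_subset_inter_right _ (hanti n.le_succ))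
      (fun n => ⟨p n, subset_closure (mem_range_self n), hp n⟩)
      (hcomp.inter_right (hK 0)) (fun n => isClosed_closure.inter (hK n))
    have hq' : ∀ n, q ∈ K n := fun n => (mem_iInter.1 hq n).2
    have heq : q.2.1 = q.2.2 := by
      refine Subtype.ext (sub_eq_zero.1 (abs_nonpos_iff.1 (le_of_forall_pos_lt_add fun ε hε => ?_)))
      obtain ⟨n, hn⟩ := exists_nat_one_div_lt hε
      rw [zero_add]
      exact (hq' n).1.trans_lt hn
    have := (hq' 0).2.2.trans (heq ▸ (hq' 0).2.1)
    exact (lt_next ξ).not_ge (LongRay.pt_le_iff.1 this)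
  -- One time step works for uncountably many `ξ`, so above any bound there is another such `ξ`, and
  -- finitely many steps traverse the interval.
  obtain ⟨n, hn⟩ := exists_uncountable_fiber uncountable (fun ξ (n : ℕ) => ∀ y t t',
    |t.1 - t'.1| ≤ 1 / (n + 1 : ℝ) → Φ (y, t) ≤ LongRay.pt ξ → Φ (y, t') < LongRay.pt ξ.next)
    fun ξ _ => h1 ξ
  have h2 : ∀ k : ℕ, ∃ b, ∀ y t t', |t.1 - t'.1| ≤ k / (n + 1 : ℝ) → Φ (y, t) ≤ LongRay.pt a →
      Φ (y, t') < LongRay.pt b := by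
    intro k
    induction k with
    | zero =>
      refine ⟨a.next, fun y t t' h h' => ?_⟩
      rw [Nat.cast_zero, zero_div] at h
      rw [← Subtype.ext (sub_eq_zero.1 (abs_nonpos_iff.1 h))]
      exact h'.trans_lt (LongRay.pt_lt_iff.2 (lt_next a))
    | succ k ih =>
      obtain ⟨b, hb⟩ := ih
      obtain ⟨ξ, hξ, hbξ⟩ := unbounded_of_uncountable hn b
      refine ⟨ξ.next, fun y t t' h h' => ?_⟩
      have hk : (0 : ℝ) < k + 1 := by positivity
      have hn' : (0 : ℝ) < n + 1 := by positivity
      rw [Nat.cast_succ] at h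
      -- The intermediate time is `k` steps away from `t` and one step away from `t'`.
      have hconv : (1 / (k + 1 : ℝ)) * t.1 + (k / (k + 1 : ℝ)) * t'.1 ∈ Icc c d :=
        (convex_Icc c d) t.2 t'.2 (by positivity : (0 : ℝ) ≤ 1 / (k + 1))
          (by positivity : (0 : ℝ) ≤ k / (k + 1)) (by field_simp; ring)
      have e1 : t.1 - ((1 / (k + 1 : ℝ)) * t.1 + (k / (k + 1 : ℝ)) * t'.1) =
          (k / (k + 1 : ℝ)) * (t.1 - t'.1) := by
        field_simp
        ring
      have e2 : ((1 / (k + 1 : ℝ)) * t.1 + (k / (k + 1 : ℝ)) * t'.1) - t'.1 =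
          (1 / (k + 1 : ℝ)) * (t.1 - t'.1) := by
        field_simp
        ring
      refine hξ.2 y ⟨_, hconv⟩ t' ?_ ((hb y t ⟨_, hconv⟩ ?_ h').le.trans
        (LongRay.pt_le_iff.2 hbξ.le))
      · dsimp only
        rw [e2, abs_mul, abs_of_nonneg (by positivity)]
        calc _ ≤ (1 / (k + 1 : ℝ)) * ((k + 1) / (n + 1)) := by gcongr
          _ = _ := by field_simp
      · dsimp only
        rw [e1, abs_mul, abs_of_nonneg (by positivity)]
        calc _ ≤ (k / (k + 1 : ℝ)) * ((k + 1) / (n + 1)) := by gcongr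
          _ = _ := by field_simp
  obtain ⟨k, hk⟩ := exists_nat_ge ((d - c) * (n + 1 : ℝ))
  obtain ⟨b, hb⟩ := h2 k
  refine ⟨b, fun y t t' => hb y t t' ?_⟩
  rw [le_div_iff₀ (by positivity)]
  refine le_trans (mul_le_mul_of_nonneg_right ?_ (by positivity)) hk
  exact abs_sub_le_iff.2 ⟨by linarith [t.2.2, t'.2.1], by linarith [t'.2.2, t.2.1]⟩

end

/-! ### The direction formed by the centres of the planes -/

noncomputable section

open Om1

namespace TubeSystem.Space

variable {N : Type} [TopologicalSpace N] {S : TubeSystem N}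

theorem exists_nat_forall_tube_mem {f : S.Space → LongRay} (hf : Continuous f) {V : Set LongRay}
    (hV : IsOpen V) {a : Om1} (ha : f (inr a 0) ∈ V) :
    ∃ k : ℕ, ∀ t : ℝ, k ≤ t → f (inl ⟨S.tubeMap a (0, t), S.tubeMap_mem _ _⟩) ∈ V := by
  have h1 : Continuous fun τ : ℝ => f (chart a (0, τ)) :=
    hf.comp ((isOpenEmbedding_chart a).continuous.comp (by fun_prop))
  have h2 : ∀ᶠ τ : ℝ in 𝓝 0, f (chart a (0, τ)) ∈ V :=
    h1.continuousAt.eventually (hV.mem_nhds (show f (chart a (0, 0)) ∈ V by rwa [chart_zero]))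
  have h3 := tendsto_inv_atTop_zero.eventually h2
  obtain ⟨k, hk⟩ := Filter.eventually_atTop.1 h3
  obtain ⟨n, hn⟩ := exists_nat_ge (max k 1)
  refine ⟨n, fun t ht => ?_⟩
  have h4 := hk t ((le_max_left _ _).trans (hn.trans ht))
  have ht0 : 0 < t := zero_lt_one.trans_le ((le_max_right _ _).trans (hn.trans ht))
  rwa [chart_inv ht0.ne'] at h4

/-- If the tubes sweep out circles, the centres of the planes at their ends form a direction. -/
theorem isDirection_centres [T2Space N] (hN : LocEuclidean 2 N) (hN' : OmegaBounded N)
    {v : Om1 → LongRay} (hv : ∀ a, LongRay.pt (S.level a) < v a ∧ v a < LongRay.pt (S.level a).next)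
    (hsweep : ∀ a (m : ℕ) y, S.s y = v a →
      ∃ t ∈ Icc (m + 1 / 3 : ℝ) (m + 2 / 3), S.tube a (0, t) = y)
    (hlim : ∀ d, IsLim d → ∃ z, ∀ V ∈ 𝓝 z, ∃ b < d, ∀ w, LongRay.pt b < w → w < LongRay.pt d →
      ∃ y ∈ V, S.s y = w) :
    (typeI hN S).IsDirection (range fun a : Om1 => (inr a 0 : S.Space)) := by
  refine TypeI.isDirection_of_rigid (isClubDiscrete_centres hN).1 fun f hf a ha => ?_
  have hmem : ∀ (m : ℕ) (y : N) (t : Icc (m + 1 / 3 : ℝ) (m + 2 / 3)), (y, t.1) ∈ S.Pierced :=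
    fun m y t => Or.inl (mem_gated_of_mem_Ioo (i := m) (by
      constructor <;> push_cast <;> linarith [t.2.1, t.2.2]))
  let Φ : ∀ m : ℕ, N × Icc (m + 1 / 3 : ℝ) (m + 2 / 3) → LongRay := fun m p =>
    f (inl ⟨(p.1, p.2.1), hmem m p.1 p.2⟩)
  have hΦ : ∀ m, Continuous (Φ m) := fun m =>
    hf.comp (isOpenEmbedding_inl.continuous.comp (by fun_prop))
  have hbd : ∀ a, ∃ b, ∀ m y t t', Φ m (y, t) ≤ LongRay.pt a → Φ m (y, t') < LongRay.pt b := by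
    intro a
    choose b hb using fun m => hN'.exists_bound (hΦ m) a
    obtain ⟨c, hc⟩ := exists_gt_range b
    exact ⟨c, fun m y t t' h => (hb m y t t' h).trans (LongRay.pt_lt_iff.2 (hc m))⟩
  -- A value at most `a` at one time of the middle third of any slab forces values at most `a₁`
  -- throughout it, and a value above `b` forces values above `a₁.next`. These bounds must not
  -- depend on the slab, which is chosen only after `k` and `l` are known.
  obtain ⟨a₁, h₁⟩ := hbd a
  obtain ⟨b, hb₁⟩ := hbd a₁.next
  refine ⟨b, ?_⟩
  by_contra hb
  have key : ∀ V : Set LongRay, IsOpen V →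
      ¬ {x | x ∈ (range fun a : Om1 => (inr a 0 : S.Space)) ∧ f x ∈ V}.Countable →
      ∃ A : Set Om1, ∃ k : ℕ, (∀ c, ∃ d ∈ A, c < d) ∧
        ∀ c ∈ A, ∀ t : ℝ, k ≤ t → f (inl ⟨S.tubeMap c (0, t), S.tubeMap_mem _ _⟩) ∈ V := by
    intro V hV hVc
    have hu : ¬ {i | f (inr i 0) ∈ V}.Countable := by
      refine fun h => hVc ((h.image fun a => inr a 0).mono ?_)
      rintro _ ⟨⟨i, rfl⟩, h⟩
      exact ⟨i, h, rfl⟩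
    obtain ⟨k, hk⟩ := exists_uncountable_fiber hu (fun i (k : ℕ) => ∀ t : ℝ, k ≤ t →
      f (inl ⟨S.tubeMap i (0, t), S.tubeMap_mem _ _⟩) ∈ V)
      fun i hi => exists_nat_forall_tube_mem hf hV hi
    exact ⟨_, k, unbounded_of_uncountable hk, fun c hc => hc.2⟩
  obtain ⟨A, k, hA, hA'⟩ := key _ isOpen_Iio ha
  obtain ⟨B, l, hB, hB'⟩ := key _ isOpen_Ioi hb
  obtain ⟨G, hG⟩ := exists_closure_limit hA
  obtain ⟨G', hG'⟩ := exists_closure_limit hB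
  obtain ⟨H, hH, hH'⟩ := exists_closure_subset_two G G'
  obtain ⟨K, hK, hK'⟩ := exists_closure_subset_two H fun a => (S.level a).next
  obtain ⟨d, hd, -⟩ := exists_mem_closure K a
  obtain ⟨z, hz⟩ := hlim d hd.1
  have hmid : ∀ m : ℕ, (m + 1 / 2 : ℝ) ∈ Icc (m + 1 / 3 : ℝ) (m + 2 / 3) := fun m => by
    constructor <;> linarith
  let u : N → LongRay := fun y => Φ (max k l) (y, ⟨_, hmid _⟩)
  have hu : Continuous u := (hΦ _).comp (by fun_prop)
  -- The circles at the levels `v c`, for `c` in `C`, accumulate at `z`: every neighbourhood of `z`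
  -- contains points at all levels in a final segment below `d`.
  have hcl : ∀ C : Set Om1, (∀ b < d, ∃ a ∈ C, b < a ∧ a < d) →
      z ∈ closure {y | ∃ c ∈ C, S.s y = v c} := by
    intro C hC
    refine mem_closure_iff_nhds.2 fun V hV => ?_
    obtain ⟨b, hb, hbV⟩ := hz V hV
    obtain ⟨c, hc, hbc, hcd⟩ := hC b hb
    obtain ⟨y, hy, hyv⟩ := hbV (v c)
      ((LongRay.pt_lt_iff.2 (hbc.trans_le S.level_strictMono.le_apply)).trans (hv c).1)
      ((hv c).2.trans (LongRay.pt_lt_iff.2 ((hK' hd).2 c hcd)))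
    exact ⟨y, hy, c, hc, hyv⟩
  have h1 : u z ≤ LongRay.pt a₁ := by
    refine closure_minimal (fun y hy => ?_) (isClosed_Iic.preimage hu)
      (hcl A (hG d (hH (hK hd))))
    obtain ⟨c, hc, hyc⟩ := hy
    obtain ⟨t, ht, rfl⟩ := hsweep c (max k l) y hyc
    have hkt : (k : ℝ) ≤ t := by
      have : (k : ℝ) ≤ (max k l : ℕ) := by exact_mod_cast le_max_left k l
      linarith [ht.1]
    exact (h₁ _ _ ⟨t, ht⟩ _ (le_of_lt (hA' c hc t hkt))).le
  have h2 : LongRay.pt a₁.next ≤ u z := by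
    refine closure_minimal (fun y hy => ?_) (isClosed_Ici.preimage hu)
      (hcl B (hG' d (hH' (hK hd))))
    obtain ⟨c, hc, hyc⟩ := hy
    obtain ⟨t, ht, rfl⟩ := hsweep c (max k l) y hyc
    have hlt : (l : ℝ) ≤ t := by
      have : (l : ℝ) ≤ (max k l : ℕ) := by exact_mod_cast le_max_right k l
      linarith [ht.1]
    by_contra hcon
    have h3 := hb₁ _ _ _ ⟨t, ht⟩ (not_le.1 hcon).le
    exact lt_asymm h3 (hB' c hc t hlt)
  exact (lt_next a₁).not_ge (LongRay.pt_le_iff.1 (h2.trans h1))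

end TubeSystem.Space

end

/-! ### Slow maps of the long ray and extension over pierced walls -/

noncomputable section

open Om1

instance : DenselyOrdered LongRay := by
  refine ⟨fun x y h => ?_⟩
  rcases LongRay.lt_iff.1 h with h | ⟨h, h'⟩
  · obtain ⟨r, h1, h2⟩ := exists_between (ofLex x).2.2.2
    exact ⟨toLex ((ofLex x).1, ⟨r, (ofLex x).2.2.1.trans h1.le, h2⟩),
      LongRay.lt_iff.2 (Or.inr ⟨rfl, h1⟩), LongRay.lt_iff.2 (Or.inl h)⟩
  · obtain ⟨r, h1, h2⟩ := exists_between h'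
    exact ⟨toLex ((ofLex x).1, r),
      LongRay.lt_iff.2 (Or.inr ⟨rfl, h1⟩), LongRay.lt_iff.2 (Or.inr ⟨h, h2⟩)⟩

/-- There are arbitrarily slow unbounded continuous maps of the long ray to itself. -/
theorem LongRay.exists_slow (G : Om1 → Om1) :
    ∃ φ : LongRay → LongRay, Continuous φ ∧ (∀ a x, x < pt (G a) → φ x ≤ pt a.next) ∧
      ∀ B : Set LongRay, BddAbove (φ '' B) ↔ BddAbove B := by
  obtain ⟨e, b, he⟩ := exists_sparse (Y := Om1) id (fun i y => G i < y)
    fun i b => ⟨max (G i) b |>.next, (le_max_left _ _).trans_lt (lt_next _),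
      (le_max_right _ _).trans_lt (lt_next _)⟩
  have hlt : ∀ {j i}, j < i → e j < e i := fun {j i} h => ((he i).2.2 j h).trans_lt (he i).2.1
  have hmono : StrictMono e := fun _ _ => hlt
  have hρ : ∀ β : Om1, ∃ i, β ≤ e i ∧ ∀ j < i, e j < β := by
    intro β
    obtain ⟨i, hi, hmin⟩ := WellFounded.has_min (wellFounded_lt (α := Om1)) {i | β ≤ e i}
      ⟨β, hmono.le_apply⟩
    exact ⟨i, hi, fun j hj => lt_of_not_ge fun h => hmin j h hj⟩
  choose ρ hρ hρ' using hρ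
  have hρe : ∀ i, ρ (e i) = i := fun i => by
    rcases lt_trichotomy (ρ (e i)) i with h | h | h
    · exact absurd (hρ (e i)) (hlt h).not_ge
    · exact h
    · exact absurd (hρ' (e i) i h) (lt_irrefl _)
  have hρm : Monotone ρ := fun β γ h => by
    by_contra hc
    exact ((hρ' β _ (not_le.1 hc)).trans_le h).not_ge (hρ γ)
  classical
  let z : Ico (0 : ℝ) 1 := ⟨0, le_refl 0, zero_lt_one⟩
  have hz : ∀ r : Ico (0 : ℝ) 1, z ≤ r := fun r => Subtype.coe_le_coe.1 r.2.1
  -- The unit interval starting at `e i` is mapped onto the one starting at `i`, and everything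
  -- between these intervals is collapsed. The map is monotone and surjective, hence continuous.
  let φ : LongRay → LongRay := fun x =>
    toLex (iso (ρ (iso.symm (ofLex x).1)),
      if iso.symm (ofLex x).1 = e (ρ (iso.symm (ofLex x).1)) then (ofLex x).2 else z)
  have hφm : Monotone φ := by
    intro x y h
    rcases le_iff.1 h with h | ⟨h, h'⟩
    · have h1 : iso.symm (ofLex x).1 < iso.symm (ofLex y).1 := iso.symm.lt_iff_lt.2 h
      rcases (hρm h1.le).lt_or_eq with h2 | h2
      · exact le_iff.2 (Or.inl (iso.lt_iff_lt.2 h2))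
      · refine le_iff.2 (Or.inr ⟨congrArg iso h2, ?_⟩)
        have h3 : iso.symm (ofLex x).1 ≠ e (ρ (iso.symm (ofLex x).1)) := by
          rw [h2]
          exact (h1.trans_le (hρ _)).ne
        show (if _ then _ else _) ≤ _
        rw [if_neg h3]
        exact hz _
    · refine le_iff.2 (Or.inr ⟨congrArg (fun w => iso (ρ (iso.symm w))) h, ?_⟩)
      show (if _ then _ else _) ≤ (if _ then _ else _)
      rw [h]
      split_ifs
      · exact h'
      · exact le_rfl
  have hφs : Function.Surjective φ := by
    intro y
    refine ⟨toLex (iso (e (iso.symm (ofLex y).1)), (ofLex y).2), ?_⟩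
    show toLex (iso (ρ (iso.symm (iso (e (iso.symm (ofLex y).1))))), if
      iso.symm (iso (e (iso.symm (ofLex y).1))) = e (ρ (iso.symm (iso (e (iso.symm (ofLex y).1)))))
        then (ofLex y).2 else z) = y
    rw [OrderIso.symm_apply_apply, hρe, if_pos rfl, OrderIso.apply_symm_apply]
    rfl
  refine ⟨φ, hφm.continuous_of_surjective hφs, fun a x hx => ?_, fun B => ⟨fun h => ?_, fun h => ?_⟩⟩
  · have h1 : iso.symm (ofLex x).1 < G a := by
      have := iso.symm.lt_iff_lt.2 (lt_ofOmega1_iff.1 hx)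
      rwa [OrderIso.symm_apply_apply] at this
    have h2 : iso.symm (ofLex x).1 < e a.next :=
      h1.trans ((he a).1.trans (hlt (lt_next a)))
    have h3 : ρ (iso.symm (ofLex x).1) ≤ a.next := by
      by_contra hc
      exact lt_asymm h2 (hρ' _ _ (not_le.1 hc))
    rcases h3.lt_or_eq with h3 | h3
    · exact le_iff.2 (Or.inl (iso.lt_iff_lt.2 h3))
    · refine le_iff.2 (Or.inr ⟨congrArg iso h3, ?_⟩)
      show (if _ then _ else _) ≤ _
      rw [if_neg (by rw [h3]; exact h2.ne)]
      exact hz _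
  · obtain ⟨a, ha⟩ := bddAbove_iff.1 h
    refine bddAbove_iff.2 ⟨e a, fun x hx => lt_of_not_ge fun hc => ?_⟩
    have h1 := (hφm hc).trans_lt (ha _ ⟨x, hx, rfl⟩)
    have h2 := iso.lt_iff_lt.1 (lt_ofOmega1_iff.1 h1)
    have h3 : iso.symm (ofLex (pt (e a))).1 = e a := iso.symm_apply_apply _
    rw [h3, hρe] at h2
    exact lt_irrefl _ h2
  · obtain ⟨a, ha⟩ := h
    refine ⟨φ a, ?_⟩
    rintro _ ⟨x, hx, rfl⟩
    exact hφm (ha hx)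

namespace TubeSystem.Space

variable {N : Type} [TopologicalSpace N] {S : TubeSystem N}

/-- Extending a function on two adjacent slabs, with the help of a function that is large in the
windows of the even walls and small in the windows of the odd walls. -/
theorem exists_extension_of_le {g h : N → LongRay} (hg : Continuous g) (hh : Continuous h)
    {c : LongRay} (hgO : ∀ y ∈ S.O, g y ≤ c) (hhO : ∀ y ∈ S.O, h y ≤ c)
    (heven : ∀ a (x : Plane × ℝ) (k : ℤ), x.2 = 2 * k → g (S.tube a x) ≤ h (S.tube a x))
    (hodd : ∀ a (x : Plane × ℝ) (k : ℤ), x.2 = 2 * k + 1 → h (S.tube a x) ≤ c) (k : ℤ) :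
    ∃ f : S.Space → LongRay, Continuous f ∧
      ∀ p : ↥S.Pierced, |p.1.2 - (2 * k + 1)| ≤ 1 → f (inl p) = max (g p.1.1) c := by
  classical
  let d : ↥S.Pierced → ℝ := fun p => |p.1.2 - (2 * k + 1)|
  have hd : Continuous d := by fun_prop
  -- Distance at most 1 from the odd wall `2 * k + 1` gives the two slabs where `g` is kept. At
  -- distance 1 are even walls, where `g ≤ h` in the windows; at distance 2 are odd walls, where `h
  -- ≤ c` in the windows. In the gates `c` dominates both.
  let f₀ : ↥S.Pierced → LongRay := fun p => if d p ≤ 1 then max (g p.1.1) c else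
    if d p ≤ 2 then min (max (g p.1.1) c) (max (h p.1.1) c) else c
  have hO : ∀ p : ↥S.Pierced, ∀ i : ℤ, p.1.2 = i → p.1.1 ∈ S.O ∨ ∃ a x, p.1 = S.tubeMap a x := by
    rintro ⟨p, (hp | hp) | hp⟩ i hi
    · exact Or.inl hp
    · exact absurd hi (hp i)
    · obtain ⟨a, x, hx⟩ := mem_iUnion.1 hp
      exact Or.inr ⟨a, x, hx.symm⟩
  have hf₀ : Continuous f₀ := by
    have hg' : Continuous fun p : ↥S.Pierced => max (g p.1.1) c := by fun_prop
    have hh' : Continuous fun p : ↥S.Pierced => min (max (g p.1.1) c) (max (h p.1.1) c) := by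
      fun_prop
    refine hg'.if_le (hh'.if_le continuous_const hd continuous_const fun p hp => ?_) hd
      continuous_const fun p hp => ?_
    · suffices h p.1.1 ≤ c by
        rw [max_eq_right this]
        exact min_eq_right (le_max_right _ _)
      obtain ⟨i, hi⟩ : ∃ i : ℤ, p.1.2 = 2 * i + 1 := by
        rcases eq_or_eq_neg_of_abs_eq hp with h | h
        · exact ⟨k + 1, by push_cast; linarith⟩
        · exact ⟨k - 1, by push_cast; linarith⟩
      rcases hO p (2 * i + 1) (by exact_mod_cast hi) with h | ⟨a, x, hx⟩
      · exact hhO _ h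
      · rw [hx] at hi ⊢
        exact hodd a x i hi
    · rw [if_pos (hp.le.trans one_le_two)]
      obtain ⟨i, hi⟩ : ∃ i : ℤ, p.1.2 = 2 * i := by
        rcases eq_or_eq_neg_of_abs_eq hp with h | h
        · exact ⟨k + 1, by push_cast; linarith⟩
        · exact ⟨k, by linarith⟩
      refine (min_eq_left ?_).symm
      rcases hO p (2 * i) (by exact_mod_cast hi) with h | ⟨a, x, hx⟩
      · exact max_le ((hgO _ h).trans (le_max_right _ _)) (le_max_right _ _)
      · rw [hx] at hi ⊢
        exact max_le_max_right c (heven a x i hi)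
  obtain ⟨f, hfl, hfr⟩ : ∃ f : S.Space → LongRay, f ∘ inl = f₀ ∧ ∀ a q, f (inr a q) = c :=
    ⟨Sum.elim f₀ fun _ => c, rfl, fun _ _ => rfl⟩
  refine ⟨f, continuous_iff.2 ⟨hfl ▸ hf₀, fun a => ?_⟩,
    fun p hp => (congrFun hfl p).trans (if_pos hp)⟩
  refine continuous_iff_continuousAt.2 fun x => ?_
  by_cases hx : x.2 = 0
  · refine (continuousAt_const (y := c)).congr ?_
    have hpos : (0 : ℝ) < |2 * (k : ℝ) + 1| + 3 := by positivity
    -- So close to the plane the height is more than 2 away from the wall `2 * k + 1`, where the map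
    -- has the constant value `c`.
    have hU : {y : Plane × ℝ | |y.2| < (|2 * (k : ℝ) + 1| + 3)⁻¹} ∈ 𝓝 x :=
      (isOpen_lt (by fun_prop) continuous_const).mem_nhds (by simpa [hx] using hpos)
    filter_upwards [hU] with y hy
    by_cases hy0 : y.2 = 0
    · rw [Function.comp_apply, chart, if_pos hy0, hfr]
    · rw [Function.comp_apply, chart_of_ne hy0]
      have h1 : |2 * (k : ℝ) + 1| + 3 < |y.2⁻¹| := by
        rw [abs_inv]
        exact (lt_inv_comm₀ (abs_pos.2 hy0) hpos).1 hy
      have h2 : 2 < d ⟨S.tubeMap a (y.1, y.2⁻¹), S.tubeMap_mem _ _⟩ := by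
        have := abs_sub_abs_le_abs_sub (y.2⁻¹) (2 * (k : ℝ) + 1)
        show 2 < |y.2⁻¹ - (2 * k + 1)|
        linarith
      exact ((congrFun hfl _).trans ((if_neg (by linarith)).trans (if_neg (by linarith)))).symm
  · have h1 : ContinuousAt f (inl ⟨S.tubeMap a (x.1, x.2⁻¹), S.tubeMap_mem _ _⟩) :=
      isOpenEmbedding_inl.continuousAt_iff.1 (hfl ▸ hf₀.continuousAt)
    rw [← chart_of_ne hx] at h1
    exact h1.comp (isOpenEmbedding_chart a).continuous.continuousAt

/-- Functions on slabs extend up to slowing down. -/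
theorem exists_extension {h : N → LongRay} (hh : Continuous h) {K : Set N} (hOK : S.O ⊆ K)
    (hK : IsLindelof K) (u : LongRay)
    (heven : ∀ a (x : Plane × ℝ) (k : ℤ), x.2 = 2 * k → LongRay.pt a.next ≤ h (S.tube a x))
    (hodd : ∀ a (x : Plane × ℝ) (k : ℤ), x.2 = 2 * k + 1 → h (S.tube a x) ≤ u)
    (i : ℤ) {g : N → LongRay} (hg : Continuous g) :
    ∃ f : S.Space → LongRay, Continuous f ∧ ∀ A : Set ↥(Gated S.O),
      (∀ p ∈ A, p.1.2 ∈ Ioo (i : ℝ) (i + 1)) →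
        (BddAbove (f '' (gatedMap '' A)) ↔ BddAbove (g '' ((fun p => p.1.1) '' A))) := by
  have hG : ∀ a, ∃ b, ∀ y, S.s y ≤ LongRay.pt (S.level a).next → g y < LongRay.pt b := by
    intro a
    obtain ⟨b, hb⟩ := LongRay.bddAbove_iff.1 (LongRay.bddAbove_image_of_isLindelof hg
      (S.isLindelof_s (S.level a).next))
    exact ⟨b, fun y hy => hb _ ⟨y, hy, rfl⟩⟩
  choose G hG using hG
  -- `G a` bounds `g` up to the top of tube `a`, so that the slowed map is at most `a.next` there
  -- and thus at most `h` in the even windows.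
  obtain ⟨φ, hφ, hφG, hφb⟩ := LongRay.exists_slow G
  obtain ⟨c₁, hc₁⟩ := LongRay.bddAbove_image_of_isLindelof (hφ.comp hg) hK
  obtain ⟨c₂, hc₂⟩ := LongRay.bddAbove_image_of_isLindelof hh hK
  -- The odd wall adjacent to slab `i` is `2 * k + 1`; the map is kept on both sides of it, so its
  -- windows impose no condition.
  obtain ⟨k, hk⟩ : ∃ k : ℤ, i = 2 * k ∨ i = 2 * k + 1 := ⟨i / 2, by omega⟩
  obtain ⟨f, hf, hfg⟩ := exists_extension_of_le (S := S) (hφ.comp hg) hh (c := max (max c₁ c₂) u)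
    (fun y hy => (hc₁ ⟨y, hOK hy, rfl⟩).trans ((le_max_left _ _).trans (le_max_left _ _)))
    (fun y hy => (hc₂ ⟨y, hOK hy, rfl⟩).trans ((le_max_right _ _).trans (le_max_left _ _)))
    (fun a x l hx => (hφG a _ (hG a _ (S.s_tube_lt a x).le)).trans (heven a x l hx))
    (fun a x l hx => (hodd a x l hx).trans (le_max_right _ _)) k
  refine ⟨f, hf, fun A hA => ?_⟩
  rw [← hφb (g '' _), ← image_comp φ g, ← LongRay.bddAbove_image_max (φ ∘ g) (max (max c₁ c₂) u), ← image_comp,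
    ← image_comp]
  refine iff_of_eq (congrArg BddAbove (image_congr fun p hp => hfg _ ?_))
  have := hA p hp
  show |p.1.2 - (2 * k + 1)| ≤ 1
  rw [abs_le]
  rcases hk with rfl | rfl <;> push_cast at this <;> constructor <;> linarith [this.1, this.2]

end TubeSystem.Space

end

/-! ### Paths on the circle and gentle slicers -/

noncomputable section

open Om1

/-- A path on the circle which alternates between two given points and sweeps out the circle in
the middle of each step. -/
theorem Circle.exists_alternating (z₀ z₁ : Circle) :
    ∃ ω : ℝ → Circle, Continuous ω ∧ (∀ k : ℤ, ω (2 * k) = z₀) ∧ (∀ k : ℤ, ω (2 * k + 1) = z₁) ∧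
      ∀ (m : ℕ) (w : Circle), ∃ t ∈ Icc (m + 1 / 3 : ℝ) (m + 2 / 3), ω t = w := by
  obtain ⟨A, rfl⟩ := Circle.exp_surjective z₀
  obtain ⟨B, rfl⟩ := Circle.exp_surjective z₁
  obtain ⟨n, hn⟩ := exists_nat_ge ((A + 4 * Real.pi - B) / (2 * Real.pi))
  rw [div_le_iff₀ Real.two_pi_pos] at hn
  -- The total angle is congruent to `B - A` and at least `4 * π`, so that the middle third of each
  -- step, which covers half of it, still makes a full turn.
  let c : ℝ := B + n * (2 * Real.pi) - A
  have hc : 4 * Real.pi ≤ c := by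
    show _ ≤ B + n * (2 * Real.pi) - A
    linarith
  let θ : ℝ → ℝ := fun t => A + c * ((1 - Real.cos (t * Real.pi)) / 2)
  have hθ : Continuous θ := by fun_prop
  refine ⟨fun t => Circle.exp (θ t), by fun_prop, fun k => ?_, fun k => ?_, fun m w => ?_⟩
  · have : Real.cos (2 * k * Real.pi) = 1 := by
      rw [mul_comm (2 : ℝ), mul_assoc]
      exact Real.cos_int_mul_two_pi k
    show Circle.exp (A + c * ((1 - Real.cos (2 * k * Real.pi)) / 2)) = _
    rw [this, sub_self, zero_div, mul_zero, add_zero]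
  · have : Real.cos ((2 * k + 1) * Real.pi) = -1 := by
      rw [show (2 * k + 1) * Real.pi = k * (2 * Real.pi) + Real.pi by ring]
      exact Real.cos_int_mul_two_pi_add_pi k
    show Circle.exp (A + c * ((1 - Real.cos ((2 * k + 1) * Real.pi)) / 2)) = _
    rw [this, show A + c * ((1 - -1) / 2) = B + n * (2 * Real.pi) by ring_nf; simp [c]; ring]
    exact Circle.periodic_exp.nat_mul n B
  · obtain ⟨x, rfl⟩ := Circle.exp_surjective w
    have e1 : Real.cos ((m + 1 / 3) * Real.pi) = (-1) ^ m * (1 / 2) := by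
      rw [show (m + 1 / 3) * Real.pi = Real.pi / 3 + m * Real.pi by ring,
        Real.cos_add_nat_mul_pi, Real.cos_pi_div_three]
    have e2 : Real.cos ((m + 2 / 3) * Real.pi) = -((-1) ^ m * (1 / 2)) := by
      rw [show (m + 2 / 3) * Real.pi = (Real.pi - Real.pi / 3) + m * Real.pi by ring,
        Real.cos_add_nat_mul_pi, Real.cos_pi_sub, Real.cos_pi_div_three, mul_neg]
    obtain ⟨l, hl, -⟩ := existsUnique_add_zsmul_mem_Ico Real.two_pi_pos x (A + c / 4)
    have hl' : x + l • (2 * Real.pi) ∈ uIcc (θ (m + 1 / 3)) (θ (m + 2 / 3)) := by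
      have h1 : A + c / 4 ≤ x + l • (2 * Real.pi) := hl.1
      have h2 : x + l • (2 * Real.pi) ≤ A + c * (3 / 4) := by linarith [hl.2]
      show _ ∈ uIcc (A + c * ((1 - Real.cos ((m + 1 / 3) * Real.pi)) / 2))
        (A + c * ((1 - Real.cos ((m + 2 / 3) * Real.pi)) / 2))
      rw [e1, e2]
      rcases neg_one_pow_eq_or ℝ m with h | h
      · rw [h]
        exact Icc_subset_uIcc ⟨by linarith, by linarith⟩
      · rw [h]
        exact Icc_subset_uIcc' ⟨by linarith, by linarith⟩
    obtain ⟨t, ht, htx⟩ := intermediate_value_uIcc hθ.continuousOn hl'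
    rw [uIcc_of_le (by linarith)] at ht
    refine ⟨t, ht, ?_⟩
    show Circle.exp (θ t) = _
    rw [htx]
    exact Circle.periodic_exp.zsmul l x

namespace LongRay

theorem zero_le (x : LongRay) : ofOmega1 Omega1.zero ≤ x :=
  ofOmega1_le_iff.2 (Subtype.coe_le_coe.1 _root_.zero_le)

theorem exists_lt_pt_of_isLim {d : Om1} (hd : IsLim d) {x : LongRay} (hx : x < pt d) :
    ∃ a < d, x < pt a := by
  have h : iso.symm (ofLex x).1 < d := by
    have := iso.symm.lt_iff_lt.2 (lt_ofOmega1_iff.1 hx)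
    rwa [OrderIso.symm_apply_apply] at this
  obtain ⟨a, ha, had⟩ := hd.2 _ h
  refine ⟨a, had, lt_ofOmega1_iff.2 ?_⟩
  have := iso.lt_iff_lt.2 ha
  rwa [OrderIso.apply_symm_apply] at this

end LongRay

/-- Maps of an `ω`-bounded space to the long ray that are unbounded on a closed set take the
values given by almost all limit ordinals on that set. -/
theorem OmegaBounded.exists_closure_forall_eq {N : Type} [TopologicalSpace N]
    (hN : OmegaBounded N) {s : N → LongRay} (hs : Continuous s) {K : Set N} (hK : IsClosed K)
    (hub : ∀ a, ∃ y ∈ K, LongRay.pt a < s y) :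
    ∃ G, ∀ d ∈ Closure G, ∃ y ∈ K, s y = LongRay.pt d := by
  choose y hyK hy using hub
  choose G hG using fun a => LongRay.exists_lt_pt (s (y a))
  -- Below a closure point `d` of `G` the values at the chosen points are cofinal in `d`. Their
  -- closure is compact, so the supremum is attained, and it is attained on `K`.
  refine ⟨G, fun d hd => ?_⟩
  have hcpt := (hN (y '' Iio d) ((countable_Iio d).image y)).image hs
  have hlub : IsLUB (s '' (y '' Iio d)) (LongRay.pt d) := by
    refine ⟨?_, fun x hx => le_of_not_gt fun hxd => ?_⟩
    · rintro _ ⟨_, ⟨a, ha, rfl⟩, rfl⟩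
      exact (hG a).le.trans (LongRay.pt_le_iff.2 (hd.2 a ha).le)
    · obtain ⟨a, ha, hxa⟩ := LongRay.exists_lt_pt_of_isLim hd.1 hxd
      exact (hxa.trans (hy a)).not_ge (hx ⟨_, ⟨a, ha, rfl⟩, rfl⟩)
  have hne : (s '' (y '' Iio d)).Nonempty := by
    obtain ⟨b, hb⟩ := hd.1.1
    exact ⟨_, _, ⟨b, hb, rfl⟩, rfl⟩
  obtain ⟨x, hx, hxd⟩ := closure_minimal (image_mono subset_closure) hcpt.isClosed
    (hlub.mem_closure hne)
  refine ⟨x, closure_minimal ?_ hK hx, hxd⟩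
  rintro _ ⟨a, -, rfl⟩
  exact hyK a

section GentleSlicer

variable {N : Type} [TopologicalSpace N] {F : TypeI N} {s : N → LongRay}

/-- In a canonical sequence the first stage containing `y` has a successor index `γ + 1`, so the
slicer is at least `γ` at `y`; hence `γ < a`. -/
theorem TypeI.mem_stage_of_slicer_lt (hF : F.IsCanonical) (hs : F.IsSlicer s) {y : N} {a : Om1}
    (h : s y < LongRay.pt a) : y ∈ F.stage a := by
  obtain ⟨β, hβ, hmin⟩ := WellFounded.has_min (wellFounded_lt (α := Omega1)) {β | y ∈ F.seq β}
    (by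
      obtain ⟨b, hb⟩ := F.exists_mem_stage y
      exact ⟨_, hb⟩)
  have hβ : y ∈ F.seq β := hβ
  have h0 : ¬ IsMin β := fun h => by
    have : β = Omega1.zero :=
      le_antisymm (h (Subtype.coe_le_coe.1 _root_.zero_le)) (Subtype.coe_le_coe.1 _root_.zero_le)
    rw [this, hF.1] at hβ
    exact hβ
  have h1 : ¬ Order.IsSuccLimit β := fun h => by
    rw [hF.2 β h] at hβ
    obtain ⟨γ, hγ, hy⟩ := mem_iUnion₂.1 hβ
    exact hmin γ hy hγ
  obtain ⟨γ, hγ⟩ : ∃ γ, γ ⋖ β := by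
    by_contra hc
    exact h1 ⟨h0, fun γ hγ => hc ⟨γ, hγ⟩⟩
  have hle : β ≤ Omega1.succ γ := le_of_not_gt fun h =>
    hγ.2 (Subtype.coe_lt_coe.1 (Order.lt_succ γ.1)) h
  have hmono : ∀ {α β : Omega1}, α ≤ β → F.seq α ⊆ F.seq β := fun {α β} h => by
    rcases h.eq_or_lt with rfl | h
    · exact subset_rfl
    · exact subset_closure.trans (F.closure_subset _ _ h)
  have h2 := (hs.2 γ y ⟨subset_closure (hmono hle hβ), fun h => hmin γ h hγ.1⟩).1
  have h3 : γ < iso a := LongRay.ofOmega1_lt_iff.1 (h2.trans_lt h)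
  exact hmono (hle.trans (Subtype.coe_le_coe.1 (Order.succ_le_of_lt (Subtype.coe_lt_coe.2 h3)))) hβ

theorem TypeI.isLindelof_slicer_le (hF : F.IsCanonical) (hs : F.IsSlicer s) (a : Om1) :
    IsLindelof {y | s y ≤ LongRay.pt a} :=
  (F.isLindelof_closure_stage a.next).of_isClosed_subset (isClosed_Iic.preimage hs.1)
    fun y (hy : s y ≤ LongRay.pt a) => subset_closure (F.mem_stage_of_slicer_lt hF hs
      (hy.trans_lt (LongRay.pt_lt_iff.2 (lt_next a))))

/-- The parametrization of the part of a surface below a given level of a gentle slicer. -/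
theorem TypeI.IsGentleSlicer.exists_param (hF : F.IsCanonical) (hs : F.IsGentleSlicer s) (a : Om1) :
    ∃ q : Circle × Ioo (LongRay.ofOmega1 Omega1.zero) (LongRay.pt a) → N, IsOpenEmbedding q ∧
      (∀ p, s (q p) = p.2) ∧
      ∀ y, LongRay.ofOmega1 Omega1.zero < s y → s y < LongRay.pt a → y ∈ range q := by
  obtain ⟨h, hh⟩ := hs.2 (iso a)
  have ho : IsOpen (F.seq (iso a) \ s ⁻¹' {LongRay.ofOmega1 Omega1.zero}) :=
    (F.isOpen_seq _).sdiff (isClosed_singleton.preimage hs.1.1)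
  refine ⟨fun p => (h.symm p).1, ho.isOpenEmbedding_subtypeVal.comp h.symm.isOpenEmbedding,
    fun p => ?_, fun y h0 ha => ?_⟩
  · exact (hh _).symm.trans (congrArg (fun x => (x.2 : LongRay)) (h.apply_symm_apply p))
  · exact ⟨h ⟨y, F.mem_stage_of_slicer_lt hF hs.1 ha, fun h => h0.ne' h⟩, by simp⟩

/-- The point `z` is at level `d` on a vertical line of the parametrization, and that line passes
through all levels just below `d` inside any neighbourhood of `z`. -/
theorem TypeI.IsGentleSlicer.exists_limit (hF : F.IsCanonical) (hs : F.IsGentleSlicer s) {d : Om1}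
    (hd : IsLim d) : ∃ z, ∀ V ∈ 𝓝 z, ∃ b < d, ∀ w, LongRay.pt b < w → w < LongRay.pt d →
      ∃ y ∈ V, s y = w := by
  obtain ⟨q, hq, hqs, -⟩ := hs.exists_param hF d.next
  obtain ⟨c, hc⟩ := hd.1
  have h0 : LongRay.ofOmega1 Omega1.zero < LongRay.pt d :=
    (LongRay.zero_le _).trans_lt (LongRay.pt_lt_iff.2 hc)
  have hdn := LongRay.pt_lt_iff.2 (lt_next d)
  refine ⟨q (1, ⟨LongRay.pt d, h0, hdn⟩), fun V hV => ?_⟩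
  obtain ⟨x, hx, hxd⟩ := exists_between h0
  have hcont : Continuous fun x => q (1, x) := hq.continuous.comp (by fun_prop)
  obtain ⟨l, hl, hlV⟩ := exists_Ioc_subset_of_mem_nhds (hcont.continuousAt.preimage_mem_nhds hV)
    ⟨⟨x, hx, hxd.trans hdn⟩, hxd⟩
  obtain ⟨b, hb, hlb⟩ := LongRay.exists_lt_pt_of_isLim hd hl
  refine ⟨b, hb, fun w hbw hwd => ?_⟩
  have hw : w ∈ Ioo (LongRay.ofOmega1 Omega1.zero) (LongRay.pt d.next) :=
    ⟨(LongRay.zero_le _).trans_lt hbw, hwd.trans hdn⟩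
  exact ⟨q (1, ⟨w, hw⟩), hlV ⟨show l.1 < w from hlb.trans hbw, show w ≤ _ from hwd.le⟩, hqs _⟩

end GentleSlicer

end

/-! ### Construction of the tubes and of the 3-manifold -/

noncomputable section

open Om1

/-- A tube winding around in an annulus, with windows where a function is large in even walls, and
small in odd walls. -/
theorem exists_tube {N : Type} [TopologicalSpace N] (hN : LocEuclidean 2 N) {s h : N → LongRay}
    (hh : Continuous h) {z l r c₀ c₁ : LongRay} (hzl : z < l) (hlr : l < r)
    {q : Circle × Ioo z r → N} (hq : IsOpenEmbedding q) (hqs : ∀ p, s (q p) = p.2)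
    (hqr : ∀ y, z < s y → s y < r → y ∈ range q) {y₀ y₁ : N} (hy₀ : s y₀ = l) (hy₁ : s y₁ = l)
    (hc₀ : c₀ < h y₀) (hc₁ : h y₁ < c₁) :
    ∃ (v : LongRay) (T : Plane × ℝ → N), (l < v ∧ v < r) ∧
      IsOpenEmbedding (fun x : Plane × ℝ => (T x, x.2)) ∧ (∀ x, l < s (T x) ∧ s (T x) < r) ∧
      (∀ (x : Plane × ℝ) (k : ℤ), x.2 = 2 * k → c₀ ≤ h (T x)) ∧
      (∀ (x : Plane × ℝ) (k : ℤ), x.2 = 2 * k + 1 → h (T x) ≤ c₁) ∧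
      ∀ (m : ℕ) y, s y = v → ∃ t ∈ Icc (m + 1 / 3 : ℝ) (m + 2 / 3), T (0, t) = y := by
  have hlift : ∀ y, s y = l → ∃ w : Circle, q (w, ⟨l, hzl, hlr⟩) = y := by
    rintro y hy
    obtain ⟨⟨w, x⟩, rfl⟩ := hqr y (hy ▸ hzl) (hy ▸ hlr)
    rw [hqs] at hy
    exact ⟨w, congrArg (fun x => q (w, x)) (Subtype.ext hy.symm)⟩
  obtain ⟨w₀, rfl⟩ := hlift y₀ hy₀
  obtain ⟨w₁, rfl⟩ := hlift y₁ hy₁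
  have hqc := hq.continuous
  -- Positions whose rotations by `w₀` and by `w₁` satisfy the conditions for even and odd windows.
  -- The position `(1, l)` qualifies, and by openness so does one at a level `v` slightly higher.
  let V : Set (Circle × Ioo z r) :=
    {p | c₀ < h (q (w₀ * p.1, p.2)) ∧ h (q (w₁ * p.1, p.2)) < c₁}
  have hw : ∀ w : Circle, Continuous fun p : Circle × Ioo z r => h (q (w * p.1, p.2)) :=
    fun w => by fun_prop
  have hV : IsOpen V :=
    (isOpen_lt continuous_const (hw w₀)).inter (isOpen_lt (hw w₁) continuous_const)
  obtain ⟨v, ⟨hv, hvr⟩, hvV⟩ : ∃ v : LongRay, ∃ hv : l < v ∧ v < r,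
      ((1 : Circle), (⟨v, hzl.trans hv.1, hv.2⟩ : Ioo z r)) ∈ V := by
    have hc : Continuous fun x : Ioo z r => ((1 : Circle), x) := by fun_prop
    have hU : {x : Ioo z r | ((1 : Circle), x) ∈ V} ∈ 𝓝 (⟨l, hzl, hlr⟩ : Ioo z r) :=
      (hV.preimage hc).mem_nhds (by simpa [V] using ⟨hc₀, hc₁⟩)
    obtain ⟨r', hlr', hr'⟩ := exists_between hlr
    obtain ⟨u, hu, hus⟩ := exists_Ico_subset_of_mem_nhds hU
      ⟨⟨r', hzl.trans hlr', hr'⟩, hlr'⟩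
    obtain ⟨v, hv, hvu⟩ := exists_between hu
    exact ⟨v.1, ⟨hv, v.2.2⟩, hus ⟨hv.le, hvu⟩⟩
  let V' : Set (Circle × Ioo z r) := V ∩ {p | l < p.2.1}
  have hV' : IsOpen V' := hV.inter (isOpen_lt continuous_const (by fun_prop))
  obtain ⟨e, he, he0, heV⟩ := (hN.of_isOpenEmbedding hq).exists_subset
    (hV'.mem_nhds ⟨hvV, hv⟩)
  obtain ⟨ω, hω, hω₀, hω₁, hωs⟩ := Circle.exists_alternating w₀ w₁
  have heV' : ∀ p, e p ∈ V' := fun p => heV (mem_range_self p)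
  -- A small disc in `V'` is rotated by `ω`. Rotating at each height is a homeomorphism of the
  -- annulus times the line, so the tube is openly embedded.
  let T : Plane × ℝ → N := fun x => q (ω x.2 * (e x.1).1, (e x.1).2)
  let R : (Circle × Ioo z r) × ℝ ≃ₜ (Circle × Ioo z r) × ℝ :=
    { toFun := fun p => ((ω p.2 * p.1.1, p.1.2), p.2)
      invFun := fun p => (((ω p.2)⁻¹ * p.1.1, p.1.2), p.2)
      left_inv := fun p => by simp
      right_inv := fun p => by simp
      continuous_toFun := by fun_prop
      continuous_invFun := by fun_prop }
  refine ⟨v, T, ⟨hv, hvr⟩, ?_, fun x => ?_, fun x k hx => ?_, fun x k hx => ?_, fun m y hy => ?_⟩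
  · exact (hq.prodMap .id).comp (R.isOpenEmbedding.comp (he.prodMap .id))
  · show l < s (q _) ∧ s (q _) < r
    rw [hqs]
    exact ⟨(heV' x.1).2, (e x.1).2.2.2⟩
  · show c₀ ≤ h (q (ω x.2 * _, _))
    rw [hx, hω₀]
    exact (heV' x.1).1.1.le
  · show h (q (ω x.2 * _, _)) ≤ c₁
    rw [hx, hω₁]
    exact (heV' x.1).1.2.le
  · obtain ⟨⟨w, x⟩, rfl⟩ := hqr y (hy ▸ hzl.trans hv) (hy ▸ hvr)
    rw [hqs] at hy
    obtain ⟨t, ht, rfl⟩ := hωs m w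
    refine ⟨t, ht, ?_⟩
    show q (ω t * (e 0).1, (e 0).2) = _
    rw [he0]
    exact congrArg q (Prod.ext (mul_one _) (Subtype.ext hy.symm))

/-- A directionless surface with a gentle slicer gives rise to a 3-manifold. -/
theorem IsDirectionlessSurface.exists_threeManifold {N : Type} [TopologicalSpace N]
    (hN : IsDirectionlessSurface N) (hs : HasGentleSlicer N) :
    ∃ (X : Type) (_ : TopologicalSpace X) (F : TypeI X) (M : Set X),
      F.DirectionsContainDiscrete M ∧ IsManifoldUnionOmegaBounded M ∧ IsTopManifold X 3 := by
  obtain ⟨hman, hω, F', hF'⟩ := hN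
  obtain ⟨F, hF, s, hs⟩ := hs
  obtain ⟨_, _, hloc⟩ := isTopManifold_iff.1 hman
  obtain ⟨κ, hκ⟩ := hloc.exists_annulus
  have hsL := F.isLindelof_slicer_le hF hs.1
  have huniv : ¬ F'.IsDirection univ := hF' univ
  -- The whole surface is not a direction, and this supplies the map `h` used for the windows.
  obtain ⟨h, hh, hhu, C, hC, hhC⟩ : ∃ h : N → LongRay, Continuous h ∧ ¬ BddAbove (range h) ∧
      ∃ C, F'.IsClub C ∧ BddAbove (h '' C) := by
    simp only [TypeI.IsDirection, not_and, not_forall] at huniv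
    obtain ⟨C, -, hC, hnot⟩ := huniv ⟨isClosed_univ, F'.unbounded_univ⟩
    have : ¬ UfoLE univ C := fun h' => hnot h' fun f _ hb hb' => hb (hb'.mono (image_mono (subset_univ C)))
    simp only [UfoLE, not_forall, not_not] at this
    obtain ⟨h, hh, h1, h2⟩ := this
    exact ⟨h, hh, by rwa [← image_univ], C, hC, h2⟩
  obtain ⟨u, hu⟩ := LongRay.bddAbove_iff.1 hhC
  have hlow : ∀ a, ∃ y ∈ C, LongRay.pt a < s y := by
    intro a
    have := (TypeI.unbounded_iff _).1 (TypeI.unbounded_congr F' F hC.2) a.next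
    obtain ⟨y, hy, hya⟩ := this
    refine ⟨y, hy, lt_of_not_ge fun hc => hya (F.mem_stage_of_slicer_lt hF hs.1 ?_)⟩
    exact hc.trans_lt (LongRay.pt_lt_iff.2 (lt_next a))
  have hhigh : ∀ w a, ∃ y ∈ {y | LongRay.pt w ≤ h y}, LongRay.pt a < s y := by
    intro w a
    obtain ⟨b, hb⟩ := LongRay.bddAbove_iff.1 (LongRay.bddAbove_image_of_isLindelof hh (hsL a))
    by_contra! hc
    refine hhu (LongRay.bddAbove_iff.2 ⟨max w b, ?_⟩)
    rintro _ ⟨y, rfl⟩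
    by_contra hy
    have hy := not_lt.1 hy
    have h1 := hc y ((LongRay.pt_le_iff.2 (le_max_left w b)).trans hy)
    exact (hb _ ⟨y, h1, rfl⟩).not_ge ((LongRay.pt_le_iff.2 (le_max_right w b)).trans hy)
  obtain ⟨G, hG⟩ := hω.exists_closure_forall_eq hs.1.1 hC.1 hlow
  choose H hH using fun w =>
    hω.exists_closure_forall_eq hs.1.1 (isClosed_Ici.preimage hh) (hhigh w)
  -- At almost every limit level `h` is bounded by `u` at some point and large at another. Levels
  -- are positive, to lie in the parametrized part; `a.next.next` yields the strict inequality that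
  -- survives thickening.
  obtain ⟨level, b, hlev⟩ := exists_sparse (Y := Om1) id (fun a l => (∃ c, c < l) ∧
    (∃ y, s y = LongRay.pt l ∧ LongRay.pt a.next < h y) ∧ ∃ y, s y = LongRay.pt l ∧
      h y < LongRay.pt u) fun a b => by
    obtain ⟨K, hK, hK'⟩ := exists_closure_subset_two G (H a.next.next)
    obtain ⟨d, hd, hbd⟩ := exists_mem_closure K b
    obtain ⟨y₁, hy₁, hs₁⟩ := hG d (hK hd)
    obtain ⟨y₀, hy₀, hs₀⟩ := hH _ d (hK' hd)
    exact ⟨d, ⟨⟨b, hbd⟩, ⟨y₀, hs₀, (LongRay.pt_lt_iff.2 (lt_next _)).trans_le hy₀⟩,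
      y₁, hs₁, hu _ ⟨y₁, hy₁, rfl⟩⟩, hbd⟩
  choose c hc using fun a => (hlev a).1.1
  choose y₀ hs₀ hy₀ using fun a => (hlev a).1.2.1
  choose y₁ hs₁ hy₁ using fun a => (hlev a).1.2.2
  choose q hq hqs hqr using fun a => hs.exists_param hF (level a).next
  choose v T hv hTo hTs hTe hTd hTv using fun a => exists_tube hloc hh
    ((LongRay.zero_le _).trans_lt (LongRay.pt_lt_iff.2 (hc a)))
    (LongRay.pt_lt_iff.2 (lt_next (level a))) (hq a) (hqs a) (hqr a) (hs₀ a) (hs₁ a) (hy₀ a)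
    (hy₁ a)
  let S : TubeSystem N :=
    { O := range κ
      isOpen_O := hκ.isOpen_range
      isConnected_O := isConnected_range hκ.continuous
      s := s
      continuous_s := hs.1.1
      isLindelof_s := hsL
      level := level
      level_strictMono := fun a b h => ((hlev b).2.2 a h).trans_lt (hlev b).2.1
      tube := T
      isOpenEmbedding_tube := hTo
      lt_s_tube := fun a x => (hTs a x).1
      s_tube_lt := fun a x => (hTs a x).2 }
  have hT2 : T2Space S.Space := inferInstance
  have hloc3 : LocEuclidean 3 S.Space := TubeSystem.Space.locEuclidean hloc
  have hfc := hloc3.locallyMetrizable.firstCountable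
  have hj := (TubeSystem.Space.isOpenEmbedding_gatedMap (S := S)).toIsEmbedding
  obtain ⟨hM, hc⟩ := isManifoldUnionOmegaBounded_gated hloc hω hκ hj
  refine ⟨S.Space, inferInstance, TubeSystem.Space.typeI hloc S, _,
    ⟨⟨hT2, hloc3.locallyMetrizable, hloc3.locallySeparable, _,
      TubeSystem.Space.isDirection_centres hloc hω hv (fun a m y => hTv a m y)
        fun d hd => hs.exists_limit hF hd,
      (TubeSystem.Space.isClubDiscrete_centres hloc).2⟩,
      TubeSystem.Space.dense_range_gatedMap, hc, fun D hD => ?_⟩, hM,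
    isTopManifold_iff.2 ⟨hT2, TubeSystem.Space.connectedSpace, hloc3⟩⟩
  exact exists_isClubDiscrete_of_slabs hloc hω hF' hκ hj
    (fun E _ hE => TubeSystem.Space.exists_isClubDiscrete_subset hloc hE)
    (fun i g hg => TubeSystem.Space.exists_extension (S := S) hh subset_rfl
      (isLindelof_of_subset_range hκ.continuous subset_rfl) (LongRay.pt u) hTe hTd i hg) hD

end

theorem theorem7p7 :
    (∃ (X : Type) (_ : TopologicalSpace X) (F : TypeI X), F.ClubsContainDiscrete) ∧
    (DiamondStar →
      ∃ (X : Type) (_ : TopologicalSpace X) (F : TypeI X),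
        F.ClubsContainDiscrete ∧ CollectionwiseHausdorff X) ∧
    (NotSH →
      ∃ (X : Type) (_ : TopologicalSpace X) (F : TypeI X) (M : Set X),
        F.DirectionsContainDiscrete M) ∧
    (NyikosClaim → DiamondPlus →
      (∃ (X : Type) (_ : TopologicalSpace X) (F : TypeI X) (M : Set X),
        F.DirectionsContainDiscrete M ∧ IsManifoldUnionOmegaBounded M) ∧
      (∀ (N : Type) [TopologicalSpace N], IsDirectionlessSurface N → HasGentleSlicer N →
        ∃ (X : Type) (_ : TopologicalSpace X) (F : TypeI X) (M : Set X),
          F.DirectionsContainDiscrete M ∧ IsManifoldUnionOmegaBounded M ∧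
            IsTopManifold X 3)) := by
  refine ⟨?_, DiamondStar.exists_collectionwiseHausdorff, ?_, ?_⟩
  · obtain ⟨X, t, F, M, h, -⟩ := StatSpace.exists_clubsContainDiscrete
    exact ⟨X, t, F, h⟩
  · intro _
    obtain ⟨X, t, F, M, -, h⟩ := StatSpace.exists_clubsContainDiscrete
    exact ⟨X, t, F, M, h⟩
  · intro hNy hd
    refine ⟨?_, fun N _ hN hs => ?_⟩
    · obtain ⟨N, _, hN⟩ := hNy hd
      exact hN.exists_directionsContainDiscrete
    · exact hN.exists_threeManifold hs
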